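/- Let $D\ge 0$ and $N\ge 2$ be integers. For $p\ge 0$ let $Y^N_p$ be the Young diagram with $p$ cells all of whose rows have $N-1$ cells, except possibly the last one, and let $\mathbf Y_p$ be the Young symmetrizer of $Y^N_p$ acting on covariant tensors of degree $p$ on $\mathbb R^D$ (symmetrization over the rows, followed by antisymmetrization over the columns, normalized to be a projection; the cells are numbered along successive rows, and the slots $\mu_1,\dots,\mu_p$ occupy them in decreasing order, so that $\mu_1$ is in the last cell). Let $\Omega^p_N(\mathbb R^D)$ be the real vector space of smooth covariant tensor fields of degree $p$ on $\mathbb R^D$ whose value at every point lies in the image of $\mathbf Y_p$, and let $d=\mathbf Y_{p+1}\circ\partial:\Omega^p_N(\mathbb R^D)\to\Omega^{p+1}_N(\mathbb R^D)$, where $(\partial T)_{\mu_1\cdots\mu_{p+1}}=\partial_{\mu_1}T_{\mu_2\cdots\mu_{p+1}}$. Then $d^N=0$. For $1\le k\le N-1$ and $p\ge 0$ put $$H^p_{(k)}=\frac{\operatorname{Ker}\big(d^k:\Omega_N^p(\mathbb R^D)\to\Omega_N^{p+k}(\mathbb R^D)\big)}{d^{N-k}\big(\Omega_N^{p+k-N}(\mathbb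 R^D)\big)},$$ where $\Omega_N^{q}=0$ for $q<0$. Let $[i]:H^p_{(k)}\to H^p_{(k+1)}$ be the map induced by the inclusion $\operatorname{Ker}(d^k)\subset\operatorname{Ker}(d^{k+1})$, and $[d]:H^p_{(k+1)}\to H^{p+1}_{(k)}$ the map induced by $d:\operatorname{Ker}(d^{k+1})\to\operatorname{Ker}(d^k)$, for $1\le k\le N-2$. (a) For all integers $k,\ell\ge 1$ with $k+\ell\le N-1$ the sequence $$0\longrightarrow H^{k-1}_{(\ell)}\xrightarrow{[i]^{N-k-\ell}}H^{k-1}_{(N-k)}\xrightarrow{[d]^{\ell}}H^{k+\ell-1}_{(N-k-\ell)}\xrightarrow{[i]^{k}}H^{k+\ell-1}_{(N-\ell)}\longrightarrow 0$$ is exact. (b) For $N=3$ and every $n\ge 1$ the map $[i]:H^{2n+1}_{(1)}\to H^{2n+1}_{(2)}$ is an isomorphism. -/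

import Mathlib

/-! ### Generalized cohomology of a graded space with a degree-one operator -/

namespace NComplex

section Cohomology

variable {E : ℕ → Type*} [∀ p, AddCommGroup (E p)] [∀ p, Module ℝ (E p)]
  (d : ∀ p, E p →ₗ[ℝ] E (p + 1))

/-- The power `d ^ j : E p → E (p + j)`. -/
def dPow : (j p : ℕ) → E p →ₗ[ℝ] E (p + j)
  | 0, _ => LinearMap.id
  | j + 1, p => (d (p + j)).comp (dPow j p)

/-- The image `d ^ m (E (p - m))` inside `E p`, which is zero when `p < m`
(see `dImage_add` and `dImage_of_lt`). -/
def dImage : (m p : ℕ) → Submodule ℝ (E p)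
  | 0, _ => ⊤
  | _ + 1, 0 => ⊥
  | m + 1, p + 1 => (dImage m p).map (d p)

theorem dImage_add (m q : ℕ) : dImage d m (q + m) = LinearMap.range (dPow d m q) := by
  induction m with
  | zero => exact LinearMap.range_id.symm
  | succ m ih =>
    change (dImage d m (q + m)).map (d (q + m)) = LinearMap.range ((d (q + m)).comp (dPow d m q))
    rw [ih, LinearMap.range_comp]

theorem dImage_of_lt (m p : ℕ) (h : p < m) : dImage d m p = ⊥ := by
  induction m generalizing p with
  | zero => omega
  | succ m ih =>
    cases p with
    | zero => rfl
    | succ p =>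
      change (dImage d m p).map (d p) = ⊥
      rw [ih p (by omega), Submodule.map_bot]

theorem dPow_dPow_heq (j k p : ℕ) (T : E p) :
    HEq (dPow d k (p + j) (dPow d j p T)) (dPow d (j + k) p T) := by
  induction k with
  | zero => rfl
  | succ k ih =>
    change HEq (d (p + j + k) (dPow d k (p + j) (dPow d j p T)))
      (d (p + (j + k)) (dPow d (j + k) p T))
    generalize dPow d k (p + j) (dPow d j p T) = a at ih ⊢
    generalize dPow d (j + k) p T = b at ih ⊢
    revert a b
    rw [Nat.add_assoc p j k]
    rintro a b h
    rw [eq_of_heq h]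

theorem dPow_dPow_eq_zero {j k p : ℕ} {T : E p} (h : dPow d (j + k) p T = 0) :
    dPow d k (p + j) (dPow d j p T) = 0 := by
  have h1 := dPow_dPow_heq d j k p T
  rw [h] at h1
  generalize dPow d k (p + j) (dPow d j p T) = a at h1 ⊢
  clear h
  revert a
  rw [Nat.add_assoc p j k]
  intro a h
  exact eq_of_heq h

theorem ker_dPow_mono {k k' : ℕ} (h : k ≤ k') (p : ℕ) :
    LinearMap.ker (dPow d k p) ≤ LinearMap.ker (dPow d k' p) := by
  induction k', h using Nat.le_induction with
  | base => exact le_rfl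
  | succ m _ ih =>
    intro T hT
    have hm : dPow d m p T = 0 := ih hT
    change d (p + m) (dPow d m p T) = 0
    rw [hm, map_zero]

theorem dImage_succ_le (m p : ℕ) : dImage d (m + 1) p ≤ dImage d m p := by
  induction m generalizing p with
  | zero => exact le_top
  | succ m ih =>
    cases p with
    | zero => exact bot_le
    | succ p => exact Submodule.map_mono (ih p)

theorem dImage_anti {m m' : ℕ} (h : m ≤ m') (p : ℕ) : dImage d m' p ≤ dImage d m p :=
  antitone_nat_of_succ_le (f := fun m => dImage d m p) (fun m => dImage_succ_le d m p) h

theorem dPow_mem_dImage {m p : ℕ} (j : ℕ) {T : E p} (hT : T ∈ dImage d m p) :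
    dPow d j p T ∈ dImage d (m + j) (p + j) := by
  induction j with
  | zero => exact hT
  | succ j ih => exact Submodule.mem_map_of_mem ih

/-- The generalized cohomology
`H^p_(k) = Ker (d ^ k : E p → E (p + k)) / d ^ (N - k) (E (p + k - N))`, for `1 ≤ k ≤ N - 1`.
When `d ^ N = 0` the image on the right is contained in the kernel. -/
abbrev H (N k p : ℕ) : Type _ :=
  LinearMap.ker (dPow d k p) ⧸ (dImage d (N - k) p).submoduleOf (LinearMap.ker (dPow d k p))

/-- For `k ≤ k'`, the map `H^p_(k) → H^p_(k')` induced by the inclusions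
`Ker (d ^ k) ⊆ Ker (d ^ k')` and `Im (d ^ (N - k)) ⊆ Im (d ^ (N - k'))`. For `k' = k + 1` it is
the map `[i]`, and in general it is the power `[i] ^ (k' - k)` (see `iPow_self`, `iPow_succ`). -/
def iPow (N p : ℕ) {k k' : ℕ} (h : k ≤ k') : H d N k p →ₗ[ℝ] H d N k' p :=
  Submodule.mapQ _ _ (Submodule.inclusion (ker_dPow_mono d h p))
    (fun _ hT => dImage_anti d (Nat.sub_le_sub_left h N) p hT)

/-- For `k' + j = k`, the map `H^p_(k) → H^(p+j)_(k')` induced by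
`d ^ j : Ker (d ^ k) → Ker (d ^ k')`. For `j = 1` it is the map `[d]`, and in general it is the
power `[d] ^ j` (see `hdPow_zero`, `hdPow_succ`). -/
def hdPow (N p : ℕ) (j : ℕ) {k k' : ℕ} (h : k' + j = k) :
    H d N k p →ₗ[ℝ] H d N k' (p + j) :=
  Submodule.mapQ _ _
    ((dPow d j p).restrict (p := LinearMap.ker (dPow d k p))
      (q := LinearMap.ker (dPow d k' (p + j)))
      (fun T hT => dPow_dPow_eq_zero d (j := j) (k := k')
        (by rw [Nat.add_comm j k', h]; exact hT)))
    (fun _ hT => dImage_anti d (by omega : N - k' ≤ N - k + j) (p + j)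
      (dPow_mem_dImage d j hT))

theorem iPow_self (N p k : ℕ) : iPow d N p (le_refl k) = LinearMap.id := by
  ext; rfl

theorem iPow_succ (N p : ℕ) {k k' : ℕ} (h : k ≤ k') :
    iPow d N p (Nat.le_succ_of_le h) = (iPow d N p (Nat.le_succ k')).comp (iPow d N p h) := by
  ext; rfl

theorem hdPow_zero (N p k : ℕ) : hdPow d N p 0 (Nat.add_zero k) = LinearMap.id := by
  ext; rfl

theorem hdPow_succ (N p j : ℕ) {k k' : ℕ} (h : k' + (j + 1) = k) :
    hdPow d N p (j + 1) h =
      (hdPow d N (p + j) 1 rfl).comp (hdPow d N p j (k' := k' + 1) (by omega)) := by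
  ext; rfl

end Cohomology

/-! ### The `N`-complex of tensor fields on `ℝ^D` -/

/-- Components `T_{μ₁ ⋯ μ_p}` of a covariant tensor of degree `p` on `ℝ^D`. -/
abbrev Tensor (D p : ℕ) : Type := (Fin p → Fin D) → ℝ

/-- The cells of the diagram `Y^N_p` (all rows of length `N - 1`, except possibly the last one)
are numbered `0, …, p - 1` along the rows, from top to bottom. The tensor slots `μ₁, …, μ_p`
occupy the cells in decreasing order, so that the slot `μ₁`, in which a derivative is inserted,
is the last cell of `Y^N_p` and the other slots keep the cells they have in `Y^N_{p-1}`.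
`rowOf N j` is the row of the cell of slot `j`. -/
def rowOf (N : ℕ) {p : ℕ} (j : Fin p) : ℕ := (j.rev : ℕ) / (N - 1)

/-- The column of the cell of slot `j` in `Y^N_p`. -/
def colOf (N : ℕ) {p : ℕ} (j : Fin p) : ℕ := (j.rev : ℕ) % (N - 1)

/-- Permutations of the slots that preserve every row of `Y^N_p`. -/
def rowPerms (N p : ℕ) : Finset (Equiv.Perm (Fin p)) :=
  Finset.univ.filter fun σ => ∀ j, rowOf N (σ j) = rowOf N j

/-- Permutations of the slots that preserve every column of `Y^N_p`. -/
def colPerms (N p : ℕ) : Finset (Equiv.Perm (Fin p)) :=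
  Finset.univ.filter fun σ => ∀ j, colOf N (σ j) = colOf N j

/-- The hook length (arm + leg + 1) of the cell of slot `j` in `Y^N_p`. -/
def hookLength (N : ℕ) {p : ℕ} (j : Fin p) : ℕ :=
  (Finset.univ.filter fun i : Fin p => rowOf N i = rowOf N j ∧ colOf N j ≤ colOf N i).card +
  (Finset.univ.filter fun i : Fin p => colOf N i = colOf N j ∧ rowOf N j < rowOf N i).card

/-- The Young symmetrizer of `Y^N_p`: symmetrize over the rows, then antisymmetrize over the
columns, and divide by the product of the hook lengths, which makes it a projection. -/
noncomputable def youngSymmetrizer (N D p : ℕ) : Tensor D p →ₗ[ℝ] Tensor D p where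
  toFun T := fun μ => (∏ j : Fin p, (hookLength N j : ℝ))⁻¹ *
    ∑ τ ∈ colPerms N p, ((Equiv.Perm.sign τ : ℤ) : ℝ) * ∑ σ ∈ rowPerms N p, T ((μ ∘ τ) ∘ σ)
  map_add' S T := by
    funext μ
    simp only [Pi.add_apply, Finset.sum_add_distrib, mul_add]
  map_smul' c T := by
    funext μ
    simp only [Pi.smul_apply, smul_eq_mul, ← Finset.mul_sum, RingHom.id_apply]
    rw [mul_left_comm c, Finset.mul_sum (a := c)]
    congr 1
    exact Finset.sum_congr rfl fun τ _ => mul_left_comm _ _ _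

/-- `Ω_N^p(ℝ^D)`: smooth covariant tensor fields of degree `p` on `ℝ^D` with values in the
tensors of Young symmetry type `Y^N_p`. -/
noncomputable def Omega (N D p : ℕ) : Submodule ℝ ((Fin D → ℝ) → Tensor D p) where
  carrier := {T | ContDiff ℝ ((⊤ : ℕ∞) : WithTop ℕ∞) T ∧
    ∀ x, T x ∈ LinearMap.range (youngSymmetrizer N D p)}
  add_mem' hS hT := ⟨hS.1.add hT.1, fun x => Submodule.add_mem _ (hS.2 x) (hT.2 x)⟩
  zero_mem' := ⟨contDiff_const, fun _ => Submodule.zero_mem _⟩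
  smul_mem' c _ hT := ⟨contDiff_const.smul hT.1, fun x => Submodule.smul_mem _ c (hT.2 x)⟩

/-- The tensor field `∂T`, with components `∂_{μ₁} T_{μ₂ ⋯ μ_{p+1}}`. -/
noncomputable def partialD {D p : ℕ} (T : (Fin D → ℝ) → Tensor D p) :
    (Fin D → ℝ) → Tensor D (p + 1) :=
  fun x μ => fderiv ℝ (fun y => T y (Fin.tail μ)) x (Pi.single (μ 0) 1)

theorem contDiff_component {D p : ℕ} {T : (Fin D → ℝ) → Tensor D p}
    (hT : ContDiff ℝ ((⊤ : ℕ∞) : WithTop ℕ∞) T) (μ : Fin p → Fin D) :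
    ContDiff ℝ ((⊤ : ℕ∞) : WithTop ℕ∞) (fun y => T y μ) :=
  contDiff_pi.1 hT μ

theorem contDiff_partialD {D p : ℕ} {T : (Fin D → ℝ) → Tensor D p}
    (hT : ContDiff ℝ ((⊤ : ℕ∞) : WithTop ℕ∞) T) :
    ContDiff ℝ ((⊤ : ℕ∞) : WithTop ℕ∞) (partialD T) := by
  refine contDiff_pi.2 fun μ => ?_
  exact ((contDiff_component hT (Fin.tail μ)).fderiv_right (by simp)).clm_apply contDiff_const

/-- The differential `d = Y_{p+1} ∘ ∂ : Ω_N^p(ℝ^D) → Ω_N^{p+1}(ℝ^D)`. -/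
noncomputable def dOmega (N D p : ℕ) : Omega N D p →ₗ[ℝ] Omega N D (p + 1) where
  toFun T := ⟨fun x => youngSymmetrizer N D (p + 1) (partialD T.1 x),
    (LinearMap.toContinuousLinearMap (youngSymmetrizer N D (p + 1))).contDiff.comp
      (contDiff_partialD T.2.1),
    fun _ => LinearMap.mem_range_self _ _⟩
  map_add' S T := by
    apply Subtype.ext
    funext x
    have h : partialD ((S + T : Omega N D p) : (Fin D → ℝ) → Tensor D p) x =
        partialD S.1 x + partialD T.1 x := by
      funext μ
      exact congrArg (fun L => L (Pi.single (μ 0) 1)) (fderiv_fun_add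
        ((contDiff_component S.2.1 _).differentiable (by simp) x)
        ((contDiff_component T.2.1 _).differentiable (by simp) x))
    change youngSymmetrizer N D (p + 1) (partialD ((S + T : Omega N D p) : _ → _) x) = _
    rw [h, map_add]
    rfl
  map_smul' c T := by
    apply Subtype.ext
    funext x
    have h : partialD ((c • T : Omega N D p) : (Fin D → ℝ) → Tensor D p) x =
        c • partialD T.1 x := by
      funext μ
      exact congrArg (fun L => L (Pi.single (μ 0) 1)) (fderiv_fun_const_smul
        ((contDiff_component T.2.1 _).differentiable (by simp) x) c)
    change youngSymmetrizer N D (p + 1) (partialD ((c • T : Omega N D p) : _ → _) x) = _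
    rw [h, map_smul]
    rfl

end NComplex

/-! Three of the four claims in (a) are formal. In degrees $k-1$ and $k+\ell-1$ the images of $d^k$
and $d^{k+\ell}$ are zero, which gives injectivity and the first exactness; exactness at the third
term holds for any graded space with an operator of degree one. For surjectivity, let $T$ have
degree $k+\ell-1$ and $d^{N-\ell}T=0$. Then $d^{N-k-\ell}T$ has degree $N-1$ and is killed by $d^k$.
If it equals $d^{N-k}S$, then $T-d^\ell S$ represents the class of $T$ and lies in the kernel of
$d^{N-k-\ell}$. So (a) reduces to exactness in degree $N-1$, which is
`mem_range_dPow_of_dPow_eq_zero`.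

Up to degree $N-1$ the diagrams have one row. Fields are symmetric tensors, encoded by homogeneous
polynomials in variables $v_a$ with smooth coefficients, and $d$ is the symmetrized gradient $\sum
v_a\partial_a$ up to a nonzero factor. On degree $N-1$, for $k\le N-1$, $d^k$ lands in two-row
diagrams and is, up to a nonzero factor, $\partial^k$ followed by antisymmetrization over the
columns (`comp_dPow_two_rows`). Its vanishing means that all $k$-fold products of the curls
$\partial_{v_a}\partial_b-\partial_{v_b}\partial_a$ kill the polynomial: a compatibility condition
of Saint-Venant type. `exists_grad_iterate` integrates it by a radial homotopy and a double
induction.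

For (b), $N=3$ and the diagrams have two columns. Bijectivity of $[i]$ in odd degree follows from
two facts in even degree: a closed field is $d^2V$ (`exists_dOmega_dOmega_eq`), and a field with
$d^2T=0$ is $dU$ (`exists_dOmega_eq`). The fields become biforms, antisymmetric in each column and
subject to a Bianchi relation. On even degree $d$ is the exterior derivative $d_1$ of the first
column and $d^2$ is $d_1d_2$, up to nonzero factors. Explicit potentials are built from contractions
with the position vector and radial averages.

What remains is to know the two-column Young symmetrizer well enough. Garnir relations show that its
values satisfy the Bianchi relation, and `altOn_comp_exch` shows that on tensors with these
symmetries it is multiplication by a positive constant. Normalizations enter only through being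
nonzero. -/

namespace NComplex

/-! ### Smooth functions: partial derivatives, coordinates and radial averages -/

section RadialAverage

variable {E F : Type} [NormedAddCommGroup E] [NormedSpace ℝ E] [ProperSpace E]
  [NormedAddCommGroup F] [NormedSpace ℝ F]

/-- The weighted average `∫₀¹ t ^ c f (t x) dt` of `f` along the segment from `0` to `x`. -/
noncomputable def radialAverage (c : ℕ) (f : E → F) (x : E) : F :=
  ∫ t in (0 : ℝ)..1, t ^ c • f (t • x)

/-- Differentiation under the integral; the chain rule supplies one more factor $t$, hence the
exponent $c+1$. The dominating constant comes from compactness of the closed unit ball around $x$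
times $[0,1]$, which is where `ProperSpace` enters. -/
theorem hasFDerivAt_radialAverage [CompleteSpace F] (c : ℕ) {f : E → F} (hf : ContDiff ℝ 1 f)
    (x : E) :
    HasFDerivAt (radialAverage c f) (radialAverage (c + 1) (fderiv ℝ f) x) x := by
  have hf' : Continuous (fderiv ℝ f) := hf.continuous_fderiv one_ne_zero
  have hc : Continuous f := hf.continuous
  have hF' : Continuous (fun q : E × ℝ => q.2 ^ (c + 1) • fderiv ℝ f (q.2 • q.1)) := by fun_prop
  have hcomp : IsCompact (Metric.closedBall x 1 ×ˢ Set.Icc (0 : ℝ) 1) :=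
    (isCompact_closedBall x 1).prod isCompact_Icc
  obtain ⟨C, hC⟩ := hcomp.exists_bound_of_continuousOn hF'.continuousOn
  refine intervalIntegral.hasFDerivAt_integral_of_dominated_of_fderiv_le
    (F := fun y t => t ^ c • f (t • y)) (F' := fun y t => t ^ (c + 1) • fderiv ℝ f (t • y))
    (bound := fun _ => C) (s := Metric.ball x 1) (Metric.ball_mem_nhds x one_pos)
    (Filter.Eventually.of_forall fun y => ?_) ?_ ?_ ?_ ?_ ?_
  · exact Continuous.aestronglyMeasurable (by fun_prop)
  · exact Continuous.intervalIntegrable (by fun_prop) _ _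
  · exact Continuous.aestronglyMeasurable (by fun_prop)
  · refine Filter.Eventually.of_forall fun t ht y hy => hC (y, t) ⟨Metric.ball_subset_closedBall hy, ?_⟩
    rw [Set.uIoc_of_le zero_le_one] at ht
    exact ⟨ht.1.le, ht.2⟩
  · exact Continuous.intervalIntegrable (by fun_prop) _ _
  · refine Filter.Eventually.of_forall fun t _ y _ => ?_
    have h1 : HasFDerivAt f (fderiv ℝ f (t • y)) (t • y) :=
      (hf.differentiable one_ne_zero _).hasFDerivAt
    have h2 : HasFDerivAt (fun z : E => t • z) (t • ContinuousLinearMap.id ℝ E) y :=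
      (hasFDerivAt_id y).const_smul t
    have h3 := (h1.comp y h2).const_smul (t ^ c)
    have h4 : t ^ (c + 1) • fderiv ℝ f (t • y)
        = t ^ c • (fderiv ℝ f (t • y)).comp (t • ContinuousLinearMap.id ℝ E) := by
      ext z
      simp [pow_succ, mul_smul]
    rw [h4]
    exact h3

/-- The derivative is again a radial average, of `fderiv ℝ f` with exponent $c+1$, so the induction
must run over all exponents and all target spaces at once. -/
theorem contDiff_radialAverage_nat (n : ℕ) : ∀ {F : Type} [NormedAddCommGroup F] [NormedSpace ℝ F]
    [CompleteSpace F] (c : ℕ) {f : E → F}, ContDiff ℝ n f → ContDiff ℝ n (radialAverage c f) := by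
  induction n with
  | zero =>
    intro F _ _ _ c f hf
    have hc : Continuous f := hf.continuous
    refine contDiff_zero.2 ?_
    exact intervalIntegral.continuous_parametric_intervalIntegral_of_continuous' (by fun_prop) 0 1
  | succ n ih =>
    intro F _ _ _ c f hf
    have h1 : ContDiff ℝ 1 f := hf.of_le (by exact_mod_cast Nat.le_add_left 1 n)
    push_cast at hf ⊢
    refine (contDiff_succ_iff_fderiv.2 ⟨fun x => (hasFDerivAt_radialAverage c h1 x).differentiableAt,
      by simp, ?_⟩)
    rw [funext fun x => (hasFDerivAt_radialAverage c h1 x).fderiv]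
    exact ih _ (contDiff_succ_iff_fderiv.1 hf).2.2

theorem contDiff_radialAverage [CompleteSpace F] (c : ℕ) {f : E → F}
    (hf : ContDiff ℝ ((⊤ : ℕ∞) : WithTop ℕ∞) f) :
    ContDiff ℝ ((⊤ : ℕ∞) : WithTop ℕ∞) (radialAverage c f) :=
  contDiff_infty.2 fun n => contDiff_radialAverage_nat n c (contDiff_infty.1 hf n)

/-- The radial average inverts `x ∂_x + c + 1`. -/
theorem fderiv_radialAverage_self_add [CompleteSpace F] (c : ℕ) {f : E → F} (hf : ContDiff ℝ 1 f)
    (x : E) :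
    fderiv ℝ (radialAverage c f) x x + ((c : ℝ) + 1) • radialAverage c f x = f x := by
  have hf' : Continuous (fderiv ℝ f) := hf.continuous_fderiv one_ne_zero
  have hc : Continuous f := hf.continuous
  -- Integrating this derivative over $[0,1]$ gives $f(x)$: the boundary term at $0$ vanishes
  -- because $c+1>0$.
  have hd : ∀ t : ℝ, HasDerivAt (fun t : ℝ => t ^ (c + 1) • f (t • x))
      (t ^ (c + 1) • fderiv ℝ f (t • x) x + (((c : ℝ) + 1) * t ^ c) • f (t • x)) t := by
    intro t
    have h1 : HasFDerivAt f (fderiv ℝ f (t • x)) (t • x) :=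
      (hf.differentiable one_ne_zero _).hasFDerivAt
    have h2 : HasDerivAt (fun t : ℝ => t • x) x t := by
      simpa using (hasDerivAt_id t).smul_const x
    have h3 := h1.comp_hasDerivAt t h2
    have h4 : HasDerivAt (fun t : ℝ => t ^ (c + 1)) (((c : ℝ) + 1) * t ^ c) t := by
      simpa using hasDerivAt_pow (c + 1) t
    exact h4.smul h3
  have hint := intervalIntegral.integral_eq_sub_of_hasDerivAt (a := 0) (b := 1)
    (fun t _ => hd t) (Continuous.intervalIntegrable (by fun_prop) _ _)
  rw [intervalIntegral.integral_add (Continuous.intervalIntegrable (by fun_prop) _ _)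
    (Continuous.intervalIntegrable (by fun_prop) _ _)] at hint
  simp only [one_pow, one_smul, zero_pow (Nat.succ_ne_zero c), zero_smul, sub_zero, mul_smul] at hint
  rw [intervalIntegral.integral_smul] at hint
  rw [(hasFDerivAt_radialAverage c hf x).fderiv, ← hint, radialAverage, radialAverage,
    ContinuousLinearMap.intervalIntegral_apply]
  · rfl
  · exact Continuous.intervalIntegrable (by fun_prop) _ _

end RadialAverage

section SmoothFn

variable (D : ℕ)

/-- The algebra of smooth functions on `ℝ^D`, as a subalgebra of the algebra of all functions. -/
def smoothSubalgebra : Subalgebra ℝ ((Fin D → ℝ) → ℝ) where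
  carrier := {f | ContDiff ℝ ((⊤ : ℕ∞) : WithTop ℕ∞) f}
  mul_mem' {f g} (hf : ContDiff ℝ _ f) (hg : ContDiff ℝ _ g) :=
    Set.mem_ofPred.2 (hf.mul hg)
  add_mem' {f g} (hf : ContDiff ℝ _ f) (hg : ContDiff ℝ _ g) :=
    Set.mem_ofPred.2 (hf.add hg)
  algebraMap_mem' r :=
    Set.mem_ofPred.2 (contDiff_const : ContDiff ℝ _ fun _ : Fin D → ℝ => r)

theorem mem_smoothSubalgebra {f : (Fin D → ℝ) → ℝ} :
    f ∈ smoothSubalgebra D ↔ ContDiff ℝ ((⊤ : ℕ∞) : WithTop ℕ∞) f := Iff.rfl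

/-- The algebra of smooth functions on `ℝ^D`. -/
def SmoothFn : Type := smoothSubalgebra D

noncomputable instance : CommRing (SmoothFn D) :=
  inferInstanceAs (CommRing (smoothSubalgebra D))

noncomputable instance : Algebra ℝ (SmoothFn D) :=
  inferInstanceAs (Algebra ℝ (smoothSubalgebra D))

end SmoothFn

namespace SmoothFn

variable {D : ℕ}

/-- Evaluation at a point. -/
def eval (x : Fin D → ℝ) : SmoothFn D →ₗ[ℝ] ℝ where
  toFun f := f.1 x
  map_add' _ _ := rfl
  map_smul' _ _ := rfl

theorem ext {f g : SmoothFn D} (h : ∀ x, f.1 x = g.1 x) : f = g := Subtype.ext (funext h)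

theorem val_sum {ι : Type*} (s : Finset ι) (f : ι → SmoothFn D) (x : Fin D → ℝ) :
    (∑ i ∈ s, f i).1 x = ∑ i ∈ s, (f i).1 x := map_sum (eval x) f s

theorem smooth (f : SmoothFn D) : ContDiff ℝ ((⊤ : ℕ∞) : WithTop ℕ∞) f.1 :=
  (mem_smoothSubalgebra D).1 f.2

theorem diffAt (f : SmoothFn D) (x : Fin D → ℝ) : DifferentiableAt ℝ f.1 x :=
  (smooth f).differentiable (by simp) x

/-- The partial derivative `∂_a`. -/
noncomputable def pd (a : Fin D) : SmoothFn D →ₗ[ℝ] SmoothFn D where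
  toFun f := ⟨fun x => fderiv ℝ f.1 x (Pi.single a 1), (mem_smoothSubalgebra D).2 <|
    ((smooth f).fderiv_right (by simp)).clm_apply contDiff_const⟩
  map_add' f g := Subtype.ext <| funext fun x =>
    congrArg (fun l => l (Pi.single a 1)) (fderiv_add (diffAt f x) (diffAt g x))
  map_smul' c f := Subtype.ext <| funext fun x =>
    congrArg (fun l => l (Pi.single a 1)) (fderiv_const_smul (diffAt f x) c)

theorem pd_apply (a : Fin D) (f : SmoothFn D) (x : Fin D → ℝ) :
    (pd a f).1 x = fderiv ℝ f.1 x (Pi.single a 1) := rfl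

/-- The coordinate function `x_a`. -/
def crd (a : Fin D) : SmoothFn D :=
  ⟨fun x => x a, (mem_smoothSubalgebra D).2 (contDiff_apply ℝ ℝ a)⟩

theorem pd_mul (a : Fin D) (f g : SmoothFn D) : pd a (f * g) = pd a f * g + f * pd a g := by
  apply Subtype.ext
  funext x
  change fderiv ℝ (f.1 * g.1) x (Pi.single a 1) = _
  rw [fderiv_mul (diffAt f x) (diffAt g x)]
  change f.1 x * (pd a g).1 x + g.1 x * (pd a f).1 x = (pd a f).1 x * g.1 x + f.1 x * (pd a g).1 x
  ring

theorem pd_crd (a b : Fin D) : pd a (crd b) = if a = b then 1 else 0 := by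
  apply Subtype.ext
  funext x
  have h : fderiv ℝ (crd b).1 x = ContinuousLinearMap.proj b :=
    (ContinuousLinearMap.proj (R := ℝ) (φ := fun _ : Fin D => ℝ) b).fderiv
  rw [pd_apply, h]
  by_cases hab : a = b
  · subst hab; simp; rfl
  · simp [hab, Ne.symm hab]; rfl

theorem pd_comm (a b : Fin D) (f : SmoothFn D) : pd a (pd b f) = pd b (pd a f) := by
  apply Subtype.ext
  funext x
  have h2 : ContDiffAt ℝ 2 f.1 x := (contDiff_infty.1 (smooth f) 2).contDiffAt
  have hs : IsSymmSndFDerivAt ℝ f.1 x := h2.isSymmSndFDerivAt (by simp)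
  have hd : DifferentiableAt ℝ (fderiv ℝ f.1) x :=
    ((smooth f).fderiv_right (m := 1) (by norm_cast)).differentiable one_ne_zero x
  have key : ∀ c e : Fin D, (pd c (pd e f)).1 x
      = fderiv ℝ (fderiv ℝ f.1) x (Pi.single c 1) (Pi.single e 1) := by
    intro c e
    change fderiv ℝ (fun y => fderiv ℝ f.1 y (Pi.single e 1)) x (Pi.single c 1) = _
    rw [fderiv_clm_apply hd (differentiableAt_const _)]
    simp
  rw [key, key]
  exact hs _ _

/-- The Euler operator `∑ x_a ∂_a`. -/
noncomputable def euler (f : SmoothFn D) : SmoothFn D := ∑ a, crd a * pd a f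

theorem euler_apply (f : SmoothFn D) (x : Fin D → ℝ) : (euler f).1 x = fderiv ℝ f.1 x x := by
  have h : (euler f).1 x = ∑ a, x a * fderiv ℝ f.1 x (Pi.single a 1) := by
    unfold euler
    rw [val_sum]
    exact Finset.sum_congr rfl fun a _ => rfl
  have hx : x = ∑ a, x a • (Pi.single a (1 : ℝ) : Fin D → ℝ) := by
    ext b
    simp [Finset.sum_apply, Pi.single_apply]
  rw [h]
  conv_rhs => rw [show fderiv ℝ f.1 x x = fderiv ℝ f.1 x (∑ a, x a • Pi.single a (1 : ℝ)) from
    congrArg _ hx]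
  simp only [map_sum, map_smul, smul_eq_mul]

/-- The smooth function `∫₀¹ t ^ c f (t x) dt`. -/
noncomputable def avg (c : ℕ) : SmoothFn D →ₗ[ℝ] SmoothFn D where
  toFun f := ⟨radialAverage c f.1, (mem_smoothSubalgebra D).2 <| contDiff_radialAverage c (smooth f)⟩
  map_add' f g := by
    apply Subtype.ext
    funext x
    have hf : Continuous f.1 := (smooth f).continuous
    have hg : Continuous g.1 := (smooth g).continuous
    change ∫ t in (0 : ℝ)..1, t ^ c • (f.1 (t • x) + g.1 (t • x)) = _
    simp only [smul_add]
    exact intervalIntegral.integral_add (Continuous.intervalIntegrable (by fun_prop) _ _)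
      (Continuous.intervalIntegrable (by fun_prop) _ _)
  map_smul' r f := by
    apply Subtype.ext
    funext x
    change ∫ t in (0 : ℝ)..1, t ^ c • (r • f.1 (t • x)) = r • ∫ t in (0 : ℝ)..1, t ^ c • f.1 (t • x)
    simp only [smul_comm _ r]
    exact intervalIntegral.integral_smul _ _

theorem pd_avg (c : ℕ) (a : Fin D) (f : SmoothFn D) : pd a (avg c f) = avg (c + 1) (pd a f) := by
  apply Subtype.ext
  funext x
  have hf1 : ContDiff ℝ 1 f.1 := (smooth f).of_le (by exact_mod_cast le_top)
  have hf' : Continuous (fderiv ℝ f.1) := hf1.continuous_fderiv one_ne_zero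
  change fderiv ℝ (radialAverage c f.1) x (Pi.single a 1) = _
  rw [(hasFDerivAt_radialAverage c hf1 x).fderiv, radialAverage,
    ContinuousLinearMap.intervalIntegral_apply]
  · rfl
  · exact Continuous.intervalIntegrable (by fun_prop) _ _

theorem euler_avg (c : ℕ) (f : SmoothFn D) :
    euler (avg c f) + ((c : ℝ) + 1) • avg c f = f := by
  apply Subtype.ext
  funext x
  have hf1 : ContDiff ℝ 1 f.1 := (smooth f).of_le (by exact_mod_cast le_top)
  change (euler (avg c f)).1 x + ((c : ℝ) + 1) • (avg c f).1 x = f.1 x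
  rw [euler_apply]
  exact fderiv_radialAverage_self_add c hf1 x

end SmoothFn

end NComplex

namespace NComplex

/-! ### Polynomials in auxiliary variables with smooth coefficients -/

section CoefMap

variable {σ A : Type} [CommRing A] [Algebra ℝ A]

open MvPolynomial

/-- Apply an `ℝ`-linear map to all coefficients of a polynomial. -/
noncomputable def coefMap (φ : A →ₗ[ℝ] A) : MvPolynomial σ A →ₗ[ℝ] MvPolynomial σ A :=
  have key : ∀ (p : MvPolynomial σ A) (s : σ →₀ ℕ),
      coeff s (∑ t ∈ p.support, monomial t (φ (coeff t p))) = φ (coeff s p) := by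
    classical
    intro p s
    rw [coeff_sum]
    simp only [coeff_monomial, Finset.sum_ite_eq', mem_support_iff]
    split_ifs with h
    · rfl
    · rw [not_not.1 h, map_zero]
  { toFun := fun p => ∑ t ∈ p.support, monomial t (φ (coeff t p))
    map_add' := fun p q => by ext s; rw [coeff_add, key, key, key, coeff_add, map_add]
    map_smul' := fun r p => by
      ext s
      rw [key, coeff_smul, RingHom.id_apply, coeff_smul, key, map_smul] }

theorem coeff_coefMap (φ : A →ₗ[ℝ] A) (p : MvPolynomial σ A) (s : σ →₀ ℕ) :
    coeff s (coefMap φ p) = φ (coeff s p) := by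
  classical
  change coeff s (∑ t ∈ p.support, monomial t (φ (coeff t p))) = φ (coeff s p)
  rw [coeff_sum]
  simp only [coeff_monomial, Finset.sum_ite_eq', mem_support_iff]
  split_ifs with h
  · rfl
  · rw [not_not.1 h, map_zero]

theorem coefMap_monomial (φ : A →ₗ[ℝ] A) (s : σ →₀ ℕ) (r : A) :
    coefMap φ (monomial s r) = monomial s (φ r) := by
  classical
  ext t
  rw [coeff_coefMap, coeff_monomial, coeff_monomial]
  split_ifs <;> simp

theorem coefMap_X_mul (φ : A →ₗ[ℝ] A) (i : σ) (p : MvPolynomial σ A) :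
    coefMap φ (X i * p) = X i * coefMap φ p := by
  induction p using MvPolynomial.induction_on' with
  | monomial s r =>
    rw [X, monomial_mul, coefMap_monomial, coefMap_monomial, monomial_mul, one_mul, one_mul]
  | add p q hp hq => rw [mul_add, map_add, hp, hq, map_add, mul_add]

theorem pderiv_coefMap (φ : A →ₗ[ℝ] A) (i : σ) (p : MvPolynomial σ A) :
    pderiv i (coefMap φ p) = coefMap φ (pderiv i p) := by
  induction p using MvPolynomial.induction_on' with
  | monomial s r =>
    rw [coefMap_monomial, pderiv_monomial, pderiv_monomial, coefMap_monomial]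
    congr 1
    rw [mul_comm, mul_comm r, ← nsmul_eq_mul, ← nsmul_eq_mul, map_nsmul]
  | add p q hp hq => rw [map_add, map_add, hp, hq, map_add, map_add]

theorem isHomogeneous_coefMap (φ : A →ₗ[ℝ] A) {p : MvPolynomial σ A} {n : ℕ}
    (hp : p.IsHomogeneous n) : (coefMap φ p).IsHomogeneous n := by
  intro s hs
  refine hp fun h => hs ?_
  rw [coeff_coefMap, h, map_zero]

theorem isHomogeneous_real_smul (r : ℝ) {p : MvPolynomial σ A} {n : ℕ}
    (hp : p.IsHomogeneous n) : (r • p).IsHomogeneous n := by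
  intro s hs
  refine hp fun h => hs ?_
  rw [coeff_smul, h, smul_zero]

end CoefMap

/-- Polynomials in `D` auxiliary variables over the smooth functions on `ℝ^D`: generating
functions of symmetric tensor fields. -/
abbrev SymPoly (D : ℕ) : Type := MvPolynomial (Fin D) (SmoothFn D)

/-! ### Symmetrized gradient, curls, and a Poincaré lemma for symmetric tensors. -/

namespace SymPoly

variable {D : ℕ}

open MvPolynomial SmoothFn

/-- The partial derivative `∂_a` of the coefficients. -/
noncomputable def pdC (a : Fin D) : SymPoly D →ₗ[ℝ] SymPoly D := coefMap (pd a)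

theorem pdC_C_mul (a : Fin D) (f : SmoothFn D) (p : SymPoly D) :
    pdC a (C f * p) = C (pd a f) * p + C f * pdC a p := by
  ext1 s
  simp only [pdC, coeff_coefMap, coeff_C_mul, coeff_add, pd_mul]

theorem pdC_X_mul (a b : Fin D) (p : SymPoly D) : pdC a (X b * p) = X b * pdC a p :=
  coefMap_X_mul _ _ _

theorem pderiv_pdC (a b : Fin D) (p : SymPoly D) : pderiv a (pdC b p) = pdC b (pderiv a p) :=
  pderiv_coefMap _ _ _

theorem pderiv_comm (a b : Fin D) (p : SymPoly D) :
    pderiv a (pderiv b p) = pderiv b (pderiv a p) := by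
  have h : (⁅pderiv (R := SmoothFn D) a, pderiv b⁆ :
      Derivation (SmoothFn D) (SymPoly D) (SymPoly D)) = (0 : Derivation (SmoothFn D) (SymPoly D) (SymPoly D)) := by
    refine MvPolynomial.derivation_ext fun i => ?_
    classical
    rw [Derivation.commutator_apply, pderiv_X, pderiv_X, Derivation.coe_zero, Pi.zero_apply]
    simp [Pi.single_apply, apply_ite]
  have h2 := congrArg (fun d => d p) h
  simp only [Derivation.commutator_apply, Derivation.coe_zero, Pi.zero_apply] at h2
  exact sub_eq_zero.1 h2

/-- The symmetrized gradient `∑ v_a ∂_a`. -/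
noncomputable def grad : SymPoly D →ₗ[ℝ] SymPoly D where
  toFun p := ∑ a, X a * pdC a p
  map_add' p q := by simp only [map_add, mul_add, Finset.sum_add_distrib]
  map_smul' r p := by simp only [map_smul, mul_smul_comm, Finset.smul_sum, RingHom.id_apply]

theorem grad_apply (p : SymPoly D) : grad p = ∑ a, X a * pdC a p := rfl

/-- The contraction with the position, `∑ x_a ∂/∂v_a`. -/
noncomputable def contr (p : SymPoly D) : SymPoly D := ∑ a, C (crd a) * pderiv a p

/-- The operator `∂/∂v_a ∂_b - ∂/∂v_b ∂_a`. -/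
noncomputable def curl (a b : Fin D) : SymPoly D →ₗ[ℝ] SymPoly D where
  toFun p := pderiv a (pdC b p) - pderiv b (pdC a p)
  map_add' p q := by simp only [map_add]; ring
  map_smul' r p := by
    simp only [map_smul, RingHom.id_apply, smul_sub, Derivation.map_smul_of_tower]

theorem curl_apply (a b : Fin D) (p : SymPoly D) :
    curl a b p = pderiv a (pdC b p) - pderiv b (pdC a p) := rfl

/-- All `k`-fold products of the operators `curl a b` vanish on `p`. -/
def CurlVanish : ℕ → SymPoly D → Prop
  | 0, p => p = 0
  | k + 1, p => ∀ a b, CurlVanish k (curl a b p)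

theorem curlVanish_smul (k : ℕ) (r : ℝ) {p : SymPoly D} (h : CurlVanish k p) :
    CurlVanish k (r • p) := by
  induction k generalizing p with
  | zero => rw [CurlVanish] at *; rw [h, smul_zero]
  | succ k ih =>
    intro a b
    rw [map_smul]
    exact ih (h a b)

/-- The radial average of the coefficients. -/
noncomputable def avgC (c : ℕ) : SymPoly D →ₗ[ℝ] SymPoly D := coefMap (avg c)

theorem pdC_avgC (a : Fin D) (c : ℕ) (p : SymPoly D) : pdC a (avgC c p) = avgC (c + 1) (pdC a p) := by
  ext1 s
  simp only [pdC, avgC, coeff_coefMap, pd_avg]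

theorem curl_avgC (a b : Fin D) (c : ℕ) (p : SymPoly D) :
    curl a b (avgC c p) = avgC (c + 1) (curl a b p) := by
  rw [curl_apply, pdC_avgC, pdC_avgC, avgC, pderiv_coefMap, pderiv_coefMap, curl_apply, map_sub]

theorem curlVanish_avgC (k c : ℕ) {p : SymPoly D} (h : CurlVanish k p) :
    CurlVanish k (avgC c p) := by
  induction k generalizing p c with
  | zero => rw [CurlVanish] at *; rw [h, map_zero]
  | succ k ih =>
    intro a b
    rw [curl_avgC]
    exact ih _ (h a b)

theorem euler_avgC (c : ℕ) (p : SymPoly D) :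
    ∑ a, C (crd a) * pdC a (avgC c p) + ((c : ℝ) + 1) • avgC c p = p := by
  ext1 s
  rw [coeff_add, coeff_sum, coeff_smul]
  simp only [coeff_C_mul, pdC, avgC, coeff_coefMap]
  exact euler_avg c _

/-- Differentiating the coordinate in `contr` produces the extra term
$\partial_{v_a}\partial_{v_b}p$, which is symmetric in $a,b$ and cancels in the curl. Thus
contraction preserves the vanishing of iterated curls, as the induction in `exists_grad_iterate`
requires. -/
theorem curl_contr (a b : Fin D) (p : SymPoly D) : curl a b (contr p) = contr (curl a b p) := by
  have h1 : ∀ e, pdC e (contr p) = pderiv e p + ∑ c, C (crd c) * pdC e (pderiv c p) := by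
    intro e
    rw [contr, map_sum]
    simp only [pdC_C_mul, pd_crd, Finset.sum_add_distrib, apply_ite C, map_one, map_zero, ite_mul,
      one_mul, zero_mul, Finset.sum_ite_eq, Finset.mem_univ, if_true]
  have h2 : ∀ a b, pderiv a (pdC b (contr p)) = pderiv a (pderiv b p) +
      ∑ c, C (crd c) * pderiv a (pdC b (pderiv c p)) := by
    intro a b
    rw [h1, map_add, map_sum]
    simp only [pderiv_C_mul]
  rw [curl_apply, h2, h2, pderiv_comm b a, contr, add_sub_add_left_eq_sub, ← Finset.sum_sub_distrib]
  refine Finset.sum_congr rfl fun c _ => ?_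
  rw [← mul_sub, curl_apply, map_sub, pderiv_comm c a, pderiv_comm c b, pderiv_pdC c, pderiv_pdC c]

theorem curlVanish_contr (k : ℕ) {p : SymPoly D} (h : CurlVanish k p) :
    CurlVanish k (contr p) := by
  induction k generalizing p with
  | zero => rw [CurlVanish] at *; rw [h, contr]; simp
  | succ k ih =>
    intro a b
    rw [curl_contr]
    exact ih (h a b)

theorem isHomogeneous_contr {p : SymPoly D} {n : ℕ} (hp : p.IsHomogeneous (n + 1)) :
    (contr p).IsHomogeneous n := by
  refine IsHomogeneous.sum _ _ _ fun a _ => ?_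
  have := (isHomogeneous_C (Fin D) (crd a)).mul (hp.pderiv (i := a))
  simpa using this

theorem isHomogeneous_curl {p : SymPoly D} {n : ℕ} (hp : p.IsHomogeneous (n + 1)) (a b : Fin D) :
    (curl a b p).IsHomogeneous n :=
  ((isHomogeneous_coefMap _ hp).pderiv).sub ((isHomogeneous_coefMap _ hp).pderiv)

/-- The homotopy formula. The Euler operator $\sum v_b\partial_{v_b}$ acts as $n$ in degree $n$, and
replacing $\partial_{v_a}\partial_b$ by $\partial_{v_b}\partial_a$ costs the curl term. -/
theorem grad_contr {p : SymPoly D} {n : ℕ} (hp : p.IsHomogeneous n) :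
    grad (contr p) = (n : ℝ) • (p + ∑ a, C (crd a) * pdC a p) +
      ∑ a, ∑ b, C (crd a) * X b * curl a b p := by
  have h1 : ∀ e, pdC e (contr p) = pderiv e p + ∑ c, C (crd c) * pdC e (pderiv c p) := by
    intro e
    rw [contr, map_sum]
    simp only [pdC_C_mul, pd_crd, Finset.sum_add_distrib, apply_ite C, map_one, map_zero, ite_mul,
      one_mul, zero_mul, Finset.sum_ite_eq, Finset.mem_univ, if_true]
  have he : ∀ q : SymPoly D, q.IsHomogeneous n → ∑ b, X b * pderiv b q = (n : ℝ) • q := by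
    intro q hq
    rw [hq.sum_X_mul_pderiv, Nat.cast_smul_eq_nsmul]
  have h3 : ∑ a, C (crd a) * ((n : ℝ) • pdC a p)
      = ∑ a, ∑ b, C (crd a) * X b * pderiv b (pdC a p) := by
    refine Finset.sum_congr rfl fun a _ => ?_
    rw [← he (pdC a p) (isHomogeneous_coefMap _ hp), Finset.mul_sum]
    exact Finset.sum_congr rfl fun b _ => (mul_assoc _ _ _).symm
  have h4 : ∑ e, X e * ∑ c, C (crd c) * pdC e (pderiv c p)
      = ∑ a, ∑ b, C (crd a) * X b * pderiv a (pdC b p) := by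
    rw [Finset.sum_comm]
    refine Finset.sum_congr rfl fun e _ => ?_
    rw [Finset.mul_sum]
    refine Finset.sum_congr rfl fun c _ => ?_
    rw [pderiv_pdC]
    ring
  rw [grad_apply]
  simp only [h1, mul_add, Finset.sum_add_distrib, curl_apply, mul_sub, Finset.sum_sub_distrib]
  rw [he p hp, smul_add, Finset.smul_sum, h4, ← h3]
  simp only [mul_smul_comm]
  abel

theorem grad_wedge (a b : Fin D) (p : SymPoly D) :
    grad (C (crd a) * X b * p) = X a * X b * p + C (crd a) * X b * grad p := by
  have h : ∀ c, pdC c (C (crd a) * X b * p)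
      = (if c = a then 1 else 0) * (X b * p) + C (crd a) * (X b * pdC c p) := by
    intro c
    rw [mul_assoc, pdC_C_mul, pdC_X_mul, pd_crd, apply_ite C, map_one, map_zero]
  rw [grad_apply, grad_apply, Finset.mul_sum]
  calc ∑ c, X c * pdC c (C (crd a) * X b * p)
      = ∑ c, ((if c = a then X c * (X b * p) else 0) + C (crd a) * X b * (X c * pdC c p)) := by
        refine Finset.sum_congr rfl fun c _ => ?_
        rw [h]
        split_ifs <;> ring
    _ = _ := by
        rw [Finset.sum_add_distrib, Finset.sum_ite_eq' Finset.univ a, if_pos (Finset.mem_univ a),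
          mul_assoc]

/-- The gradient turns $x_a$ into $v_a$, and $\sum v_av_bZ_{ab}=0$ because $Z$ is antisymmetric;
only the term with the gradient on $Z$ survives. -/
theorem grad_iterate_sum_wedge (j : ℕ) (Z : Fin D → Fin D → SymPoly D)
    (hZ : ∀ a b, Z a b = -Z b a) :
    grad^[j] (∑ a, ∑ b, C (crd a) * X b * Z a b) =
      ∑ a, ∑ b, C (crd a) * X b * grad^[j] (Z a b) := by
  induction j generalizing Z with
  | zero => rfl
  | succ j ih =>
    have h0 : ∑ a, ∑ b, X a * X b * Z a b = 0 := by
      have h : ∑ a, ∑ b, X a * X b * Z a b = -∑ a, ∑ b, X a * X b * Z a b := by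
        conv_rhs => rw [Finset.sum_comm]
        rw [← Finset.sum_neg_distrib]
        refine Finset.sum_congr rfl fun a _ => ?_
        rw [← Finset.sum_neg_distrib]
        refine Finset.sum_congr rfl fun b _ => ?_
        rw [hZ a b]
        ring
      have h' := congrArg ((2 : ℝ)⁻¹ • ·) (add_eq_zero_iff_eq_neg.2 h)
      simpa only [← two_smul ℝ, smul_smul, inv_mul_cancel₀ (two_ne_zero' ℝ), one_smul,
        smul_zero] using h'
    have h1 : grad (∑ a, ∑ b, C (crd a) * X b * Z a b)
        = ∑ a, ∑ b, C (crd a) * X b * grad (Z a b) := by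
      have h2 : ∀ a b, grad (C (crd a) * X b * Z a b)
          = X a * X b * Z a b + C (crd a) * X b * grad (Z a b) := fun a b => grad_wedge a b (Z a b)
      simp only [map_sum, h2, Finset.sum_add_distrib, h0, zero_add]
    rw [Function.iterate_succ_apply, h1, ih]
    · rfl
    · intro a b
      rw [hZ a b, map_neg]

theorem grad_iterate_add (j : ℕ) (p q : SymPoly D) :
    grad^[j] (p + q) = grad^[j] p + grad^[j] q := by
  induction j generalizing p q with
  | zero => rfl
  | succ j ih => rw [Function.iterate_succ_apply, map_add, ih]; rfl

theorem grad_iterate_smul (j : ℕ) (r : ℝ) (p : SymPoly D) :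
    grad^[j] (r • p) = r • grad^[j] p := by
  induction j generalizing p with
  | zero => rfl
  | succ j ih => rw [Function.iterate_succ_apply, map_smul, ih]; rfl

theorem curl_antisymm (a b : Fin D) (p : SymPoly D) : curl a b p = -curl b a p := by
  rw [curl_apply, curl_apply, neg_sub]

/-- A homogeneous polynomial of degree `q + j` on which all `(q + 1)`-fold curls vanish is the
`j`-fold symmetrized gradient of a homogeneous polynomial of degree `q`. -/
theorem exists_grad_iterate (q : ℕ) : ∀ (j : ℕ) (p : SymPoly D), p.IsHomogeneous (q + j) →
    CurlVanish (q + 1) p → ∃ g : SymPoly D, g.IsHomogeneous q ∧ grad^[j] g = p := by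
  induction q with
  | zero =>
    intro j
    induction j with
    | zero => exact fun p hp _ => ⟨p, hp, rfl⟩
    | succ j ihj =>
      intro p hp hv
      -- With $f$ the average of $p$ one has $f+\sum x_a\partial_af=p$. The curls of $f$ vanish, so
      -- `grad_contr` reads: the gradient of the contraction of $f$ is $(j+1)p$. The contraction has
      -- degree $j$ and is a $j$-fold gradient by induction.
      have hf : (avgC 0 p).IsHomogeneous (0 + (j + 1)) := isHomogeneous_coefMap _ hp
      have hfv : CurlVanish (0 + 1) (avgC 0 p) := curlVanish_avgC _ 0 hv
      obtain ⟨g, hg, hgp⟩ := ihj (contr (avgC 0 p)) (isHomogeneous_contr hf) (curlVanish_contr _ hfv)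
      have h := grad_contr hf
      have he := euler_avgC 0 p
      rw [Nat.cast_zero, zero_add, one_smul, add_comm] at he
      have hz : ∀ a b, curl a b (avgC 0 p) = 0 := fun a b => hfv a b
      simp only [hz, mul_zero, Finset.sum_const_zero, add_zero, he] at h
      have hn : ((0 + (j + 1) : ℕ) : ℝ) ≠ 0 := by positivity
      refine ⟨((0 + (j + 1) : ℕ) : ℝ)⁻¹ • g, isHomogeneous_real_smul _ hg, ?_⟩
      rw [grad_iterate_smul, Function.iterate_succ_apply', hgp, h, smul_smul, inv_mul_cancel₀ hn,
        one_smul]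
  | succ q ihq =>
    intro j
    induction j with
    | zero => exact fun p hp _ => ⟨p, hp, rfl⟩
    | succ j ihj =>
      intro p hp hv
      have hf : (avgC 0 p).IsHomogeneous (q + 1 + (j + 1)) := isHomogeneous_coefMap _ hp
      have hfv : CurlVanish (q + 1 + 1) (avgC 0 p) := curlVanish_avgC _ 0 hv
      obtain ⟨g, hg, hgp⟩ := ihj (contr (avgC 0 p)) (isHomogeneous_contr hf) (curlVanish_contr _ hfv)
      have h := grad_contr hf
      have he := euler_avgC 0 p
      rw [Nat.cast_zero, zero_add, one_smul, add_comm] at he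
      rw [he] at h
      -- The curl terms survive here. Each curl of $f$ has degree $q+(j+1)$ and vanishing
      -- $(q+1)$-fold curls, so the induction on $q$ makes it a $(j+1)$-fold gradient.
      have hz : ∀ a b, ∃ z : SymPoly D, z.IsHomogeneous q ∧
          grad^[j + 1] z = curl a b (avgC 0 p) := by
        intro a b
        refine ihq (j + 1) _ (isHomogeneous_curl ?_ a b) (hfv a b)
        rwa [show q + (j + 1) + 1 = q + 1 + (j + 1) by omega]
      choose Z hZ hZc using hz
      -- The primitives need not be antisymmetric in $a,b$. Antisymmetrizing them changes nothing
      -- for the curls, which are antisymmetric, and makes `grad_iterate_sum_wedge` applicable.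
      set Z' : Fin D → Fin D → SymPoly D := fun a b => (2 : ℝ)⁻¹ • (Z a b + (-1 : ℝ) • Z b a) with hZ'
      have hZ'h : ∀ a b, (Z' a b).IsHomogeneous q := fun a b =>
        isHomogeneous_real_smul _ ((hZ a b).add (isHomogeneous_real_smul _ (hZ b a)))
      have hZ'a : ∀ a b, Z' a b = -Z' b a := by
        intro a b
        simp only [hZ', neg_smul, one_smul]
        rw [← smul_neg, neg_add_rev, neg_neg, add_comm]
      have hZ'c : ∀ a b, grad^[j + 1] (Z' a b) = curl a b (avgC 0 p) := by
        intro a b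
        simp only [hZ']
        rw [grad_iterate_smul, grad_iterate_add, grad_iterate_smul, hZc, hZc, curl_antisymm b a,
          neg_smul, one_smul, neg_neg, ← two_smul ℝ, smul_smul, inv_mul_cancel₀ two_ne_zero, one_smul]
      have hw := grad_iterate_sum_wedge (j + 1) Z' hZ'a
      simp only [hZ'c] at hw
      have hn : ((q + 1 + (j + 1) : ℕ) : ℝ) ≠ 0 := by positivity
      -- In the homotopy formula with $n=q+j+2$, subtract the $(j+1)$-fold primitive of $\sum
      -- x_av_b\,\mathrm{curl}_{ab}f$ and divide by $n$.
      refine ⟨((q + 1 + (j + 1) : ℕ) : ℝ)⁻¹ • (g + (-1 : ℝ) • ∑ a, ∑ b, C (crd a) * X b * Z' a b),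
        isHomogeneous_real_smul _ (hg.add (isHomogeneous_real_smul _ ?_)), ?_⟩
      · refine IsHomogeneous.sum _ _ _ fun a _ => IsHomogeneous.sum _ _ _ fun b _ => ?_
        have := ((isHomogeneous_C (Fin D) (crd a)).mul (isHomogeneous_X (SmoothFn D) b)).mul (hZ'h a b)
        rwa [show 0 + 1 + q = q + 1 by omega] at this
      · rw [grad_iterate_smul, grad_iterate_add, grad_iterate_smul, hw, Function.iterate_succ_apply',
          hgp, h, neg_smul, one_smul, add_neg_cancel_right, smul_smul, inv_mul_cancel₀ hn, one_smul]

end SymPoly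

end NComplex

namespace NComplex

/-! ### Exchanges in a shape with two lines -/

section TwoLines

open Equiv

theorem perm_apply_inv {ι : Type*} (π : Perm ι) (x : ι) : π (π⁻¹ x) = x := π.apply_symm_apply x

theorem perm_inv_apply {ι : Type*} (π : Perm ι) (x : ι) : π⁻¹ (π x) = x := π.symm_apply_apply x

/-- In a set of cells distributed over two lines (the line of `x` is `line x`), `θ` matches every
cell of the second line (`line x = true`) with a cell of the first line, and fixes the other
cells. -/
structure IsMate {ι : Type*} (line : ι → Bool) (θ : ι → ι) : Prop where
  invol : ∀ x, θ (θ x) = x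
  flip : ∀ x, θ x ≠ x → line (θ x) = !line x
  mated : ∀ x, line x = true → θ x ≠ x

/-- The permutation `τ` exchanges some cells with their mates. -/
def IsExch {ι : Type*} (θ : ι → ι) (τ : Perm ι) : Prop := ∀ x, τ x = x ∨ τ x = θ x

variable {ι : Type*} {line : ι → Bool} {θ : ι → ι}

theorem IsExch.apply_of_ne {τ : Perm ι} (hτ : IsExch θ τ) {x : ι} (hx : τ x ≠ x) : τ x = θ x :=
  (hτ x).resolve_left hx

theorem IsExch.apply_mate (hθ : IsMate line θ) {τ : Perm ι} (hτ : IsExch θ τ) {x : ι}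
    (hx : τ x ≠ x) : τ (θ x) = x := by
  rcases hτ (θ x) with h | h
  · have h1 := hτ.apply_of_ne hx
    exact absurd (h1.trans (τ.injective (h.trans h1.symm))) hx
  · rw [h, hθ.invol]

theorem IsExch.apply_apply (hθ : IsMate line θ) {τ : Perm ι} (hτ : IsExch θ τ) (x : ι) :
    τ (τ x) = x := by
  by_cases hx : τ x = x
  · rw [hx, hx]
  · rw [hτ.apply_of_ne hx, hτ.apply_mate hθ hx]

theorem IsExch.inv_eq (hθ : IsMate line θ) {τ : Perm ι} (hτ : IsExch θ τ) : τ⁻¹ = τ := by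
  ext x
  rw [Perm.inv_eq_iff_eq, hτ.apply_apply hθ]

theorem IsExch.one : IsExch θ (1 : Perm ι) := fun _ => Or.inl rfl

theorem IsExch.mul (hθ : IsMate line θ) {τ τ' : Perm ι} (hτ : IsExch θ τ) (hτ' : IsExch θ τ') :
    IsExch θ (τ * τ') := by
  intro x
  rw [Perm.mul_apply]
  by_cases h' : τ' x = x
  · rw [h']; exact hτ x
  · rw [hτ'.apply_of_ne h']
    rcases hτ (θ x) with h | h
    · exact Or.inr h
    · exact Or.inl (h.trans (hθ.invol x))

theorem IsExch.swap [DecidableEq ι] (hθ : IsMate line θ) (x : ι) : IsExch θ (swap x (θ x)) := by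
  intro y
  by_cases h1 : y = x
  · rw [h1, swap_apply_left]; exact Or.inr rfl
  by_cases h2 : y = θ x
  · rw [h2, swap_apply_right, hθ.invol]; exact Or.inr rfl
  · rw [swap_apply_of_ne_of_ne h1 h2]; exact Or.inl rfl

theorem IsExch.line_ne_iff (hθ : IsMate line θ) {τ : Perm ι} (hτ : IsExch θ τ) (x : ι) :
    line (τ x) ≠ line x ↔ τ x ≠ x := by
  constructor
  · intro h h'
    rw [h'] at h
    exact h rfl
  · intro h
    rw [hτ.apply_of_ne h, hθ.flip x (by rw [← hτ.apply_of_ne h]; exact h)]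
    cases line x <;> simp

/-- The exchange obtained by undoing the exchange of `x` and its mate. -/
theorem IsExch.swap_mul_apply [DecidableEq ι] (hθ : IsMate line θ) {τ : Perm ι} (hτ : IsExch θ τ)
    {x : ι} (hx : τ x ≠ x) (y : ι) :
    (Equiv.swap x (θ x) * τ) y = if y = x ∨ y = θ x then y else τ y := by
  rw [Perm.mul_apply]
  by_cases h1 : y = x
  · subst h1; rw [if_pos (Or.inl rfl), hτ.apply_of_ne hx, swap_apply_right]
  by_cases h2 : y = θ x
  · rw [if_pos (Or.inr h2), h2, hτ.apply_mate hθ hx, swap_apply_left]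
  · rw [if_neg (by tauto)]
    refine swap_apply_of_ne_of_ne (fun h => h2 ?_) (fun h => h1 ?_)
    · rw [← hτ.apply_mate hθ hx] at h
      exact τ.injective h
    · rw [← hτ.apply_of_ne hx] at h
      exact τ.injective h

variable [Fintype ι] [DecidableEq ι]

/-- The cells of the second line that are moved by `τ`. -/
def movedCells (line : ι → Bool) (τ : Perm ι) : Finset ι :=
  Finset.univ.filter fun x => line x = true ∧ τ x ≠ x

theorem mem_movedCells {τ : Perm ι} {x : ι} :
    x ∈ movedCells line τ ↔ line x = true ∧ τ x ≠ x := by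
  simp [movedCells]

theorem IsExch.eq_one_of_movedCells (hθ : IsMate line θ) {τ : Perm ι} (hτ : IsExch θ τ)
    (h : movedCells line τ = ∅) : τ = 1 := by
  ext x
  rw [Perm.one_apply]
  by_contra hx
  have hne : ∀ y, ¬ (line y = true ∧ τ y ≠ y) := fun y hy =>
    Finset.notMem_empty y (h ▸ mem_movedCells.2 hy)
  cases hl : line x with
  | true => exact hne x ⟨hl, hx⟩
  | false =>
    refine hne (τ x) ⟨?_, fun h' => hx (τ.injective h')⟩
    have := (hτ.line_ne_iff hθ x).2 hx
    rw [hl] at this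
    simpa using this

theorem IsExch.movedCells_swap_mul (hθ : IsMate line θ) {τ : Perm ι} (hτ : IsExch θ τ)
    {x : ι} (hx : x ∈ movedCells line τ) :
    movedCells line (Equiv.swap x (θ x) * τ) = (movedCells line τ).erase x := by
  have hx' := mem_movedCells.1 hx
  ext y
  rw [Finset.mem_erase, mem_movedCells, mem_movedCells, hτ.swap_mul_apply hθ hx'.2]
  have hl : line (θ x) = false := by rw [hθ.flip x (hθ.mated x hx'.1), hx'.1]; rfl
  by_cases h1 : y = x
  · simp [h1]
  by_cases h2 : y = θ x
  · simp [h2, hl]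
  · simp [h1, h2]

/-- Undo the exchanges one at a time: each is a transposition and removes one cell from
`movedCells`. -/
theorem IsExch.sign_eq (hθ : IsMate line θ) {τ : Perm ι} (hτ : IsExch θ τ) :
    Perm.sign τ = (-1) ^ (movedCells line τ).card := by
  induction h : (movedCells line τ).card generalizing τ with
  | zero =>
    rw [hτ.eq_one_of_movedCells hθ (Finset.card_eq_zero.1 h), Perm.sign_one, pow_zero]
  | succ n ih =>
    obtain ⟨x, hx⟩ := Finset.card_pos.1 (by omega : 0 < (movedCells line τ).card)
    have hx' := mem_movedCells.1 hx
    have h1 := ih ((IsExch.swap hθ x).mul hθ hτ)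
      (by rw [hτ.movedCells_swap_mul hθ hx, Finset.card_erase_of_mem hx, h]; rfl)
    rw [Perm.sign_mul, Perm.sign_swap (hθ.mated x hx'.1).symm] at h1
    rw [pow_succ, ← h1]
    simp

/-- The exchanges of cells with their mates. -/
def exchPerms (θ : ι → ι) : Finset (Perm ι) := Finset.univ.filter fun τ => ∀ x, τ x = x ∨ τ x = θ x

theorem mem_exchPerms {τ : Perm ι} : τ ∈ exchPerms θ ↔ IsExch θ τ := by
  simp [exchPerms, IsExch]

/-- The permutations that preserve the two lines. -/
def linePerms (line : ι → Bool) : Finset (Perm ι) :=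
  Finset.univ.filter fun σ => ∀ x, line (σ x) = line x

theorem mem_linePerms {σ : Perm ι} : σ ∈ linePerms line ↔ ∀ x, line (σ x) = line x := by
  simp [linePerms]

variable {X V : Type*} [AddCommGroup V]

/-- Antisymmetrization of a tensor over the exchanges of cells with their mates. -/
def exchAlt (θ : ι → ι) (A : (ι → X) → V) (μ : ι → X) : V :=
  ∑ τ ∈ exchPerms θ, (Perm.sign τ : ℤ) • A (μ ∘ τ)

/-- The terms cancel in pairs. Exchanging $x$ with its mate before $\pi$ amounts to a transposition
inside one line after it, under which $A$ is invariant, while the sign changes. -/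
theorem exchAlt_comp_eq_zero (hθ : IsMate line θ) {A : (ι → X) → V}
    (hA : ∀ σ ∈ linePerms line, ∀ μ, A (μ ∘ σ) = A μ) (π : Perm ι) (x : ι) (hx : θ x ≠ x)
    (hπ : line (π⁻¹ x) = line (π⁻¹ (θ x))) (μ : ι → X) :
    exchAlt θ (fun μ => A (μ ∘ π)) μ = 0 := by
  refine Finset.sum_involution (fun τ _ => τ * swap x (θ x)) ?_ ?_ ?_ ?_
  · intro τ _
    have h1 : (swap x (θ x)) * π = π * swap (π⁻¹ x) (π⁻¹ (θ x)) := by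
      exact swap_mul_eq_mul_swap π x (θ x)
    have h2 : A ((μ ∘ (τ * swap x (θ x) : Perm ι)) ∘ π) = A ((μ ∘ τ) ∘ π) := by
      have h3 : (μ ∘ (τ * swap x (θ x) : Perm ι)) ∘ π
          = ((μ ∘ τ) ∘ π) ∘ (swap (π⁻¹ x) (π⁻¹ (θ x)) : Perm ι) := by
        rw [Function.comp_assoc, Function.comp_assoc, Function.comp_assoc, ← Perm.coe_mul,
          ← Perm.coe_mul, ← Perm.coe_mul, mul_assoc, h1]
      rw [h3]
      refine hA _ (mem_linePerms.2 fun y => ?_) _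
      by_cases hy1 : y = π⁻¹ x
      · rw [hy1, swap_apply_left, hπ]
      by_cases hy2 : y = π⁻¹ (θ x)
      · rw [hy2, swap_apply_right, hπ]
      · rw [swap_apply_of_ne_of_ne hy1 hy2]
    beta_reduce
    rw [h2, Perm.sign_mul, Perm.sign_swap hx.symm, mul_neg, mul_one, Units.val_neg, neg_smul,
      add_neg_cancel]
  · intro τ _ _ h
    have : swap x (θ x) = 1 := mul_eq_left.1 h
    exact hx (swap_eq_one_iff.1 this).symm
  · intro τ hτ
    exact mem_exchPerms.2 ((mem_exchPerms.1 hτ).mul hθ (IsExch.swap hθ x))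
  · intro τ _
    rw [mul_assoc, swap_mul_self, mul_one]

theorem exchAlt_comp_exch (hθ : IsMate line θ) (A : (ι → X) → V) {τ : Perm ι} (hτ : IsExch θ τ)
    (μ : ι → X) :
    exchAlt θ (fun μ => A (μ ∘ τ)) μ = (Perm.sign τ : ℤ) • exchAlt θ A μ := by
  unfold exchAlt
  rw [Finset.smul_sum]
  refine Finset.sum_bij' (fun σ _ => σ * τ) (fun σ _ => σ * τ) ?_ ?_ ?_ ?_ ?_
  · exact fun σ hσ => mem_exchPerms.2 ((mem_exchPerms.1 hσ).mul hθ hτ)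
  · exact fun σ hσ => mem_exchPerms.2 ((mem_exchPerms.1 hσ).mul hθ hτ)
  · intro σ _
    nth_rw 2 [← hτ.inv_eq hθ]
    rw [mul_inv_cancel_right]
  · intro σ _
    nth_rw 2 [← hτ.inv_eq hθ]
    rw [mul_inv_cancel_right]
  · intro σ _
    rw [smul_smul, Perm.sign_mul, mul_comm (Perm.sign σ), Units.val_mul, ← mul_assoc,
      ← Units.val_mul, Int.units_mul_self, Units.val_one, one_mul]
    rfl

/-- If the lines can be restored by exchanges after the permutation `π`, then `π` factors as an
exchange followed by a permutation preserving the lines. -/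
theorem exists_exch_mul (hθ : IsMate line θ) (π : Perm ι)
    (hπ : ∀ x, θ x ≠ x → line (π⁻¹ x) ≠ line (π⁻¹ (θ x))) :
    ∃ τ : Perm ι, IsExch θ τ ∧ τ * π ∈ linePerms line ∧
      movedCells line τ = Finset.univ.filter fun x => line x = true ∧ line (π⁻¹ x) = false := by
  -- A counting argument: send each second-line cell $x$ to whichever of $x,\theta x$ has its
  -- preimage in the second line. This is injective between sets of equal size, hence onto, so every
  -- cell with preimage in the second line has a mate.
  have hpos : ∀ x, line (π⁻¹ x) = true → θ x ≠ x := by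
    have hcard : (Finset.univ.filter fun x => line (π⁻¹ x) = true).card
        = (Finset.univ.filter fun x => line x = true).card := by
      refine Finset.card_bij' (fun x _ => π⁻¹ x) (fun x _ => π x) ?_ ?_ ?_ ?_ <;> simp
    have hsurj := Finset.surj_on_of_inj_on_of_card_le
      (s := Finset.univ.filter fun x => line x = true)
      (t := Finset.univ.filter fun x => line (π⁻¹ x) = true)
      (fun x _ => if line (π⁻¹ x) = true then x else θ x)
      (by
        intro x hx
        have hx' := (Finset.mem_filter.1 hx).2
        refine Finset.mem_filter.2 ⟨Finset.mem_univ _, ?_⟩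
        split_ifs with h
        · exact h
        · have := hπ x (hθ.mated x hx')
          revert this h
          cases line (π⁻¹ x) <;> cases line (π⁻¹ (θ x)) <;> simp)
      (by
        intro x y hx hy hxy
        have hx' := (Finset.mem_filter.1 hx).2
        have hy' := (Finset.mem_filter.1 hy).2
        have hfx := hθ.flip x (hθ.mated x hx')
        have hfy := hθ.flip y (hθ.mated y hy')
        split_ifs at hxy with h1 h2 h2
        · exact hxy
        · rw [hxy, hfy, hy'] at hx'; simp at hx'
        · rw [← hxy, hfx, hx'] at hy'; simp at hy'
        · rw [← hθ.invol x, hxy, hθ.invol])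
      hcard.le
    intro x hx
    obtain ⟨y, hy, hxy⟩ := hsurj x (Finset.mem_filter.2 ⟨Finset.mem_univ _, hx⟩)
    have hy' := (Finset.mem_filter.1 hy).2
    have hm := hθ.mated y hy'
    split_ifs at hxy with h
    · rwa [hxy]
    · rw [hxy, hθ.invol]; exact hm.symm
  have hne : ∀ x, line (π⁻¹ x) ≠ line x → θ x ≠ x := by
    intro x hx
    cases h : line x with
    | true => exact hθ.mated x h
    | false =>
      rw [h] at hx
      exact hpos x (by simpa using hx)
  -- The exchange of exactly those pairs whose cells come from the wrong lines.
  set κ : ι → ι := fun x => if line (π⁻¹ x) = line x then x else θ x with hκ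
  have hinv : Function.Involutive κ := by
    intro x
    by_cases h : line (π⁻¹ x) = line x
    · have h1 : κ x = x := if_pos h
      rw [h1, h1]
    · have h1 := hne x h
      have h2 := hπ x h1
      have h3 := hθ.flip x h1
      have h4 : line (π⁻¹ (θ x)) ≠ line (θ x) := by
        rw [h3]
        revert h h2
        cases line (π⁻¹ x) <;> cases line (π⁻¹ (θ x)) <;> cases line x <;> simp
      have h5 : κ x = θ x := if_neg h
      have h6 : κ (θ x) = θ (θ x) := if_neg h4
      rw [h5, h6, hθ.invol]
  refine ⟨hinv.toPerm, fun x => ?_, mem_linePerms.2 fun y => ?_, ?_⟩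
  · change κ x = x ∨ κ x = θ x
    by_cases h : line (π⁻¹ x) = line x
    · exact Or.inl (if_pos h)
    · exact Or.inr (if_neg h)
  · change line (κ (π y)) = line y
    by_cases h : line (π⁻¹ (π y)) = line (π y)
    · rw [show κ (π y) = π y from if_pos h, ← h, perm_inv_apply]
    · rw [show κ (π y) = θ (π y) from if_neg h, hθ.flip _ (hne _ h)]
      rw [perm_inv_apply] at h
      revert h
      cases line y <;> cases line (π y) <;> simp
  · ext x
    rw [mem_movedCells, Finset.mem_filter]
    change line x = true ∧ κ x ≠ x ↔ x ∈ Finset.univ ∧ line x = true ∧ line (π⁻¹ x) = false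
    refine ⟨fun h => ⟨Finset.mem_univ _, h.1, ?_⟩, fun h => ⟨h.2.1, ?_⟩⟩
    · by_contra hc
      refine h.2 (if_pos ?_)
      rw [h.1]
      simpa using hc
    · rw [show κ x = θ x from if_neg (by rw [h.2.1, h.2.2]; simp)]
      exact hθ.mated x h.2.1

/-- Antisymmetrizing a line-symmetric tensor, symmetrizing it over the lines, and antisymmetrizing
it again gives, term by term, nothing or the antisymmetrized tensor. -/
theorem sign_smul_exchAlt_comp (hθ : IsMate line θ) {σ τ : Perm ι} (hσ : σ ∈ linePerms line)
    (hτ : IsExch θ τ) :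
    ∃ c : ℕ, (τ = 1 → c = 1) ∧ ∀ A : (ι → X) → V, (∀ σ ∈ linePerms line, ∀ μ, A (μ ∘ σ) = A μ) →
      ∀ μ, (Perm.sign τ : ℤ) • exchAlt θ (fun μ => A (μ ∘ (σ * τ : Perm ι))) μ
        = c • exchAlt θ A μ := by
  by_cases hτ1 : τ = 1
  · subst hτ1
    refine ⟨1, fun _ => rfl, fun A hA μ => ?_⟩
    simp only [Perm.sign_one, Units.val_one, one_smul, mul_one]
    congr 1
    exact funext fun μ => hA σ hσ μ
  -- Either the cells of every mated pair come from different lines, and an exchange restores the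
  -- lines, or some pair comes from a single line and the term vanishes.
  by_cases hπ : ∀ x, θ x ≠ x → line ((σ * τ)⁻¹ x) ≠ line ((σ * τ)⁻¹ (θ x))
  · obtain ⟨κ, hκ, hκl, hκm⟩ := exists_exch_mul hθ (σ * τ) hπ
    refine ⟨1, fun _ => rfl, fun A hA μ => ?_⟩
    -- The cells moved by $\kappa$ in the second line are the images under $\sigma$ of those moved
    -- by $\tau$, because $\sigma$ preserves the lines.
    have hsign : Perm.sign κ = Perm.sign τ := by
      rw [hκ.sign_eq hθ, hτ.sign_eq hθ, hκm]
      congr 1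
      have hσ' := mem_linePerms.1 hσ
      refine Finset.card_bij' (fun x _ => σ⁻¹ x) (fun x _ => σ x) ?_ ?_ (by simp) (by simp)
      · intro x hx
        have hx' := (Finset.mem_filter.1 hx).2
        rw [mul_inv_rev, Perm.mul_apply, hτ.inv_eq hθ] at hx'
        have h1 : line (σ⁻¹ x) = true := by
          rw [← hσ' (σ⁻¹ x), perm_apply_inv]; exact hx'.1
        refine mem_movedCells.2 ⟨h1, (hτ.line_ne_iff hθ _).1 ?_⟩
        rw [h1, hx'.2]; simp
      · intro x hx
        have hx' := mem_movedCells.1 hx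
        refine Finset.mem_filter.2 ⟨Finset.mem_univ _, by rw [hσ', hx'.1], ?_⟩
        rw [mul_inv_rev, Perm.mul_apply, perm_inv_apply, hτ.inv_eq hθ]
        have := (hτ.line_ne_iff hθ x).2 hx'.2
        rw [hx'.1] at this
        simpa using this
    have h1 : (fun μ : ι → X => A (μ ∘ (σ * τ : Perm ι))) = fun μ => A (μ ∘ κ) := by
      funext μ
      have h2 : (σ * τ : Perm ι) = κ * (κ * (σ * τ)) := by
        rw [← mul_assoc κ κ]
        nth_rw 2 [← hκ.inv_eq hθ]
        rw [mul_inv_cancel, one_mul]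
      rw [h2, Perm.coe_mul, ← Function.comp_assoc, hA _ hκl]
    rw [h1, exchAlt_comp_exch hθ A hκ, hsign, smul_smul, ← Units.val_mul, Int.units_mul_self,
      Units.val_one, one_smul, one_smul]
  · push Not at hπ
    obtain ⟨x, hx, hl⟩ := hπ
    refine ⟨0, fun h => absurd h hτ1, fun A hA μ => ?_⟩
    rw [exchAlt_comp_eq_zero hθ hA _ x hx hl, smul_zero, zero_smul]

/-- Young symmetrization (symmetrize over the lines, then antisymmetrize over the exchanges) of
a partially antisymmetrized line-symmetric tensor. -/
theorem exists_exchAlt_sum_linePerms (hθ : IsMate line θ) (P : Finset (Perm ι))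
    (hP : P ⊆ exchPerms θ) (h1 : (1 : Perm ι) ∈ P) :
    ∃ c : ℕ, 0 < c ∧ ∀ A : (ι → X) → V, (∀ σ ∈ linePerms line, ∀ μ, A (μ ∘ σ) = A μ) →
      ∀ μ, exchAlt θ (fun μ => ∑ σ ∈ linePerms line, ∑ τ ∈ P,
        (Perm.sign τ : ℤ) • A ((μ ∘ σ) ∘ τ)) μ = c • exchAlt θ A μ := by
  have h := fun σ (hσ : σ ∈ linePerms line) τ (hτ : τ ∈ P) =>
    sign_smul_exchAlt_comp (X := X) (V := V) hθ hσ (mem_exchPerms.1 (hP hτ))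
  choose c hc1 hc using h
  refine ⟨∑ σ : {σ // σ ∈ linePerms line}, ∑ τ : {τ // τ ∈ P}, c σ.1 σ.2 τ.1 τ.2, ?_, ?_⟩
  -- The coefficients are natural numbers, so nothing cancels the contribution $1$ of
  -- $\sigma=\tau=1$.
  · have h1l : (1 : Perm ι) ∈ linePerms line := mem_linePerms.2 fun _ => rfl
    refine Finset.sum_pos' (fun _ _ => Nat.zero_le _) ⟨⟨1, h1l⟩, Finset.mem_univ _, ?_⟩
    refine Finset.sum_pos' (fun _ _ => Nat.zero_le _) ⟨⟨1, h1⟩, Finset.mem_univ _, ?_⟩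
    rw [hc1 1 h1l 1 h1 rfl]
    exact one_pos
  · intro A hA μ
    have h2 : exchAlt θ (fun μ => ∑ σ ∈ linePerms line, ∑ τ ∈ P,
        (Perm.sign τ : ℤ) • A ((μ ∘ σ) ∘ τ)) μ
        = ∑ σ ∈ linePerms line, ∑ τ ∈ P,
          (Perm.sign τ : ℤ) • exchAlt θ (fun μ => A (μ ∘ (σ * τ : Perm ι))) μ := by
      unfold exchAlt
      simp only [Finset.smul_sum]
      rw [Finset.sum_comm]
      refine Finset.sum_congr rfl fun σ _ => ?_
      rw [Finset.sum_comm]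
      refine Finset.sum_congr rfl fun τ _ => Finset.sum_congr rfl fun κ _ => ?_
      rw [smul_comm]
      rfl
    rw [h2, Finset.sum_smul, ← Finset.sum_attach (linePerms line)]
    refine Finset.sum_congr rfl fun σ _ => ?_
    rw [Finset.sum_smul, ← Finset.sum_attach P]
    exact Finset.sum_congr rfl fun τ _ => hc σ.1 σ.2 τ.1 τ.2 A hA μ

end TwoLines

end NComplex

namespace NComplex

/-! ### Tensor fields with components in the smooth functions -/

/-- Tensor fields of degree `p`, given by their components. -/
abbrev TField (D p : ℕ) : Type := (Fin p → Fin D) → SmoothFn D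

section TField

open MvPolynomial SmoothFn SymPoly

variable {D : ℕ}

/-- The tensor field `∂T`, with components `∂_{μ₀} T_{μ₁ ⋯ μ_p}`. -/
noncomputable def dT {p : ℕ} (T : TField D p) : TField D (p + 1) :=
  fun μ => pd (μ 0) (T (Fin.tail μ))

/-- The components of `T` with first index `a`. -/
def slice {p : ℕ} (a : Fin D) (T : TField D (p + 1)) : TField D p := fun ν => T (Fin.cons a ν)

/-- Invariance under all permutations of the indices. -/
def IsSymm {X V : Type*} {p : ℕ} (T : (Fin p → X) → V) : Prop :=
  ∀ (τ : Equiv.Perm (Fin p)) (μ : Fin p → X), T (μ ∘ τ) = T μ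

/-- The extension of a permutation of `Fin n` to `Fin (n + 1)` that fixes `0`. -/
def liftPerm {n : ℕ} (τ : Equiv.Perm (Fin n)) : Equiv.Perm (Fin (n + 1)) :=
  Equiv.Perm.decomposeFin.symm (0, τ)

theorem liftPerm_zero {n : ℕ} (τ : Equiv.Perm (Fin n)) : liftPerm τ 0 = 0 :=
  Equiv.Perm.decomposeFin_symm_apply_zero 0 τ

theorem liftPerm_succ {n : ℕ} (τ : Equiv.Perm (Fin n)) (i : Fin n) :
    liftPerm τ i.succ = (τ i).succ := by
  rw [liftPerm, Equiv.Perm.decomposeFin_symm_apply_succ, Equiv.swap_self, Equiv.refl_apply]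

theorem sign_liftPerm {n : ℕ} (τ : Equiv.Perm (Fin n)) :
    Equiv.Perm.sign (liftPerm τ) = Equiv.Perm.sign τ := by
  rw [liftPerm, Equiv.Perm.decomposeFin.symm_sign, if_pos rfl, one_mul]

theorem liftPerm_injective {n : ℕ} :
    Function.Injective (liftPerm : Equiv.Perm (Fin n) → Equiv.Perm (Fin (n + 1))) := by
  intro σ τ h
  ext i
  have := congrArg (fun e => e i.succ) h
  simp only [liftPerm_succ] at this
  exact congrArg Fin.val (Fin.succ_injective _ this)

theorem cons_comp_liftPerm {X : Type*} {n : ℕ} (a : X) (μ : Fin n → X) (τ : Equiv.Perm (Fin n)) :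
    (Fin.cons a μ : Fin (n + 1) → X) ∘ liftPerm τ = Fin.cons a (μ ∘ τ) := by
  funext i
  cases i using Fin.cases with
  | zero => simp [liftPerm_zero]
  | succ i => simp [liftPerm_succ]

theorem tail_comp_liftPerm {X : Type*} {n : ℕ} (μ : Fin (n + 1) → X) (τ : Equiv.Perm (Fin n)) :
    Fin.tail (μ ∘ liftPerm τ) = Fin.tail μ ∘ τ := by
  funext i
  simp [Fin.tail, liftPerm_succ]

theorem dT_comp_liftPerm {p : ℕ} (T : TField D p) (τ : Equiv.Perm (Fin p))
    (μ : Fin (p + 1) → Fin D) :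
    dT T (μ ∘ liftPerm τ) = pd (μ 0) (T (Fin.tail μ ∘ τ)) := by
  rw [dT, tail_comp_liftPerm, Function.comp_apply, liftPerm_zero]

theorem IsSymm.slice {p : ℕ} {T : TField D (p + 1)} (hT : IsSymm T) (a : Fin D) :
    IsSymm (slice a T) := by
  intro τ μ
  rw [NComplex.slice, NComplex.slice, ← cons_comp_liftPerm, hT]

theorem IsSymm.cons_cons {p : ℕ} {T : TField D (p + 2)} (hT : IsSymm T) (a b : Fin D)
    (ν : Fin p → Fin D) :
    T (Fin.cons a (Fin.cons b ν : Fin (p + 1) → Fin D))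
      = T (Fin.cons b (Fin.cons a ν : Fin (p + 1) → Fin D)) := by
  rw [← hT (Equiv.swap 0 1)]
  congr 1
  funext i
  refine Fin.cases ?_ (fun i => Fin.cases ?_ (fun i => ?_) i) i
  · simp only [Function.comp_apply, Equiv.swap_apply_left, Fin.cons_zero]
    exact Fin.cons_succ (α := fun _ => Fin D) _ _ 0
  · change (Fin.cons a (Fin.cons b ν : Fin (p + 1) → Fin D) : Fin (p + 2) → Fin D)
      (Equiv.swap 0 1 1) = _
    simp only [Equiv.swap_apply_right, Fin.cons_zero, Fin.cons_succ]
  · simp only [Function.comp_apply]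
    rw [Equiv.swap_apply_of_ne_of_ne (Fin.succ_ne_zero _) (by
      rw [← Fin.succ_zero_eq_one, Ne, Fin.succ_inj]; exact Fin.succ_ne_zero _)]
    simp only [Fin.cons_succ]

/-- The generating polynomial `∑ T_μ v_{μ₁} ⋯ v_{μ_p}`. -/
noncomputable def genPoly {p : ℕ} (T : TField D p) : SymPoly D := ∑ μ, C (T μ) * ∏ i, X (μ i)

theorem genPoly_zero_index (T : TField D 0) : genPoly T = C (T Fin.elim0) := by
  rw [genPoly, Fintype.sum_unique]
  simp only [Finset.univ_eq_empty, Finset.prod_empty, mul_one]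
  congr 2

theorem genPoly_succ {p : ℕ} (T : TField D (p + 1)) :
    genPoly T = ∑ a, X a * genPoly (slice a T) := by
  unfold genPoly
  rw [← (Fin.consEquiv fun _ : Fin (p + 1) => Fin D).sum_comp, Fintype.sum_prod_type]
  refine Finset.sum_congr rfl fun a _ => ?_
  rw [Finset.mul_sum]
  refine Finset.sum_congr rfl fun ν _ => ?_
  rw [Fin.prod_univ_succ]
  change C (T (Fin.cons a ν)) * (X a * ∏ i, X (ν i)) = X a * (C (T (Fin.cons a ν)) * ∏ i, X (ν i))
  ring

theorem genPoly_add {p : ℕ} (S T : TField D p) : genPoly (S + T) = genPoly S + genPoly T := by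
  simp only [genPoly, Pi.add_apply, map_add, add_mul, Finset.sum_add_distrib]

theorem genPoly_smul {p : ℕ} (r : ℝ) (T : TField D p) : genPoly (r • T) = r • genPoly T := by
  unfold genPoly
  rw [Finset.smul_sum]
  refine Finset.sum_congr rfl fun μ _ => ?_
  rw [Pi.smul_apply, ← smul_mul_assoc]
  congr 1
  ext1 s
  classical
  rw [coeff_smul, coeff_C, coeff_C]
  split_ifs <;> simp

theorem isHomogeneous_genPoly {p : ℕ} (T : TField D p) : (genPoly T).IsHomogeneous p := by
  refine IsHomogeneous.sum _ _ _ fun μ _ => ?_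
  have h1 : (∏ i, X (μ i) : SymPoly D).IsHomogeneous (∑ _i : Fin p, 1) :=
    IsHomogeneous.prod _ _ _ fun i _ => isHomogeneous_X _ _
  have h2 := (isHomogeneous_C (Fin D) (T μ)).mul h1
  simpa using h2

theorem pdC_genPoly {p : ℕ} (a : Fin D) (T : TField D p) :
    pdC a (genPoly T) = genPoly (fun ν => pd a (T ν)) := by
  ext1 s
  unfold genPoly
  rw [pdC, coeff_coefMap, coeff_sum, coeff_sum, map_sum]
  refine Finset.sum_congr rfl fun μ _ => ?_
  rw [coeff_C_mul, coeff_C_mul, pd_mul]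
  have h : pd a (coeff s (∏ i, X (μ i) : SymPoly D)) = 0 := by
    have h1 : (∏ i, X (μ i) : SymPoly D) = monomial (∑ i, Finsupp.single (μ i) 1) 1 := by
      rw [monomial_sum_one]
      rfl
    classical
    have h2 : pd a (1 : SmoothFn D) = 0 := by
      have := pd_mul a (1 : SmoothFn D) 1
      rw [mul_one, one_mul, mul_one] at this
      exact left_eq_add.1 this
    rw [h1, coeff_monomial]
    split_ifs
    · exact h2
    · exact map_zero _
  rw [h, mul_zero, add_zero]

theorem genPoly_dT {p : ℕ} (T : TField D p) : genPoly (dT T) = grad (genPoly T) := by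
  rw [genPoly_succ, grad_apply]
  refine Finset.sum_congr rfl fun a _ => ?_
  rw [pdC_genPoly]
  congr 2

theorem genPoly_comp_perm {p : ℕ} (T : TField D p) (τ : Equiv.Perm (Fin p)) :
    genPoly (fun μ => T (μ ∘ τ)) = genPoly T := by
  unfold genPoly
  rw [← (Equiv.arrowCongr τ (Equiv.refl (Fin D))).sum_comp]
  refine Finset.sum_congr rfl fun μ _ => ?_
  have h : (Equiv.arrowCongr τ (Equiv.refl (Fin D))) μ ∘ τ = μ := by
    funext i
    simp
  beta_reduce
  rw [h]
  congr 1
  refine Fintype.prod_equiv τ.symm _ _ fun i => ?_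
  simp

/-- By symmetry each of the $p+1$ positions contributes the same slice. -/
theorem pderiv_genPoly {p : ℕ} {T : TField D (p + 1)} (hT : IsSymm T) (b : Fin D) :
    pderiv b (genPoly T) = ((p : ℝ) + 1) • genPoly (slice b T) := by
  have h0 : ∀ {p : ℕ} (T : TField D (p + 1)), pderiv b (genPoly T)
      = genPoly (slice b T) + ∑ a, X a * pderiv b (genPoly (slice a T)) := by
    intro p T
    rw [genPoly_succ, map_sum]
    simp only [pderiv_mul, pderiv_X, Finset.sum_add_distrib]
    congr 1
    classical
    rw [Finset.sum_eq_single b]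
    · simp
    · intro a _ hab
      simp [Ne.symm hab]
    · simp
  induction p with
  | zero =>
    rw [h0]
    simp only [genPoly_zero_index, pderiv_C, mul_zero, Finset.sum_const_zero, add_zero,
      Nat.cast_zero, zero_add, one_smul]
  | succ p ih =>
    rw [h0]
    simp only [ih (hT.slice _)]
    have h1 : ∑ a, X a * ((p : ℝ) + 1) • genPoly (slice b (slice a T))
        = ((p : ℝ) + 1) • genPoly (slice b T) := by
      rw [genPoly_succ (slice b T), Finset.smul_sum]
      refine Finset.sum_congr rfl fun a _ => ?_
      rw [mul_smul_comm]
      congr 3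
      exact funext fun ν => hT.cons_cons a b ν
    rw [h1, Nat.cast_succ, add_smul ((p : ℝ) + 1) (1 : ℝ), one_smul, add_comm]

/-- Derivatives in $v_b$ recover the slices of $T$ up to a nonzero factor, and these are again
symmetric. Symmetry cannot be dropped, since `genPoly` sees only the symmetric part. -/
theorem eq_zero_of_genPoly_eq_zero {p : ℕ} {T : TField D p} (hT : IsSymm T) (h : genPoly T = 0) :
    T = 0 := by
  induction p with
  | zero =>
    rw [genPoly_zero_index, C_eq_zero] at h
    funext μ
    rw [Subsingleton.elim μ Fin.elim0, h]
    rfl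
  | succ p ih =>
    funext μ
    have h1 := pderiv_genPoly hT (μ 0)
    rw [h, map_zero] at h1
    have hp : ((p : ℝ) + 1) ≠ 0 := by positivity
    have h2 := ih (hT.slice (μ 0)) (by
      have := congrArg (((p : ℝ) + 1)⁻¹ • ·) h1
      simpa only [smul_smul, inv_mul_cancel₀ hp, one_smul, smul_zero] using this.symm)
    have h3 := congrFun h2 (Fin.tail μ)
    rwa [slice, Fin.cons_self_tail] at h3

theorem genPoly_injective {p : ℕ} {S T : TField D p} (hS : IsSymm S) (hT : IsSymm T)
    (h : genPoly S = genPoly T) : S = T := by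
  have h1 : IsSymm (S + (-1 : ℝ) • T) := by
    intro τ μ
    rw [Pi.add_apply, Pi.smul_apply, hS, hT]
    rfl
  have h2 := eq_zero_of_genPoly_eq_zero h1 (by
    rw [genPoly_add, genPoly_smul, h, neg_smul, one_smul, add_neg_cancel])
  rw [neg_smul, one_smul] at h2
  exact add_neg_eq_zero.1 h2

/-- Euler's formula expresses $g$ through its derivatives, which are represented by induction. The
field so obtained need not be symmetric; the Young symmetrizer will symmetrize it. -/
theorem exists_genPoly_eq (q : ℕ) : ∀ {g : SymPoly D}, g.IsHomogeneous q →
    ∃ S : TField D q, genPoly S = g := by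
  induction q with
  | zero =>
    intro g hg
    rw [← totalDegree_zero_iff_isHomogeneous, totalDegree_eq_zero_iff_eq_C] at hg
    refine ⟨fun _ => coeff 0 g, ?_⟩
    rw [genPoly_zero_index, ← hg]
  | succ q ih =>
    intro g hg
    choose S hS using fun a => ih (hg.pderiv (i := a))
    have hq : (((q + 1 : ℕ) : ℝ)) ≠ 0 := by positivity
    refine ⟨((q + 1 : ℕ) : ℝ)⁻¹ • fun μ => S (μ 0) (Fin.tail μ), ?_⟩
    have h1 : genPoly (fun μ : Fin (q + 1) → Fin D => S (μ 0) (Fin.tail μ))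
        = ((q + 1 : ℕ) : ℝ) • g := by
      rw [genPoly_succ, Nat.cast_smul_eq_nsmul, ← hg.sum_X_mul_pderiv]
      refine Finset.sum_congr rfl fun a _ => ?_
      rw [← hS a]
      congr 1
    rw [genPoly_smul, h1, smul_smul, inv_mul_cancel₀ hq, one_smul]

/-- The components `∂_b T_{ν a} - ∂_a T_{ν b}`. -/
noncomputable def curlT {p : ℕ} (a b : Fin D) (T : TField D (p + 1)) : TField D p :=
  fun ν => pd b (T (Fin.snoc ν a)) - pd a (T (Fin.snoc ν b))

theorem IsSymm.snoc_eq_cons {p : ℕ} {T : TField D (p + 1)} (hT : IsSymm T) (a : Fin D)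
    (ν : Fin p → Fin D) : T (Fin.snoc ν a) = T (Fin.cons a ν) := by
  rw [Fin.snoc_eq_cons_rotate]
  exact hT (finRotate _) _

theorem IsSymm.curlT {p : ℕ} {T : TField D (p + 1)} (hT : IsSymm T) (a b : Fin D) :
    IsSymm (curlT a b T) := by
  intro τ ν
  have h := fun a => hT.slice a τ ν
  simp only [NComplex.slice] at h
  simp only [NComplex.curlT, hT.snoc_eq_cons, h]

theorem curl_genPoly {p : ℕ} {T : TField D (p + 1)} (hT : IsSymm T) (a b : Fin D) :
    curl a b (genPoly T) = ((p : ℝ) + 1) • genPoly (curlT a b T) := by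
  have h1 : ∀ a b, pderiv a (pdC b (genPoly T))
      = ((p : ℝ) + 1) • genPoly (fun ν => pd b (T (Fin.snoc ν a))) := by
    intro a b
    rw [pderiv_pdC, pderiv_genPoly hT, map_smul, pdC_genPoly]
    simp only [slice, hT.snoc_eq_cons]
  have h2 : curlT a b T = (fun ν => pd b (T (Fin.snoc ν a)))
      + (-1 : ℝ) • fun ν => pd a (T (Fin.snoc ν b)) := by
    rw [neg_smul, one_smul, ← sub_eq_add_neg]
    rfl
  rw [curl_apply, h1, h1, h2, genPoly_add, genPoly_smul, neg_smul, one_smul, ← sub_eq_add_neg,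
    smul_sub]

end TField

end NComplex

namespace NComplex

/-! ### Iterated derivatives of tensor fields. -/

section IteratedDerivative

open SmoothFn SymPoly

variable {D : ℕ}

/-- The iterated derivative `∂_{α₀} ⋯ ∂_{α_{k-1}} f`. -/
noncomputable def pdIter {k : ℕ} (α : Fin k → Fin D) (f : SmoothFn D) : SmoothFn D :=
  (List.ofFn α).foldr (fun a g => pd a g) f

theorem pdIter_zero (α : Fin 0 → Fin D) (f : SmoothFn D) : pdIter α f = f := by
  simp [pdIter]

theorem pdIter_succ {k : ℕ} (α : Fin (k + 1) → Fin D) (f : SmoothFn D) :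
    pdIter α f = pd (α 0) (pdIter (Fin.tail α) f) := by
  rw [pdIter, List.ofFn_succ, List.foldr_cons]
  rfl

theorem pdIter_snoc {k : ℕ} (α : Fin k → Fin D) (a : Fin D) (f : SmoothFn D) :
    pdIter (Fin.snoc α a : Fin (k + 1) → Fin D) f = pdIter α (pd a f) := by
  rw [pdIter, List.ofFn_succ', List.concat_eq_append, List.foldr_concat, Fin.snoc_last]
  simp only [Fin.snoc_castSucc]
  rfl

theorem pdIter_comp_perm {k : ℕ} (α : Fin k → Fin D) (τ : Equiv.Perm (Fin k)) (f : SmoothFn D) :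
    pdIter (α ∘ τ) f = pdIter α f := by
  have : LeftCommutative (fun (a : Fin D) (g : SmoothFn D) => pd a g) := ⟨fun a b f => pd_comm a b f⟩
  exact (Equiv.Perm.ofFn_comp_perm τ α).foldr_eq f

theorem pdIter_sub {k : ℕ} (α : Fin k → Fin D) (f g : SmoothFn D) :
    pdIter α (f - g) = pdIter α f - pdIter α g := by
  induction k with
  | zero => simp only [pdIter_zero]
  | succ k ih => simp only [pdIter_succ, ih, map_sub]

/-- The tensor field `∂ ^ i T`. -/
noncomputable def iterD {m : ℕ} : (i : ℕ) → TField D m → TField D (m + i)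
  | 0, T => T
  | i + 1, T => dT (iterD i T)

theorem iterD_apply {m : ℕ} (i : ℕ) (T : TField D m) (μ : Fin (m + i) → Fin D) :
    iterD i T μ = pdIter (fun j : Fin i => μ ⟨j, by omega⟩)
      (T fun j : Fin m => μ ⟨i + j, by omega⟩) := by
  induction i with
  | zero =>
    rw [iterD, pdIter_zero]
    congr 1
    funext j
    congr 1
    exact Fin.ext (Nat.zero_add _).symm
  | succ i ih =>
    rw [iterD, dT, ih, pdIter_succ]
    congr 2
    congr 1
    funext j
    rw [Fin.tail]
    congr 1
    exact Fin.ext (by simp only [Fin.val_succ]; omega)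

end IteratedDerivative

/-! ### Slots, rows and column exchanges of a two-row diagram. -/

section TwoRowSlots

variable {m i : ℕ}

/-- The slot in the same column of a two-row diagram whose second row has `i` cells, in the first
slots, and whose first row has `m` cells. -/
def rowMate (m i : ℕ) (_him : i ≤ m) (x : Fin (m + i)) : Fin (m + i) :=
  if h : x.1 < i then ⟨x.1 + m, by omega⟩
  else if h : m ≤ x.1 then ⟨x.1 - m, by omega⟩ else x

/-- Whether a slot is in the second row. -/
def inSecondRow (m i : ℕ) (x : Fin (m + i)) : Bool := decide (x.1 < i)

theorem val_rowMate (him : i ≤ m) (x : Fin (m + i)) :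
    (rowMate m i him x).1 = if x.1 < i then x.1 + m else if m ≤ x.1 then x.1 - m else x.1 := by
  unfold rowMate
  split_ifs <;> rfl

theorem isMate_rowMate (_hm : 0 < m) (him : i ≤ m) :
    IsMate (inSecondRow m i) (rowMate m i him) where
  invol x := by
    apply Fin.ext
    rw [val_rowMate, val_rowMate]
    split_ifs <;> omega
  flip x hx := by
    have hx' : (rowMate m i him x).1 ≠ x.1 := fun h => hx (Fin.ext h)
    rw [inSecondRow, inSecondRow, ← decide_not]
    congr 1
    rw [val_rowMate] at hx' ⊢
    apply propext
    split_ifs at hx' ⊢ <;> omega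
  mated x hx := by
    have hx' : x.1 < i := by simpa [inSecondRow] using hx
    intro h
    have := congrArg Fin.val h
    rw [val_rowMate, if_pos hx'] at this
    omega

theorem rowOf_two_rows (_hm : 0 < m) (him : i ≤ m) (x y : Fin (m + i)) :
    rowOf (m + 1) x = rowOf (m + 1) y ↔ inSecondRow m i x = inSecondRow m i y := by
  have h : ∀ x : Fin (m + i), rowOf (m + 1) x = if x.1 < i then 1 else 0 := by
    intro x
    rw [rowOf, Fin.val_rev, Nat.add_sub_cancel]
    split_ifs with h
    · refine Nat.div_eq_of_lt_le ?_ ?_ <;> omega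
    · exact Nat.div_eq_of_lt (by omega)
  rw [h, h, inSecondRow, inSecondRow]
  by_cases h1 : x.1 < i <;> by_cases h2 : y.1 < i <;> simp [h1, h2]

theorem colOf_two_rows (hm : 0 < m) (him : i ≤ m) (x y : Fin (m + i)) :
    colOf (m + 1) x = colOf (m + 1) y ↔ x = y ∨ x = rowMate m i him y := by
  have h : ∀ x : Fin (m + i), colOf (m + 1) x
      = if x.1 < i then i - 1 - x.1 else m + i - 1 - x.1 := by
    intro x
    rw [colOf, Fin.val_rev, Nat.add_sub_cancel]
    split_ifs with h
    · rw [Nat.mod_eq_sub_mod (by omega), Nat.mod_eq_of_lt (by omega)]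
      omega
    · rw [Nat.mod_eq_of_lt (by omega)]
      omega
  rw [h, h, Fin.ext_iff, Fin.ext_iff, val_rowMate]
  have := x.2
  have := y.2
  split_ifs <;> omega

theorem rowPerms_two_rows (hm : 0 < m) (him : i ≤ m) :
    rowPerms (m + 1) (m + i) = linePerms (inSecondRow m i) := by
  ext σ
  rw [mem_linePerms, rowPerms, Finset.mem_filter]
  simp only [Finset.mem_univ, true_and, rowOf_two_rows hm him]

theorem colPerms_two_rows (hm : 0 < m) (him : i ≤ m) :
    colPerms (m + 1) (m + i) = exchPerms (rowMate m i him) := by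
  ext σ
  rw [mem_exchPerms, colPerms, Finset.mem_filter]
  simp only [Finset.mem_univ, true_and, colOf_two_rows hm him]
  rfl

/-- A cell added to the second row becomes slot $0$: the old columns shift by one slot, and a lifted
exchange leaves the new column alone. -/
theorem liftPerm_mem_exchPerms (him : i + 1 ≤ m) {τ : Equiv.Perm (Fin (m + i))}
    (hτ : τ ∈ exchPerms (rowMate m i (by omega))) :
    liftPerm τ ∈ exchPerms (rowMate m (i + 1) him) := by
  refine mem_exchPerms.2 fun x => ?_
  refine Fin.cases ?_ (fun y => ?_) x
  · exact Or.inl (liftPerm_zero τ)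
  · rw [liftPerm_succ]
    rcases mem_exchPerms.1 hτ y with h | h
    · rw [h]; exact Or.inl rfl
    · rw [h]
      by_cases hy : rowMate m i (by omega) y = y
      · rw [hy]; exact Or.inl rfl
      · refine Or.inr (Fin.ext ?_)
        have hy' : (rowMate m i (by omega) y).1 ≠ y.1 := fun h => hy (Fin.ext h)
        rw [Fin.val_succ, val_rowMate, val_rowMate, Fin.val_succ]
        rw [val_rowMate] at hy'
        split_ifs at hy' ⊢ <;> omega

variable {D : ℕ}

open SmoothFn SymPoly

/-- Partial derivatives commute and $T$ is symmetric. The work is to split $\sigma$ into a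
permutation of the $i$ derivative slots and one of the $m$ slots of $T$. -/
theorem iterD_comp_linePerm {T : TField D m} (hT : IsSymm T) {σ : Equiv.Perm (Fin (m + i))}
    (hσ : σ ∈ linePerms (inSecondRow m i)) (μ : Fin (m + i) → Fin D) :
    iterD i T (μ ∘ σ) = iterD i T μ := by
  have h1 : ∀ x, x.1 < i ↔ (σ x).1 < i := by
    intro x
    have := mem_linePerms.1 hσ x
    simp only [inSecondRow, decide_eq_decide] at this
    exact this.symm
  let e1 : Fin i ≃ {x : Fin (m + i) // x.1 < i} :=
    { toFun := fun j => ⟨⟨j.1, by omega⟩, j.2⟩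
      invFun := fun x => ⟨x.1.1, x.2⟩
      left_inv := fun j => rfl
      right_inv := fun x => rfl }
  let e2 : Fin m ≃ {x : Fin (m + i) // ¬ x.1 < i} :=
    { toFun := fun j => ⟨⟨i + j.1, by omega⟩, by simp⟩
      invFun := fun x => ⟨x.1.1 - i, by have := x.1.2; omega⟩
      left_inv := fun j => Fin.ext (by simp)
      right_inv := fun x => Subtype.ext (Fin.ext (by have := x.2; simp only; omega)) }
  let s1 : Equiv.Perm (Fin i) := (e1.trans (σ.subtypePerm fun x => (h1 x).symm)).trans e1.symm
  let s2 : Equiv.Perm (Fin m) :=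
    (e2.trans (σ.subtypePerm fun x => (not_congr (h1 x)).symm)).trans e2.symm
  have hs1 : ∀ j : Fin i, (⟨(s1 j).1, by omega⟩ : Fin (m + i)) = σ ⟨j.1, by omega⟩ := fun j =>
    congrArg Subtype.val (e1.apply_symm_apply (σ.subtypePerm (fun x => (h1 x).symm) (e1 j)))
  have hs2 : ∀ j : Fin m, (⟨i + (s2 j).1, by omega⟩ : Fin (m + i)) = σ ⟨i + j.1, by omega⟩ :=
    fun j => congrArg Subtype.val
      (e2.apply_symm_apply (σ.subtypePerm (fun x => (not_congr (h1 x)).symm) (e2 j)))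
  rw [iterD_apply, iterD_apply]
  have h2 : (fun j : Fin i => (μ ∘ σ) ⟨j, by omega⟩)
      = (fun j : Fin i => μ ⟨j, by omega⟩) ∘ s1 := by
    funext j
    simp only [Function.comp_apply, hs1]
  have h3 : (fun j : Fin m => (μ ∘ σ) ⟨i + j, by omega⟩)
      = (fun j : Fin m => μ ⟨i + j, by omega⟩) ∘ s2 := by
    funext j
    simp only [Function.comp_apply, hs2]
  rw [h2, h3, pdIter_comp_perm, hT]

/-- The sign of the exchange of a set of columns. -/
def colSign {k : ℕ} (K : Fin k → Bool) : ℤ := ∏ j, if K j then -1 else 1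

/-- The entries of `α` in the columns of `K`, and those of `β` in the others. -/
def colSelect {X : Type*} {k : ℕ} (K : Fin k → Bool) (α β : Fin k → X) (j : Fin k) : X :=
  if K j then α j else β j

theorem colSelect_snoc {X : Type*} {k : ℕ} (K : Fin k → Bool) (c : Bool) (α β : Fin k → X)
    (a b : X) :
    colSelect (Fin.snoc K c : Fin (k + 1) → Bool) (Fin.snoc α a) (Fin.snoc β b)
      = Fin.snoc (colSelect K α β) (if c then a else b) := by
  funext j
  refine Fin.lastCases ?_ (fun j => ?_) j
  · simp [colSelect]
  · simp [colSelect]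

/-- A product of $k$ curls expands into $2^k$ terms: in each pair $(\alpha_j,\beta_j)$ one index
differentiates and the other stays on $T$. The induction peels off the last pair, since `curlT` acts
on the last index. -/
theorem curlVanish_genPoly {r : ℕ} (k : ℕ) : ∀ {T : TField D (r + k)}, IsSymm T →
    (∀ (α β : Fin k → Fin D) (ρ : Fin r → Fin D), ∑ K : Fin k → Bool, colSign K •
      pdIter (colSelect K β α) (T (Fin.append ρ (colSelect K α β))) = 0) →
    CurlVanish k (genPoly T) := by
  induction k with
  | zero =>
    intro T _ h
    rw [CurlVanish]
    have hT : T = 0 := by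
      funext μ
      have h1 := h Fin.elim0 Fin.elim0 μ
      rw [Fintype.sum_unique] at h1
      simp only [colSign, Finset.univ_eq_empty, Finset.prod_empty, one_smul, pdIter_zero] at h1
      rw [Pi.zero_apply, ← h1]
      congr 1
      rw [Subsingleton.elim (colSelect _ _ _) (Fin.elim0 : Fin 0 → Fin D), Fin.append_elim0]
      rfl
    rw [hT]
    simp [genPoly]
  | succ k ih =>
    intro T hT h a b
    rw [curl_genPoly (p := r + k) hT]
    refine curlVanish_smul _ _ (ih (hT.curlT (p := r + k) a b) fun α β ρ => ?_)
    rw [← h (Fin.snoc α b) (Fin.snoc β a) ρ,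
      ← (Fin.snocEquiv fun _ : Fin (k + 1) => Bool).sum_comp, Fintype.sum_prod_type, Fintype.sum_bool,
      ← Finset.sum_add_distrib]
    refine Finset.sum_congr rfl fun K _ => ?_
    have hs : ∀ c : Bool, (Fin.snocEquiv fun _ : Fin (k + 1) => Bool) (c, K)
        = (Fin.snoc K c : Fin (k + 1) → Bool) := fun c => rfl
    have hsign : ∀ c : Bool, colSign (Fin.snoc K c : Fin (k + 1) → Bool)
        = colSign K * if c then -1 else 1 := by
      intro c
      rw [colSign, Fin.prod_univ_castSucc]
      simp only [Fin.snoc_castSucc, Fin.snoc_last]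
      rfl
    rw [hs, hs, hsign, hsign, colSelect_snoc, colSelect_snoc, colSelect_snoc, colSelect_snoc,
      Fin.append_snoc, Fin.append_snoc, pdIter_snoc, pdIter_snoc, curlT, pdIter_sub]
    simp only [if_true, Bool.false_eq_true, if_false, mul_one, mul_neg, neg_smul, smul_sub]
    abel

end TwoRowSlots

end NComplex

namespace NComplex

open SmoothFn SymPoly

/-! ### Column exchanges indexed by sets of columns. -/

section ExchangeSum

variable {D m k : ℕ}

/-- The exchange of the columns of `K` in a two-row diagram. -/
def colExch (hkm : k ≤ m) (hm : 0 < m) (K : Fin k → Bool) : Equiv.Perm (Fin (m + k)) :=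
  have hθ := isMate_rowMate hm hkm
  Function.Involutive.toPerm
    (fun x => if ∃ j : Fin k, K j = true ∧ (x.1 = j.1 ∨ x.1 = j.1 + m) then rowMate m k hkm x else x)
    (by
      intro x
      by_cases h : ∃ j : Fin k, K j = true ∧ (x.1 = j.1 ∨ x.1 = j.1 + m)
      · have h' : ∃ j : Fin k, K j = true ∧
            ((rowMate m k hkm x).1 = j.1 ∨ (rowMate m k hkm x).1 = j.1 + m) := by
          obtain ⟨j, hj, hx⟩ := h
          refine ⟨j, hj, ?_⟩
          rw [val_rowMate]
          have := j.2
          split_ifs <;> omega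
        beta_reduce
        rw [if_pos h, if_pos h', hθ.invol]
      · beta_reduce
        rw [if_neg h, if_neg h])

theorem colExch_apply (hkm : k ≤ m) (hm : 0 < m) (K : Fin k → Bool) (x : Fin (m + k)) :
    colExch hkm hm K x = if ∃ j : Fin k, K j = true ∧ (x.1 = j.1 ∨ x.1 = j.1 + m)
      then rowMate m k hkm x else x := rfl

theorem val_colExch_lt (hkm : k ≤ m) (hm : 0 < m) (K : Fin k → Bool) (j : Fin k) :
    (colExch hkm hm K ⟨j.1, by omega⟩).1 = if K j then j.1 + m else j.1 := by
  rw [colExch_apply]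
  by_cases h : K j = true
  · rw [if_pos ⟨j, h, Or.inl rfl⟩, val_rowMate, if_pos j.2, if_pos h]
  · rw [if_neg, if_neg h]
    rintro ⟨j', hj', hx⟩
    have : j = j' := Fin.ext (by have := j.2; simp only at hx; omega)
    exact h (this ▸ hj')

theorem val_colExch_ge (hkm : k ≤ m) (hm : 0 < m) (K : Fin k → Bool) (j : Fin k) :
    (colExch hkm hm K ⟨j.1 + m, by omega⟩).1 = if K j then j.1 else j.1 + m := by
  rw [colExch_apply]
  by_cases h : K j = true
  · rw [if_pos ⟨j, h, Or.inr rfl⟩, val_rowMate, if_pos h, if_neg (by simp only; omega),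
      if_pos (by simp only; omega)]
    simp only
    omega
  · rw [if_neg, if_neg h]
    rintro ⟨j', hj', hx⟩
    have : j = j' := Fin.ext (by have := j'.2; simp only at hx; omega)
    exact h (this ▸ hj')

theorem val_colExch_mid (hkm : k ≤ m) (hm : 0 < m) (K : Fin k → Bool) (x : Fin (m + k))
    (h1 : k ≤ x.1) (h2 : x.1 < m) : (colExch hkm hm K x).1 = x.1 := by
  rw [colExch_apply, if_neg]
  rintro ⟨j', _, hx⟩
  have := j'.2
  omega

theorem isExch_colExch (hkm : k ≤ m) (hm : 0 < m) (K : Fin k → Bool) :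
    IsExch (rowMate m k hkm) (colExch hkm hm K) := by
  intro x
  rw [colExch_apply]
  split_ifs
  · exact Or.inr rfl
  · exact Or.inl rfl

theorem sign_colExch (hkm : k ≤ m) (hm : 0 < m) (K : Fin k → Bool) :
    (Equiv.Perm.sign (colExch hkm hm K) : ℤ) = colSign K := by
  rw [(isExch_colExch hkm hm K).sign_eq (isMate_rowMate hm hkm), colSign, Finset.prod_ite,
    Finset.prod_const, Finset.prod_const_one, mul_one, Units.val_pow_eq_pow_val, Units.val_neg,
    Units.val_one]
  congr 1
  symm
  refine Finset.card_bij (fun j _ => ⟨j.1, by omega⟩) ?_ ?_ ?_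
  · intro j hj
    refine mem_movedCells.2 ⟨by simp [inSecondRow], fun h => ?_⟩
    have h1 := congrArg Fin.val h
    rw [val_colExch_lt, if_pos (Finset.mem_filter.1 hj).2] at h1
    simp only at h1
    omega
  · intro j _ j' _ h
    exact Fin.ext (Fin.mk.inj h)
  · intro x hx
    have hx' := mem_movedCells.1 hx
    have hxk : x.1 < k := by simpa [inSecondRow] using hx'.1
    refine ⟨⟨x.1, hxk⟩, Finset.mem_filter.2 ⟨Finset.mem_univ _, ?_⟩, rfl⟩
    by_contra hK
    refine hx'.2 (Fin.ext ?_)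
    have := val_colExch_lt hkm hm K ⟨x.1, hxk⟩
    rwa [if_neg hK] at this

/-- An exchange is determined by the set of columns that it exchanges; this turns the sum over
permutations into the $2^k$-term sum of `curlVanish_genPoly`. -/
theorem exchAlt_rowMate {X V : Type*} [AddCommGroup V] (hkm : k ≤ m) (hm : 0 < m)
    (A : (Fin (m + k) → X) → V) (μ : Fin (m + k) → X) :
    exchAlt (rowMate m k hkm) A μ = ∑ K : Fin k → Bool, colSign K • A (μ ∘ colExch hkm hm K) := by
  symm
  unfold exchAlt
  refine Finset.sum_bij' (fun K _ => colExch hkm hm K)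
    (fun τ _ j => decide (τ ⟨j.1, by omega⟩ ≠ ⟨j.1, by omega⟩)) ?_ ?_ ?_ ?_ ?_
  · exact fun K _ => mem_exchPerms.2 (isExch_colExch hkm hm K)
  · exact fun _ _ => Finset.mem_univ _
  · intro K _
    funext j
    have h := val_colExch_lt hkm hm K j
    cases hK : K j with
    | true =>
      rw [hK, if_pos rfl] at h
      refine decide_eq_true fun h' => ?_
      rw [h'] at h
      simp only at h
      omega
    | false =>
      rw [hK, if_neg Bool.false_ne_true] at h
      exact decide_eq_false (not_not.2 (Fin.ext h))
  · intro τ hτ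
    have hτ' := mem_exchPerms.1 hτ
    have hθ := isMate_rowMate hm hkm
    ext x
    congr 1
    rw [colExch_apply]
    have hmem : (∃ j : Fin k, decide (τ ⟨j.1, by omega⟩ ≠ ⟨j.1, by omega⟩) = true ∧
        (x.1 = j.1 ∨ x.1 = j.1 + m)) ↔ τ x ≠ x := by
      constructor
      · rintro ⟨j, hj, hx⟩
        have hj' : τ ⟨j.1, by omega⟩ ≠ ⟨j.1, by omega⟩ := of_decide_eq_true hj
        rcases hx with hx | hx
        · rwa [show x = ⟨j.1, by omega⟩ from Fin.ext hx]
        · have hxm : x = rowMate m k hkm ⟨j.1, by omega⟩ := by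
            apply Fin.ext
            rw [val_rowMate, if_pos j.2, hx]
          rw [hxm, hτ'.apply_mate hθ hj']
          intro h
          rw [← hτ'.apply_of_ne hj'] at h
          exact hj' h.symm
      · intro hx
        by_cases hxk : x.1 < k
        · exact ⟨⟨x.1, hxk⟩, decide_eq_true hx, Or.inl rfl⟩
        · have h1 := hτ'.apply_of_ne hx
          have h2 : (rowMate m k hkm x).1 ≠ x.1 := fun h => hx (h1.trans (Fin.ext h))
          have hxm : m ≤ x.1 := by
            by_contra hc
            rw [val_rowMate, if_neg hxk, if_neg hc] at h2
            exact h2 rfl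
          have h3 : rowMate m k hkm x = ⟨x.1 - m, by omega⟩ := by
            apply Fin.ext
            rw [val_rowMate, if_neg hxk, if_pos hxm]
          refine ⟨⟨x.1 - m, by have := x.2; omega⟩, decide_eq_true ?_, Or.inr ?_⟩
          · simp only
            rw [← h3, hτ'.apply_mate hθ hx]
            exact fun h => h2 (congrArg Fin.val h.symm)
          · simp only
            omega
    by_cases hx : τ x = x
    · rw [if_neg (fun h => hmem.1 h hx), hx]
    · rw [if_pos (hmem.2 hx), hτ'.apply_of_ne hx]
  · intro K _
    rw [sign_colExch]

/-- If the column antisymmetrization of `∂ ^ k T` vanishes, then all `k`-fold curls of `T` do. -/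
theorem curlVanish_of_exchAlt_iterD {r : ℕ} (hm : 0 < r + k) {T : TField D (r + k)} (hT : IsSymm T)
    (h : ∀ μ, exchAlt (rowMate (r + k) k (by omega)) (iterD k T) μ = 0) :
    CurlVanish k (genPoly T) := by
  refine curlVanish_genPoly k hT fun α β ρ => ?_
  -- The derivative slots, which form the second row, carry $\alpha$; the last $k$ slots, in the
  -- same columns, carry $\beta$; the slots between, alone in their columns, carry $\rho$.
  set μ : Fin (r + k + k) → Fin D := fun x =>
    if h1 : x.1 < k then α ⟨x.1, h1⟩ else if h2 : x.1 < r + k then ρ ⟨x.1 - k, by omega⟩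
    else β ⟨x.1 - (r + k), by omega⟩ with hμ
  have hkm : k ≤ r + k := by omega
  have hα : ∀ (j : Fin k) (x : Fin (r + k + k)), x.1 = j.1 → μ x = α j := by
    intro j x hx
    simp only [hμ]
    rw [dif_pos (by omega)]
    congr 1
    exact Fin.ext hx
  have hβ : ∀ (j : Fin k) (x : Fin (r + k + k)), x.1 = j.1 + (r + k) → μ x = β j := by
    intro j x hx
    simp only [hμ]
    rw [dif_neg (by omega), dif_neg (by omega)]
    congr 1
    exact Fin.ext (by simp only; omega)
  have hρ : ∀ (j : Fin r) (x : Fin (r + k + k)), x.1 = k + j.1 → μ x = ρ j := by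
    intro j x hx
    simp only [hμ]
    rw [dif_neg (by omega), dif_pos (by omega)]
    congr 1
    exact Fin.ext (by simp only; omega)
  rw [← h μ, exchAlt_rowMate hkm hm]
  refine Finset.sum_congr rfl fun K _ => ?_
  rw [iterD_apply]
  congr 2
  · funext j
    have h1 := val_colExch_lt hkm hm K j
    rw [colSelect, Function.comp_apply]
    split_ifs at h1 ⊢
    · exact (hβ j _ h1).symm
    · exact (hα j _ h1).symm
  · congr 1
    funext j
    rw [Function.comp_apply]
    refine Fin.addCases (fun i => ?_) (fun i => ?_) j
    · rw [Fin.append_left]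
      refine (hρ i _ ?_).symm
      rw [val_colExch_mid hkm hm K _ (by simp) (by simp; omega)]
      simp
    · rw [Fin.append_right, colSelect]
      have h1 := val_colExch_ge hkm hm K i
      have h2 : (⟨k + (Fin.natAdd r i).1, by simp; omega⟩ : Fin (r + k + k))
          = ⟨i.1 + (r + k), by omega⟩ := Fin.ext (by simp; omega)
      rw [h2]
      split_ifs at h1 ⊢
      · exact (hα i _ h1).symm
      · exact (hβ i _ h1).symm

end ExchangeSum

end NComplex

namespace NComplex

open SmoothFn SymPoly

/-! ### Components of the elements of `Ω_N^p` -/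

/-- The Young symmetrizer without its normalization. -/
def youngSum {X V : Type*} [AddCommGroup V] (N : ℕ) {p : ℕ} (A : (Fin p → X) → V)
    (μ : Fin p → X) : V :=
  ∑ τ ∈ colPerms N p, (Equiv.Perm.sign τ : ℤ) • ∑ σ ∈ rowPerms N p, A ((μ ∘ τ) ∘ σ)

theorem youngSum_smul {X V : Type*} [AddCommGroup V] [Module ℝ V] (N : ℕ) {p : ℕ} (r : ℝ)
    (A : (Fin p → X) → V) : youngSum N (r • A) = r • youngSum N A := by
  funext μ
  simp only [youngSum, Pi.smul_apply, Finset.smul_sum]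
  refine Finset.sum_congr rfl fun τ _ => Finset.sum_congr rfl fun σ _ => smul_comm _ _ _

/-- The product of the hook lengths of `Y^N_p`. -/
noncomputable def hookProd (N p : ℕ) : ℝ := ∏ j : Fin p, (hookLength N j : ℝ)

theorem hookProd_ne_zero (N p : ℕ) : hookProd N p ≠ 0 := by
  refine Finset.prod_ne_zero_iff.2 fun j _ => ?_
  have : 0 < hookLength N j :=
    Nat.add_pos_left (Finset.card_pos.2 ⟨j, Finset.mem_filter.2 ⟨Finset.mem_univ _, rfl, le_rfl⟩⟩) _
  exact_mod_cast this.ne'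

theorem youngSymmetrizer_eq (N D p : ℕ) (A : Tensor D p) :
    youngSymmetrizer N D p A = (hookProd N p)⁻¹ • youngSum N A := by
  funext μ
  rw [Pi.smul_apply, youngSum, smul_eq_mul]
  change (hookProd N p)⁻¹ * _ = _
  simp only [zsmul_eq_mul]

variable {N D p : ℕ}

/-- The components of a tensor field, as smooth functions. -/
noncomputable def comp : Omega N D p →ₗ[ℝ] TField D p where
  toFun T μ := ⟨fun x => T.1 x μ, (mem_smoothSubalgebra D).2 (contDiff_component T.2.1 μ)⟩
  map_add' _ _ := rfl
  map_smul' _ _ := rfl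

theorem comp_injective : Function.Injective (comp : Omega N D p → TField D p) := by
  intro S T h
  apply Subtype.ext
  funext x μ
  exact congrArg (fun W : TField D p => eval x (W μ)) h

theorem eval_youngSum (A : TField D p) (x : Fin D → ℝ) (μ : Fin p → Fin D) :
    eval x (youngSum N A μ) = youngSum N (fun μ => eval x (A μ)) μ := by
  simp only [youngSum, map_sum, map_zsmul]

theorem comp_dOmega (T : Omega N D p) :
    comp (dOmega N D p T) = (hookProd N (p + 1))⁻¹ • youngSum N (dT (comp T)) := by
  funext μ
  refine SmoothFn.ext fun x => ?_
  change youngSymmetrizer N D (p + 1) (partialD T.1 x) μ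
    = (hookProd N (p + 1))⁻¹ • eval x (youngSum N (dT (comp T)) μ)
  rw [youngSymmetrizer_eq, eval_youngSum]
  rfl

theorem exists_comp_eq_youngSum (A : TField D p) : ∃ T : Omega N D p, comp T = youngSum N A := by
  refine ⟨⟨fun x μ => eval x (youngSum N A μ), contDiff_pi.2 fun μ => smooth _, fun x => ?_⟩, rfl⟩
  refine ⟨hookProd N p • fun μ => eval x (A μ), ?_⟩
  rw [youngSymmetrizer_eq, youngSum_smul, smul_smul, inv_mul_cancel₀ (hookProd_ne_zero N p),
    one_smul]
  funext μ
  exact (eval_youngSum A x μ).symm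

/-- An eigenvector with nonzero eigenvalue lies in the image. -/
theorem exists_comp_eq_of_youngSum {A : TField D p} {c : ℝ} (hc : c ≠ 0)
    (h : youngSum N A = c • A) : ∃ T : Omega N D p, comp T = A := by
  obtain ⟨T, hT⟩ := exists_comp_eq_youngSum (N := N) (c⁻¹ • A)
  refine ⟨T, hT.trans ?_⟩
  rw [youngSum_smul, h, smul_smul, inv_mul_cancel₀ hc, one_smul]

theorem exists_eval_comp (T : Omega N D p) (x : Fin D → ℝ) :
    ∃ A : Tensor D p, ∀ μ, eval x (comp T μ) = youngSum N A μ := by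
  obtain ⟨A, hA⟩ := T.2.2 x
  refine ⟨(hookProd N p)⁻¹ • A, fun μ => ?_⟩
  rw [youngSum_smul, ← youngSymmetrizer_eq, hA]
  rfl

/-! ### Diagrams with one or two rows -/

section OneRow

variable {m : ℕ}

theorem youngSum_one_row {X V : Type*} [AddCommGroup V] (hp : p ≤ m) (A : (Fin p → X) → V)
    (μ : Fin p → X) : youngSum (m + 1) A μ = ∑ σ : Equiv.Perm (Fin p), A (μ ∘ σ) := by
  have hlt : ∀ j : Fin p, (j.rev : ℕ) < m := fun j => lt_of_lt_of_le j.rev.2 hp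
  have hcol : colPerms (m + 1) p = {1} := by
    ext τ
    rw [colPerms, Finset.mem_filter, Finset.mem_singleton]
    refine ⟨fun h => ?_, fun h => by simp [h]⟩
    ext j
    have := h.2 j
    rw [colOf, colOf, Nat.add_sub_cancel, Nat.mod_eq_of_lt (hlt _), Nat.mod_eq_of_lt (hlt _)] at this
    rw [Fin.rev_injective (Fin.ext this), Equiv.Perm.one_apply]
  have hrow : rowPerms (m + 1) p = Finset.univ := by
    refine Finset.filter_true_of_mem fun σ _ j => ?_
    rw [rowOf, rowOf, Nat.add_sub_cancel, Nat.div_eq_of_lt (hlt _), Nat.div_eq_of_lt (hlt _)]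
  rw [youngSum, hcol, hrow, Finset.sum_singleton]
  simp

theorem isSymm_youngSum {X V : Type*} [AddCommGroup V] (hp : p ≤ m) (A : (Fin p → X) → V) :
    IsSymm (youngSum (m + 1) A) := by
  intro τ μ
  rw [youngSum_one_row hp, youngSum_one_row hp]
  exact Fintype.sum_equiv (Equiv.mulLeft τ) _ _ fun σ => rfl

theorem isSymm_comp (hp : p ≤ m) (T : Omega (m + 1) D p) : IsSymm (comp T) := by
  intro τ μ
  refine SmoothFn.ext fun x => ?_
  obtain ⟨A, hA⟩ := exists_eval_comp T x
  change eval x (comp T (μ ∘ τ)) = eval x (comp T μ)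
  rw [hA, hA, isSymm_youngSum hp]

/-- Permuting the indices does not change the polynomial, and a one-row symmetrization has $p!$
terms. -/
theorem genPoly_youngSum (hp : p ≤ m) (A : TField D p) :
    genPoly (youngSum (m + 1) A) = (p.factorial : ℝ) • genPoly A := by
  have h : youngSum (m + 1) A = ∑ σ : Equiv.Perm (Fin p), fun μ => A (μ ∘ σ) := by
    funext μ
    rw [youngSum_one_row hp, Finset.sum_apply]
  have hadd : ∀ s : Finset (Equiv.Perm (Fin p)),
      genPoly (∑ σ ∈ s, fun μ => A (μ ∘ σ)) = (s.card : ℝ) • genPoly A := by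
    intro s
    induction s using Finset.cons_induction with
    | empty =>
      rw [Finset.sum_empty, Finset.card_empty, Nat.cast_zero, zero_smul]
      simp [genPoly]
    | cons σ s hs ih =>
      rw [Finset.sum_cons, genPoly_add, ih, genPoly_comp_perm, Finset.card_cons, Nat.cast_succ,
        add_smul, one_smul, add_comm]
  rw [h, hadd, Finset.card_univ, Fintype.card_perm, Fintype.card_fin]

/-- As long as the diagram has one row, the symmetrization in $d$ is visible to `genPoly` only as a
nonzero factor, which leaves the symmetrized gradient. -/
theorem genPoly_comp_dPow {q : ℕ} (j : ℕ) (hj : q + j ≤ m) : ∃ c : ℝ, c ≠ 0 ∧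
    ∀ S : Omega (m + 1) D q, genPoly (comp (dPow (dOmega (m + 1) D) j q S))
      = c • grad^[j] (genPoly (comp S)) := by
  induction j with
  | zero => exact ⟨1, one_ne_zero, fun S => by rw [one_smul]; rfl⟩
  | succ j ih =>
    obtain ⟨c, hc, h⟩ := ih (by omega)
    refine ⟨(hookProd (m + 1) (q + j + 1))⁻¹ * ((q + j + 1).factorial : ℝ) * c, ?_, fun S => ?_⟩
    · exact mul_ne_zero (mul_ne_zero (inv_ne_zero (hookProd_ne_zero _ _))
        (Nat.cast_ne_zero.2 (Nat.factorial_ne_zero _))) hc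
    · change genPoly (comp (dOmega (m + 1) D (q + j) (dPow (dOmega (m + 1) D) j q S))) = _
      rw [comp_dOmega, genPoly_smul, genPoly_youngSum hj, genPoly_dT, h, map_smul,
        Function.iterate_succ_apply', smul_smul, smul_smul]
      rfl

end OneRow

section TwoRows

variable {m : ℕ}

theorem youngSum_two_rows {X V : Type*} [AddCommGroup V] (hm : 0 < m) {i : ℕ} (him : i ≤ m)
    (A : (Fin (m + i) → X) → V) (μ : Fin (m + i) → X) : youngSum (m + 1) A μ
      = exchAlt (rowMate m i him) (fun μ => ∑ σ ∈ linePerms (inSecondRow m i), A (μ ∘ σ)) μ := by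
  rw [youngSum, colPerms_two_rows hm him, rowPerms_two_rows hm him]
  rfl

theorem dT_smul (c : ℝ) (A : TField D p) : dT (c • A) = c • dT A := by
  funext μ
  rw [dT, Pi.smul_apply, map_smul]
  rfl

theorem dT_exchAlt {i : ℕ} (him : i ≤ m) (B : TField D (m + i)) (μ : Fin (m + i + 1) → Fin D) :
    dT (exchAlt (rowMate m i him) B) μ
      = ∑ τ ∈ (exchPerms (rowMate m i him)).image liftPerm,
        (Equiv.Perm.sign τ : ℤ) • dT B (μ ∘ τ) := by
  rw [Finset.sum_image fun _ _ _ _ h => liftPerm_injective h, dT, exchAlt, map_sum]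
  refine Finset.sum_congr rfl fun τ _ => ?_
  rw [map_zsmul, dT_comp_liftPerm, sign_liftPerm]

/-- Up to a nonzero factor, `d ^ i` on the tensor fields of degree `N - 1` is the derivative
`∂ ^ i` followed by the antisymmetrization over the columns. -/
theorem comp_dPow_two_rows (hm : 0 < m) (i : ℕ) (him : i ≤ m) : ∃ c : ℝ, c ≠ 0 ∧
    ∀ T : Omega (m + 1) D m, comp (dPow (dOmega (m + 1) D) i m T)
      = c • exchAlt (rowMate m i him) (iterD i (comp T)) := by
  induction i with
  | zero =>
    refine ⟨1, one_ne_zero, fun T => ?_⟩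
    rw [one_smul]
    have h : exchPerms (rowMate m 0 him) = {1} := by
      ext τ
      rw [mem_exchPerms, Finset.mem_singleton]
      refine ⟨fun h => ?_, fun h => h ▸ IsExch.one⟩
      have h0 : ∀ x, rowMate m 0 him x = x := fun x => Fin.ext (by
        rw [val_rowMate, if_neg (by omega), if_neg (by have := x.2; omega)])
      ext x
      rcases h x with h | h
      · rw [h, Equiv.Perm.one_apply]
      · rw [h, h0, Equiv.Perm.one_apply]
    funext μ
    rw [exchAlt, h, Finset.sum_singleton, Equiv.Perm.sign_one, Units.val_one, one_smul]
    rfl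
  | succ i ih =>
    obtain ⟨c, hc, h⟩ := ih (by omega)
    -- By the induction hypothesis the derivative falls on a tensor antisymmetrized over the old
    -- columns only, that is, over the lifted exchanges. They form the set $P$ here, and the Young
    -- symmetrizer replaces this partial antisymmetrization by the full one.
    obtain ⟨c', hc', h'⟩ := exists_exchAlt_sum_linePerms (X := Fin D) (V := SmoothFn D)
      (isMate_rowMate hm him)
      ((exchPerms (rowMate m i (by omega))).image liftPerm)
      (fun τ hτ => by
        obtain ⟨τ', h1, rfl⟩ := Finset.mem_image.1 hτ
        exact liftPerm_mem_exchPerms him h1)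
      (Finset.mem_image.2 ⟨1, mem_exchPerms.2 IsExch.one, by
        ext x
        refine Fin.cases ?_ (fun y => ?_) x
        · rw [liftPerm_zero]; rfl
        · rw [liftPerm_succ]; rfl⟩)
    refine ⟨(hookProd (m + 1) (m + i + 1))⁻¹ * c * c', mul_ne_zero
      (mul_ne_zero (inv_ne_zero (hookProd_ne_zero _ _)) hc) (Nat.cast_ne_zero.2 hc'.ne'),
      fun T => ?_⟩
    change comp (dOmega (m + 1) D (m + i) (dPow (dOmega (m + 1) D) i m T)) = _
    rw [comp_dOmega, h, dT_smul, youngSum_smul, smul_smul, mul_smul _ (c' : ℝ)]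
    congr 1
    funext μ
    rw [Pi.smul_apply, Nat.cast_smul_eq_nsmul,
      ← h' _ (fun σ hσ μ => iterD_comp_linePerm (isSymm_comp le_rfl T) hσ μ)]
    refine (youngSum_two_rows hm him (dT _) μ).trans ?_
    unfold exchAlt
    refine Finset.sum_congr rfl fun τ _ => ?_
    congr 1
    refine Finset.sum_congr rfl fun σ _ => ?_
    exact dT_exchAlt (by omega) _ _

theorem curlVanish_comp {k : ℕ} (hm : 0 < m) (hkm : k ≤ m) (T : Omega (m + 1) D m)
    (hT : dPow (dOmega (m + 1) D) k m T = 0) : CurlVanish k (genPoly (comp T)) := by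
  obtain ⟨c, hc, h⟩ := comp_dPow_two_rows (D := D) hm k hkm
  have h1 := h T
  rw [hT, map_zero] at h1
  have h2 := (smul_eq_zero.1 h1.symm).resolve_left hc
  have hs : IsSymm (comp T) := isSymm_comp le_rfl T
  generalize comp T = A at h2 hs
  clear h h1 hT T hc c
  obtain ⟨r, rfl⟩ : ∃ r, m = r + k := ⟨m - k, by omega⟩
  exact curlVanish_of_exchAlt_iterD hm hs fun μ => congrFun h2 μ

/-- Exactness in degree `N - 1`. -/
theorem mem_range_dPow_of_dPow_eq_zero (q j : ℕ) (hj : 1 ≤ j) (T : Omega (q + j + 1) D (q + j))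
    (hT : dPow (dOmega (q + j + 1) D) (q + 1) (q + j) T = 0) :
    ∃ S, dPow (dOmega (q + j + 1) D) j q S = T := by
  -- Here $N-1=q+j$: vanishing of $d^{q+1}T$ gives vanishing $(q+1)$-fold curls, the condition for a
  -- polynomial of degree $q+j$ to be a $j$-fold gradient.
  obtain ⟨g, hg, hgT⟩ := exists_grad_iterate q j (genPoly (comp T)) (isHomogeneous_genPoly _)
    (curlVanish_comp (by omega) (by omega) T hT)
  obtain ⟨A, rfl⟩ := exists_genPoly_eq q hg
  obtain ⟨U, hU⟩ := exists_comp_eq_youngSum (N := q + j + 1) A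
  obtain ⟨c, hc, h⟩ := genPoly_comp_dPow (D := D) (m := q + j) j le_rfl (q := q)
  have hc' : (q.factorial : ℝ) ≠ 0 := Nat.cast_ne_zero.2 (Nat.factorial_ne_zero _)
  -- The factor $c$ comes from $d^j$, and $q!$ from the symmetrization of $A$ into $U$.
  refine ⟨(c * q.factorial)⁻¹ • U, comp_injective ?_⟩
  refine genPoly_injective (isSymm_comp le_rfl _) (isSymm_comp le_rfl _) ?_
  rw [h, map_smul, genPoly_smul, hU, genPoly_youngSum (by omega), smul_smul, grad_iterate_smul,
    hgT, smul_smul, mul_inv]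
  rw [show c * (c⁻¹ * (q.factorial : ℝ)⁻¹ * q.factorial) = 1 by field_simp, one_smul]

end TwoRows

end NComplex

namespace NComplex

/-! ### The Young symmetrizer of a diagram with two columns -/

section TwoColumns

open Equiv

variable {ι : Type*} [Fintype ι] [DecidableEq ι] {line : ι → Bool} {θ : ι → ι}
variable {X V : Type*} [AddCommGroup V]

/-- Symmetrization over the exchanges of cells with their mates, followed by the antisymmetrization
over the two lines. -/
def youngLines (line : ι → Bool) (θ : ι → ι) (A : (ι → X) → V) (μ : ι → X) : V :=
  ∑ τ ∈ linePerms line, (Perm.sign τ : ℤ) • ∑ σ ∈ exchPerms θ, A ((μ ∘ τ) ∘ σ)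

/-- Tensors that are antisymmetric along both lines, and satisfy the linear relations
between the two lines of the Young symmetry type. -/
structure IsTwoCol (line : ι → Bool) (Q : (ι → X) → V) : Prop where
  alt : ∀ σ ∈ linePerms line, ∀ μ, Q (μ ∘ σ) = (Perm.sign σ : ℤ) • Q μ
  bianchi : ∀ j, line j = true → ∀ μ, ∑ i with line i = false, Q (μ ∘ swap i j) = Q μ

theorem sign_mul_sign_self (τ : Perm ι) : ((Perm.sign τ : ℤ) * (Perm.sign τ : ℤ)) = 1 := by
  rcases Int.units_eq_one_or (Perm.sign τ) with h | h <;> simp [h]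

theorem swap_mem_linePerms {x y : ι} (h : line x = line y) : swap x y ∈ linePerms line := by
  refine mem_linePerms.2 fun z => ?_
  rw [swap_apply_def]
  split_ifs with h1 h2
  · rw [h1, h]
  · rw [h2, h]
  · rfl

theorem mul_mem_linePerms {σ τ : Perm ι} (hσ : σ ∈ linePerms line) (hτ : τ ∈ linePerms line) :
    σ * τ ∈ linePerms line :=
  mem_linePerms.2 fun x => by rw [Perm.mul_apply, mem_linePerms.1 hσ, mem_linePerms.1 hτ]

theorem inv_mem_linePerms {σ : Perm ι} (hσ : σ ∈ linePerms line) : σ⁻¹ ∈ linePerms line :=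
  mem_linePerms.2 fun x => by rw [← mem_linePerms.1 hσ, perm_apply_inv]

theorem sum_linePerms_comp {ρ : Perm ι} (hρ : ρ ∈ linePerms line) (A : (ι → X) → V) (μ : ι → X) :
    ∑ τ ∈ linePerms line, (Perm.sign τ : ℤ) • A (μ ∘ (τ * ρ : Perm ι))
      = (Perm.sign ρ : ℤ) • ∑ τ ∈ linePerms line, (Perm.sign τ : ℤ) • A (μ ∘ τ) := by
  rw [Finset.smul_sum]
  refine Finset.sum_bij' (fun τ _ => τ * ρ) (fun τ _ => τ * ρ⁻¹) ?_ ?_ ?_ ?_ ?_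
  · exact fun τ hτ => mul_mem_linePerms hτ hρ
  · exact fun τ hτ => mul_mem_linePerms hτ (inv_mem_linePerms hρ)
  · intro τ _; simp
  · intro τ _; simp
  · intro τ _
    rw [smul_smul, Perm.sign_mul, Units.val_mul, mul_comm, mul_assoc, sign_mul_sign_self, mul_one]

theorem alt_youngLines (A : (ι → X) → V) {σ : Perm ι} (hσ : σ ∈ linePerms line) (μ : ι → X) :
    youngLines line θ A (μ ∘ σ) = (Perm.sign σ : ℤ) • youngLines line θ A μ := by
  unfold youngLines
  rw [Finset.smul_sum]
  refine Finset.sum_bij' (fun τ _ => σ * τ) (fun τ _ => σ⁻¹ * τ) ?_ ?_ ?_ ?_ ?_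
  · exact fun τ hτ => mul_mem_linePerms hσ hτ
  · exact fun τ hτ => mul_mem_linePerms (inv_mem_linePerms hσ) hτ
  · intro τ _; simp
  · intro τ _; simp
  · intro τ _
    rw [smul_smul, Perm.sign_mul, Units.val_mul, ← mul_assoc, sign_mul_sign_self, one_mul]
    rfl

/-- Permutations that move only cells of the first line and the cell `j`. -/
def garnirPerms (line : ι → Bool) (j : ι) : Finset (Perm ι) :=
  Finset.univ.filter fun h => ∀ x, h x ≠ x → line x = false ∨ x = j

theorem mem_garnirPerms {j : ι} {h : Perm ι} :
    h ∈ garnirPerms line j ↔ ∀ x, h x ≠ x → line x = false ∨ x = j := by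
  simp [garnirPerms]

theorem mul_swap_mem_garnirPerms {j y : ι} (hy : line y = false) {h : Perm ι}
    (hh : h ∈ garnirPerms line j) : h * swap j y ∈ garnirPerms line j := by
  refine mem_garnirPerms.2 fun x hx => ?_
  by_cases hj : x = j
  · exact Or.inr hj
  · by_cases hxy : x = y
    · exact Or.inl (hxy ▸ hy)
    · rw [Perm.mul_apply, swap_apply_of_ne_of_ne hj hxy] at hx
      exact mem_garnirPerms.1 hh x hx

/-- The Garnir relation. For fixed $\tau$ the cell $\tau\theta\tau^{-1}j$ is in the first line, so
multiplying $h$ by its transposition with $j$ stays in `garnirPerms`. The sign changes, while the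
symmetrization over exchanges absorbs the transposition, and the terms cancel in pairs. -/
theorem sum_garnirPerms_youngLines (hθ : IsMate line θ) (A : (ι → X) → V) {j : ι}
    (hj : line j = true) (μ : ι → X) :
    ∑ h ∈ garnirPerms line j, (Perm.sign h : ℤ) • youngLines line θ A (μ ∘ h) = 0 := by
  unfold youngLines
  simp only [Finset.smul_sum (s := linePerms line)]
  rw [Finset.sum_comm]
  refine Finset.sum_eq_zero fun τ hτ => ?_
  have hj' : line (τ⁻¹ j) = true := by rw [mem_linePerms.1 (inv_mem_linePerms hτ), hj]
  have hmate := hθ.mated _ hj'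
  have hy : line (τ (θ (τ⁻¹ j))) = false := by
    rw [mem_linePerms.1 hτ, hθ.flip _ hmate, hj', Bool.not_true]
  have hne : j ≠ τ (θ (τ⁻¹ j)) := fun h => by rw [← h, hj] at hy; exact Bool.noConfusion hy
  have hexch : ∀ ν : ι → X, ∑ σ ∈ exchPerms θ, A ((ν ∘ swap (τ⁻¹ j) (θ (τ⁻¹ j))) ∘ σ)
      = ∑ σ ∈ exchPerms θ, A (ν ∘ σ) := by
    intro ν
    have hs := IsExch.swap hθ (τ⁻¹ j)
    refine Finset.sum_bij' (fun σ _ => swap (τ⁻¹ j) (θ (τ⁻¹ j)) * σ)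
      (fun σ _ => swap (τ⁻¹ j) (θ (τ⁻¹ j)) * σ) ?_ ?_ ?_ ?_ ?_
    · exact fun σ hσ => mem_exchPerms.2 (hs.mul hθ (mem_exchPerms.1 hσ))
    · exact fun σ hσ => mem_exchPerms.2 (hs.mul hθ (mem_exchPerms.1 hσ))
    · exact fun σ _ => swap_mul_self_mul _ _ _
    · exact fun σ _ => swap_mul_self_mul _ _ _
    · exact fun σ _ => rfl
  refine Finset.sum_involution (fun h _ => h * swap j (τ (θ (τ⁻¹ j)))) ?_ ?_ ?_ ?_
  · intro h _
    have h1 : ((μ ∘ (h * swap j (τ (θ (τ⁻¹ j))) : Perm ι)) ∘ τ)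
        = (((μ ∘ h) ∘ τ) ∘ swap (τ⁻¹ j) (θ (τ⁻¹ j))) := by
      have h2 : swap j (τ (θ (τ⁻¹ j))) * τ = τ * swap (τ⁻¹ j) (θ (τ⁻¹ j)) := by
        rw [mul_swap_eq_swap_mul, perm_apply_inv]
      funext x
      exact congrArg (fun π : Perm ι => μ (h (π x))) h2
    rw [h1, hexch, Perm.sign_mul, Perm.sign_swap hne, mul_neg_one, Units.val_neg, neg_smul,
      add_neg_cancel]
  · intro h _ _ h'
    have h2 : swap j (τ (θ (τ⁻¹ j))) = 1 := mul_eq_left.1 h'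
    exact hne (swap_eq_one_iff.1 h2)
  · exact fun h hh => mul_swap_mem_garnirPerms hy hh
  · exact fun h _ => mul_swap_mul_self _ _ _

/-- Sort the permutations by the value $i=hj$. By alternation along the lines every $h$ in a fibre
contributes like the transposition of $i$ and $j$, with its sign, and all fibres have the same size.
-/
theorem sum_garnirPerms_of_alt {G : (ι → X) → V}
    (hG : ∀ σ ∈ linePerms line, ∀ μ, G (μ ∘ σ) = (Perm.sign σ : ℤ) • G μ) {j : ι}
    (hj : line j = true) : ∃ c : ℕ, 0 < c ∧ ∀ μ,
    ∑ h ∈ garnirPerms line j, (Perm.sign h : ℤ) • G (μ ∘ h)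
      = c • (G μ - ∑ i with line i = false, G (μ ∘ swap i j)) := by
  set H := garnirPerms line j
  have hcard : ∀ i, line i = false →
      (H.filter fun h => h j = i).card = (H.filter fun h => h j = j).card := by
    intro i hi
    have hmem : ∀ h ∈ H, swap i j * h ∈ H := by
      intro h hh
      refine mem_garnirPerms.2 fun x hx => ?_
      by_cases hx' : h x = x
      · rw [Perm.mul_apply, hx'] at hx
        by_cases h1 : x = i
        · exact Or.inl (h1 ▸ hi)
        · by_cases h2 : x = j
          · exact Or.inr h2
          · exact absurd (swap_apply_of_ne_of_ne h1 h2) hx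
      · exact mem_garnirPerms.1 hh x hx'
    refine Finset.card_bij' (fun h _ => swap i j * h) (fun h _ => swap i j * h) ?_ ?_ ?_ ?_
    · intro h hh
      rw [Finset.mem_filter] at hh ⊢
      exact ⟨hmem h hh.1, by rw [Perm.mul_apply, hh.2, swap_apply_left]⟩
    · intro h hh
      rw [Finset.mem_filter] at hh ⊢
      exact ⟨hmem h hh.1, by rw [Perm.mul_apply, hh.2, swap_apply_right]⟩
    · exact fun h _ => swap_mul_self_mul _ _ _
    · exact fun h _ => swap_mul_self_mul _ _ _
  have hline : ∀ h ∈ H, ∀ i, (line i = false ∨ i = j) → h j = i → swap i j * h ∈ linePerms line := by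
    intro h hh i hi hhj
    have hhx : ∀ x, h x ≠ x → line (h x) = false ∨ h x = j := by
      intro x hx
      exact mem_garnirPerms.1 hh (h x) fun h' => hx (h.injective h')
    refine mem_linePerms.2 fun x => ?_
    rw [Perm.mul_apply]
    by_cases hxj : x = j
    · rw [hxj, hhj, swap_apply_left]
    · have hne : h x ≠ i := fun h' => hxj (h.injective (h'.trans hhj.symm))
      by_cases hx : h x = x
      · rw [hx, swap_apply_of_ne_of_ne (by rwa [hx] at hne) hxj]
      · have hlx : line x = false := (mem_garnirPerms.1 hh x hx).resolve_right hxj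
        rw [hlx]
        by_cases hxj' : h x = j
        · rw [hxj', swap_apply_right]
          refine hi.resolve_right fun h' => ?_
          rw [h'] at hne
          exact hne hxj'
        · rw [swap_apply_of_ne_of_ne hne hxj']
          exact (hhx x hx).resolve_right hxj'
  have hval : ∀ h ∈ H, ∀ i, (line i = false ∨ i = j) → h j = i → ∀ μ,
      (Perm.sign h : ℤ) • G (μ ∘ h) = (Perm.sign (swap i j) : ℤ) • G (μ ∘ swap i j) := by
    intro h hh i hi hhj μ
    have h1 := hG _ (hline h hh i hi hhj) (μ ∘ swap i j)
    have h2 : (μ ∘ swap i j) ∘ (swap i j * h : Perm ι) = μ ∘ h := by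
      funext x
      simp
    rw [h2] at h1
    rw [h1, smul_smul, Perm.sign_mul, Units.val_mul, mul_left_comm, sign_mul_sign_self, mul_one]
  refine ⟨(H.filter fun h => h j = j).card, Finset.card_pos.2 ⟨1, Finset.mem_filter.2
    ⟨mem_garnirPerms.2 fun x hx => absurd rfl hx, rfl⟩⟩, fun μ => ?_⟩
  have hmaps : ∀ h ∈ H, h j ∈ insert j (Finset.univ.filter fun i => line i = false) := by
    intro h hh
    rw [Finset.mem_insert, Finset.mem_filter]
    by_cases hx : h j = j
    · exact Or.inl hx
    · have := mem_garnirPerms.1 hh (h j) fun h' => hx (h.injective h')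
      rcases this with h' | h'
      · exact Or.inr ⟨Finset.mem_univ _, h'⟩
      · exact Or.inl h'
  rw [← Finset.sum_fiberwise_of_maps_to hmaps, Finset.sum_insert (by simp [hj]), smul_sub,
    Finset.smul_sum, sub_eq_add_neg, ← Finset.sum_neg_distrib]
  congr 1
  · rw [Finset.sum_congr rfl fun h hh => hval h (Finset.mem_filter.1 hh).1 j (Or.inr rfl)
      (Finset.mem_filter.1 hh).2 μ, Finset.sum_const, swap_self]
    simp
  · refine Finset.sum_congr rfl fun i hi => ?_
    have hi' := (Finset.mem_filter.1 hi).2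
    have hij : i ≠ j := fun h => by rw [h, hj] at hi'; exact Bool.noConfusion hi'
    rw [Finset.sum_congr rfl fun h hh => hval h (Finset.mem_filter.1 hh).1 i (Or.inl hi')
      (Finset.mem_filter.1 hh).2 μ, Finset.sum_const, hcard i hi', Perm.sign_swap hij]
    simp

/-- For tensors alternating along the lines the Bianchi relation is the Garnir relation divided by
the common fibre size. -/
theorem isTwoCol_youngLines [Module ℝ V] (hθ : IsMate line θ) (A : (ι → X) → V) :
    IsTwoCol line (youngLines line θ A) where
  alt _ hσ μ := alt_youngLines A hσ μ
  bianchi j hj μ := by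
    obtain ⟨c, hc, h⟩ := sum_garnirPerms_of_alt (fun σ hσ μ => alt_youngLines (θ := θ) A hσ μ) hj
    have h1 := h μ
    rw [sum_garnirPerms_youngLines hθ A hj, ← Nat.cast_smul_eq_nsmul ℝ] at h1
    exact (sub_eq_zero.1 ((smul_eq_zero.1 h1.symm).resolve_left (Nat.cast_ne_zero.2 hc.ne'))).symm

end TwoColumns

end NComplex

namespace NComplex

/-! ### The symmetrizer on tensors that have the two-column symmetries. -/

section TwoColumns

open Equiv

variable {ι : Type*} [Fintype ι] [DecidableEq ι] {line : ι → Bool} {θ : ι → ι}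
variable {X V : Type*} [AddCommGroup V]

/-- The permutations that move only elements of `C`. -/
def permsOn (C : Finset ι) : Finset (Perm ι) := Finset.univ.filter fun ρ => ∀ x, ρ x ≠ x → x ∈ C

theorem mem_permsOn {C : Finset ι} {ρ : Perm ι} : ρ ∈ permsOn C ↔ ∀ x, ρ x ≠ x → x ∈ C := by
  simp [permsOn]

theorem one_mem_permsOn (C : Finset ι) : (1 : Perm ι) ∈ permsOn C :=
  mem_permsOn.2 fun _ h => absurd rfl h

theorem swap_mem_permsOn {C : Finset ι} {x y : ι} (hx : x ∈ C) (hy : y ∈ C) :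
    swap x y ∈ permsOn C := by
  refine mem_permsOn.2 fun z hz => ?_
  by_contra hC
  exact hz (swap_apply_of_ne_of_ne (fun h => hC (h ▸ hx)) (fun h => hC (h ▸ hy)))

theorem mul_mem_permsOn {C : Finset ι} {σ τ : Perm ι} (hσ : σ ∈ permsOn C) (hτ : τ ∈ permsOn C) :
    σ * τ ∈ permsOn C := by
  refine mem_permsOn.2 fun x hx => ?_
  by_cases h : τ x = x
  · rw [Perm.mul_apply, h] at hx
    exact mem_permsOn.1 hσ x hx
  · exact mem_permsOn.1 hτ x h

theorem permsOn_subset_linePerms {C : Finset ι} (hC : ∀ x ∈ C, line x = false) :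
    permsOn C ⊆ linePerms line := by
  intro ρ hρ
  refine mem_linePerms.2 fun x => ?_
  by_cases h : ρ x = x
  · rw [h]
  · rw [hC x (mem_permsOn.1 hρ x h),
      hC (ρ x) (mem_permsOn.1 hρ _ fun h' => h (ρ.injective h'))]

/-- Antisymmetrization over the permutations of the cells in `C`. -/
def altOn (C : Finset ι) (A : (ι → X) → V) (μ : ι → X) : V :=
  ∑ ρ ∈ permsOn C, (Perm.sign ρ : ℤ) • A (μ ∘ ρ)

theorem altOn_comp_swap {C : Finset ι} {x y : ι} (hx : x ∈ C) (hy : y ∈ C) (hxy : x ≠ y)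
    (A : (ι → X) → V) (μ : ι → X) : altOn C (fun μ => A (μ ∘ swap x y)) μ = -altOn C A μ := by
  unfold altOn
  rw [← Finset.sum_neg_distrib]
  refine Finset.sum_bij' (fun ρ _ => ρ * swap x y) (fun ρ _ => ρ * swap x y) ?_ ?_ ?_ ?_ ?_
  · exact fun ρ hρ => mul_mem_permsOn hρ (swap_mem_permsOn hx hy)
  · exact fun ρ hρ => mul_mem_permsOn hρ (swap_mem_permsOn hx hy)
  · exact fun ρ _ => mul_swap_mul_self _ _ _
  · exact fun ρ _ => mul_swap_mul_self _ _ _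
  · intro ρ _
    rw [Perm.sign_mul, Perm.sign_swap hxy, mul_neg_one, Units.val_neg, neg_smul, neg_neg]
    rfl

/-- The hypotheses under which the antisymmetrization over `C` of an exchange of `Q` is a
multiple of `Q`. -/
structure IsTwoColOn (line : ι → Bool) (C : Finset ι) (Q : (ι → X) → V) : Prop where
  alt_first : ∀ ρ ∈ permsOn C, ∀ μ, Q (μ ∘ ρ) = (Perm.sign ρ : ℤ) • Q μ
  alt_second : ∀ x y, line x = true → line y = true → x ≠ y → ∀ μ, Q (μ ∘ swap x y) = -Q μ
  bianchi : ∀ j, line j = true → ∀ μ, ∑ i ∈ C, Q (μ ∘ swap i j) = Q μ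

theorem IsTwoCol.isTwoColOn {Q : (ι → X) → V} (hQ : IsTwoCol line Q) :
    IsTwoColOn line (Finset.univ.filter fun x => line x = false) Q where
  alt_first ρ hρ := hQ.alt ρ (permsOn_subset_linePerms (fun x hx => (Finset.mem_filter.1 hx).2) hρ)
  alt_second x y hx hy hxy μ := by
    rw [hQ.alt _ (swap_mem_linePerms (hx.trans hy.symm)), Perm.sign_swap hxy]
    simp
  bianchi := hQ.bianchi

section Exchange

variable {C : Finset ι} {Q : (ι → X) → V}

theorem IsTwoColOn.comp_swap (hQ : IsTwoColOn line C Q) {x y : ι} (hx : x ∈ C) (hy : y ∈ C)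
    (hxy : x ≠ y) (μ : ι → X) : Q (μ ∘ swap x y) = -Q μ := by
  rw [hQ.alt_first _ (swap_mem_permsOn hx hy), Perm.sign_swap hxy]
  simp

/-- One transposition of cells of $C$ gives a sign through the antisymmetrization, the other through
$Q$, and the two signs cancel. -/
theorem altOn_conj_swap (hQ : IsTwoColOn line C Q) {i k : ι} (hi : i ∈ C) (hk : k ∈ C)
    (hik : i ≠ k) (π : Perm ι) (μ : ι → X) :
    altOn C (fun μ => Q (μ ∘ (swap i k * π * swap i k : Perm ι))) μ
      = altOn C (fun μ => Q (μ ∘ π)) μ := by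
  have h1 : ∀ μ : ι → X, Q (μ ∘ (swap i k * π * swap i k : Perm ι))
      = -Q ((μ ∘ swap i k) ∘ π) := fun μ => by
    rw [← hQ.comp_swap hi hk hik]
    rfl
  have h2 := altOn_comp_swap hi hk hik (fun μ => Q (μ ∘ π)) μ
  rw [← neg_eq_iff_eq_neg] at h2
  rw [← h2, funext h1]
  simp only [altOn, smul_neg, Finset.sum_neg_distrib]

/-- Conjugation by the transposition of $i$ and $k$ replaces $i$ by $k$. In the application $k$ is
the mate of $j$, so the term becomes an exchange with one more pair. -/
theorem altOn_comp_unmoved (hQ : IsTwoColOn line C Q) {σ : Perm ι} {i j k : ι} (hi : i ∈ C)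
    (hk : k ∈ C) (hij : i ≠ j) (hjk : j ≠ k) (hσi : σ i = i) (hσj : σ j = j) (hσk : σ k = k)
    (μ : ι → X) : altOn C (fun μ => Q ((μ ∘ σ) ∘ swap i j)) μ
      = altOn C (fun μ => Q (μ ∘ (swap j k * σ : Perm ι))) μ := by
  by_cases hik : i = k
  · subst hik
    have h : swap j i * σ = σ * swap i j := by rw [mul_swap_eq_swap_mul, hσi, hσj, swap_comm]
    rw [h]
    rfl
  · have h : σ * swap i j = swap i k * (swap j k * σ) * swap i k := by
      rw [mul_assoc, mul_assoc, mul_swap_eq_swap_mul, mul_swap_eq_swap_mul, hσi, hσj, hσk,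
        ← swap_mul_swap_mul_swap hjk hij.symm, swap_comm i k, mul_assoc, mul_assoc]
    rw [← altOn_conj_swap hQ hi hk hik, ← h]
    rfl

/-- Besides the conjugation, a transposition of $l$ and $j$ inside the second line is needed; it
gives the sign. The result undoes the exchange of $i$ with $l$ and exchanges $j$ with $k$ instead.
-/
theorem altOn_comp_moved (hQ : IsTwoColOn line C Q) {σ : Perm ι} {i j k l : ι} (hi : i ∈ C)
    (hk : k ∈ C) (hj : line j = true) (hl : line l = true) (hij : i ≠ j) (hjk : j ≠ k)
    (hik : i ≠ k) (hil : i ≠ l) (hjl : j ≠ l) (hkl : k ≠ l)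
    (hσi : σ i = l) (hσl : σ l = i) (hσj : σ j = j) (hσk : σ k = k) (μ : ι → X) :
    altOn C (fun μ => Q ((μ ∘ σ) ∘ swap i j)) μ
      = -altOn C (fun μ => Q (μ ∘ (swap l i * (swap j k * σ) : Perm ι))) μ := by
  have h4 : swap l j = swap i k * (swap l i * (swap j k * (swap l k * swap i j))) := by
    ext x
    simp only [Perm.mul_apply, swap_apply_def]
    grind
  have h : σ * swap i j
      = swap i k * (swap l i * (swap j k * σ)) * swap i k * swap l j := by
    have h1 : σ * swap i j = swap l j * σ := by rw [mul_swap_eq_swap_mul, hσi, hσj]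
    have h2 : σ * swap i k = swap l k * σ := by rw [mul_swap_eq_swap_mul, hσi, hσk]
    have h3 : σ * swap l j = swap i j * σ := by rw [mul_swap_eq_swap_mul, hσl, hσj]
    have h5 : σ * (swap i k * swap l j) = swap l k * (swap i j * σ) := by
      rw [← mul_assoc, h2, mul_assoc, h3]
    rw [h1]
    simp only [mul_assoc]
    rw [h5, h4]
    simp only [mul_assoc]
  rw [← altOn_conj_swap hQ hi hk hik]
  unfold altOn
  rw [← Finset.sum_neg_distrib]
  refine Finset.sum_congr rfl fun ρ _ => ?_
  rw [← smul_neg, ← hQ.alt_second l j hl hj hjl.symm]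
  congr 1
  refine congrArg Q (funext fun x => ?_)
  exact congrArg (fun π : Perm ι => μ (ρ (π x))) h

theorem card_filter_moved (hθ : IsMate line θ) (hC : ∀ x ∈ C, line x = false)
    (hCθ : ∀ j, line j = true → θ j ∈ C) {σ : Perm ι} (hσ : IsExch θ σ) :
    (C.filter fun x => σ x ≠ x).card = (movedCells line σ).card := by
  refine Finset.card_bij' (fun x _ => θ x) (fun x _ => θ x) ?_ ?_ ?_ ?_
  · intro x hx
    rw [Finset.mem_filter] at hx
    have hne : θ x ≠ x := by rw [← hσ.apply_of_ne hx.2]; exact hx.2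
    refine mem_movedCells.2 ⟨by rw [hθ.flip x hne, hC x hx.1]; rfl, ?_⟩
    rw [hσ.apply_mate hθ hx.2]
    exact hne.symm
  · intro x hx
    rw [mem_movedCells] at hx
    refine Finset.mem_filter.2 ⟨hCθ x hx.1, ?_⟩
    rw [hσ.apply_mate hθ hx.2]
    exact (hθ.mated x hx.1).symm
  · exact fun x _ => hθ.invol x
  · exact fun x _ => hθ.invol x

/-- The multiple of `Q` obtained by exchanging `r` cells with their mates and antisymmetrizing. -/
noncomputable def exchCoeff (C : Finset ι) (r : ℕ) : ℝ :=
  (permsOn C).card * ((r.factorial * (C.card - r).factorial) / C.card.factorial)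

theorem exchCoeff_pos (C : Finset ι) (r : ℕ) : 0 < exchCoeff C r := by
  have h : 0 < (permsOn C).card := Finset.card_pos.2 ⟨1, one_mem_permsOn C⟩
  unfold exchCoeff
  positivity

/-- For $r\le|C|$ the coefficient is the number of permutations of $C$ divided by $\binom{|C|}{r}$.
This recursion is the one that the Bianchi relation produces in `altOn_comp_exch`. -/
theorem sub_mul_exchCoeff {C : Finset ι} {r : ℕ} (hr : r < C.card) :
    ((C.card - r : ℕ) : ℝ) * exchCoeff C (r + 1) = (r + 1) * exchCoeff C r := by
  obtain ⟨m, hm⟩ : ∃ m, C.card = r + m + 1 := ⟨C.card - r - 1, by omega⟩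
  unfold exchCoeff
  rw [show C.card - r = m + 1 by omega, show C.card - (r + 1) = m by omega, Nat.factorial_succ m,
    Nat.factorial_succ r]
  push_cast
  ring

/-- Write $c_r$ for the coefficient. Undo one exchange, that of $j$, and apply the Bianchi relation
at $j$ to the remaining one, with $r$ pairs. The left side is $c_rQ$; on the right the $r$ moved
cells of $C$ contribute $-c_rQ$ each, and the $|C|-r$ unmoved ones contribute the wanted term each.
-/
theorem altOn_comp_exch [Module ℝ V] (hθ : IsMate line θ) (hC : ∀ x ∈ C, line x = false)
    (hCθ : ∀ j, line j = true → θ j ∈ C) (hQ : IsTwoColOn line C Q) (r : ℕ) :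
    ∀ σ : Perm ι, IsExch θ σ → (movedCells line σ).card = r → ∀ μ : ι → X,
      altOn C (fun μ => Q (μ ∘ σ)) μ = exchCoeff C r • Q μ := by
  induction r with
  | zero =>
    intro σ hσ hr μ
    rw [hσ.eq_one_of_movedCells hθ (Finset.card_eq_zero.1 hr)]
    have h : altOn C (fun μ => Q (μ ∘ (1 : Perm ι))) μ = ∑ _ρ ∈ permsOn C, Q μ := by
      refine Finset.sum_congr rfl fun ρ hρ => ?_
      change (Perm.sign ρ : ℤ) • Q (μ ∘ ρ) = Q μ
      rw [hQ.alt_first ρ hρ, smul_smul, sign_mul_sign_self, one_smul]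
    have h0 : exchCoeff C 0 = (permsOn C).card := by
      unfold exchCoeff
      rw [Nat.factorial_zero, Nat.sub_zero, Nat.cast_one, one_mul, div_self, mul_one]
      exact Nat.cast_ne_zero.2 (Nat.factorial_ne_zero _)
    rw [h, Finset.sum_const, h0, Nat.cast_smul_eq_nsmul]
  | succ r ih =>
    intro σ hσ hr μ
    obtain ⟨j, hj⟩ := Finset.card_pos.1 (by omega : 0 < (movedCells line σ).card)
    have hj' := mem_movedCells.1 hj
    have hswap : ∀ x ∈ movedCells line σ, IsExch θ (swap x (θ x) * σ) ∧
        (movedCells line (swap x (θ x) * σ)).card = r := fun x hx =>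
      ⟨(IsExch.swap hθ x).mul hθ hσ, by
        rw [hσ.movedCells_swap_mul hθ hx, Finset.card_erase_of_mem hx, hr, Nat.add_sub_cancel]⟩
    set σ' := swap j (θ j) * σ with hσ'
    obtain ⟨he', hr'⟩ : IsExch θ σ' ∧ (movedCells line σ').card = r := hswap j hj
    have hσσ' : σ = swap j (θ j) * σ' := (swap_mul_self_mul _ _ _).symm
    have hjθ : θ j ≠ j := hθ.mated j hj'.1
    have hσ'_apply := hσ.swap_mul_apply hθ hj'.2
    have hσ'j : σ' j = j := by rw [hσ', hσ'_apply, if_pos (Or.inl rfl)]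
    have hσ'θ : σ' (θ j) = θ j := by rw [hσ', hσ'_apply, if_pos (Or.inr rfl)]
    have hkC := hCθ j hj'.1
    have hne : ∀ i ∈ C, i ≠ j := fun i hi h => by
      have := hC i hi
      rw [h, hj'.1] at this
      exact Bool.noConfusion this
    have hun : ∀ i ∈ C.filter fun x => ¬ σ' x ≠ x,
        altOn C (fun μ => Q ((μ ∘ σ') ∘ swap i j)) μ = altOn C (fun μ => Q (μ ∘ σ)) μ := by
      intro i hi
      rw [Finset.mem_filter, not_not] at hi
      rw [altOn_comp_unmoved hQ hi.1 hkC (hne i hi.1) hjθ.symm hi.2 hσ'j hσ'θ, ← hσσ']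
    have hmv : ∀ i ∈ C.filter fun x => σ' x ≠ x,
        altOn C (fun μ => Q ((μ ∘ σ') ∘ swap i j)) μ = -(exchCoeff C r • Q μ) := by
      intro i hi
      rw [Finset.mem_filter] at hi
      have h1 : σ' i = θ i := he'.apply_of_ne hi.2
      have hiθ : θ i ≠ i := by rw [← h1]; exact hi.2
      have hl : line (θ i) = true := by rw [hθ.flip i hiθ, hC i hi.1]; rfl
      have h2 : σ' (θ i) = i := he'.apply_mate hθ hi.2
      have hik : i ≠ θ j := fun h => hi.2 (by rw [h, hσ'θ])
      have hjl : j ≠ θ i := fun h => hik (by rw [h, hθ.invol])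
      have hkl : θ j ≠ θ i := fun h => hne i hi.1 (by rw [← hθ.invol i, ← h, hθ.invol])
      have hmem : θ i ∈ movedCells line σ := by
        refine mem_movedCells.2 ⟨hl, ?_⟩
        have : σ' (θ i) = σ (θ i) := by
          rw [hσ', hσ'_apply, if_neg]
          exact not_or.2 ⟨hjl.symm, hkl.symm⟩
        rw [← this, h2]
        exact hiθ.symm
      obtain ⟨he'', hr''⟩ := hswap _ hmem
      rw [hθ.invol] at he'' hr''
      rw [altOn_comp_moved hQ hi.1 hkC hj'.1 hl (hne i hi.1) hjθ.symm hik hiθ.symm hjl hkl h1 h2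
        hσ'j hσ'θ, ← hσσ', ih _ he'' hr'']
    have hcardm := card_filter_moved hθ hC hCθ he'
    rw [hr'] at hcardm
    have hcard := Finset.card_filter_add_card_filter_not (s := C) (fun x => σ' x ≠ x)
    have hlt : r < C.card := by
      have : 0 < (C.filter fun x => ¬ σ' x ≠ x).card :=
        Finset.card_pos.2 ⟨θ j, Finset.mem_filter.2 ⟨hkC, not_not.2 hσ'θ⟩⟩
      omega
    have hbi : altOn C (fun μ => Q (μ ∘ σ')) μ
        = ∑ i ∈ C, altOn C (fun μ => Q ((μ ∘ σ') ∘ swap i j)) μ := by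
      unfold altOn
      rw [Finset.sum_comm]
      refine Finset.sum_congr rfl fun ρ _ => ?_
      rw [← Finset.smul_sum, hQ.bianchi j hj'.1]
    rw [ih σ' he' hr', ← Finset.sum_filter_add_sum_filter_not C (fun x => σ' x ≠ x),
      Finset.sum_congr rfl hmv, Finset.sum_congr rfl hun, Finset.sum_const, Finset.sum_const,
      hcardm, show (C.filter fun x => ¬ σ' x ≠ x).card = C.card - r by omega,
      ← Nat.cast_smul_eq_nsmul ℝ, ← Nat.cast_smul_eq_nsmul ℝ] at hbi
    have h0 : ((C.card - r : ℕ) : ℝ) ≠ 0 := Nat.cast_ne_zero.2 (by omega)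
    have h1 : ((C.card - r : ℕ) : ℝ) • altOn C (fun μ => Q (μ ∘ σ)) μ
        = ((C.card - r : ℕ) : ℝ) • exchCoeff C (r + 1) • Q μ := by
      rw [smul_smul, sub_mul_exchCoeff hlt, add_mul, one_mul, add_smul, mul_smul]
      nth_rewrite 2 [hbi]
      rw [smul_neg]
      abel
    exact smul_right_injective V h0 h1

end Exchange

/-- The Young symmetrizer of a tensor with suitable symmetries is a multiple of its
antisymmetrization over the two lines. -/
theorem exists_youngLines_eq_altLines [Module ℝ V] (hθ : IsMate line θ) {C : Finset ι}
    (hC : ∀ x ∈ C, line x = false) (hCθ : ∀ j, line j = true → θ j ∈ C) :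
    ∃ c : ℝ, 0 < c ∧ ∀ A : (ι → X) → V, IsTwoColOn line C A → ∀ μ,
      youngLines line θ A μ = c • ∑ τ ∈ linePerms line, (Perm.sign τ : ℤ) • A (μ ∘ τ) := by
  have hG : 0 < ((permsOn C).card : ℝ) :=
    Nat.cast_pos.2 (Finset.card_pos.2 ⟨1, one_mem_permsOn C⟩)
  refine ⟨((permsOn C).card : ℝ)⁻¹ * ∑ σ ∈ exchPerms θ, exchCoeff C (movedCells line σ).card,
    mul_pos (inv_pos.2 hG) (Finset.sum_pos (fun σ _ => exchCoeff_pos _ _)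
      ⟨1, mem_exchPerms.2 IsExch.one⟩), fun A hA μ => ?_⟩
  have h1 : ∀ σ ∈ exchPerms θ, ((permsOn C).card : ℝ) • ∑ τ ∈ linePerms line,
      (Perm.sign τ : ℤ) • A ((μ ∘ τ) ∘ σ) = exchCoeff C (movedCells line σ).card •
        ∑ τ ∈ linePerms line, (Perm.sign τ : ℤ) • A (μ ∘ τ) := by
    intro σ hσ
    -- Permutations of $C$ preserve the lines, so averaging over them changes nothing in the line
    -- antisymmetrization; the inner sum over $\rho$ is then evaluated by `altOn_comp_exch`.
    have h2 : ∀ ρ ∈ permsOn C, ∑ τ ∈ linePerms line, (Perm.sign τ : ℤ) • A ((μ ∘ τ) ∘ σ)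
        = (Perm.sign ρ : ℤ) • ∑ τ ∈ linePerms line,
          (Perm.sign τ : ℤ) • A ((μ ∘ (τ * ρ : Perm ι)) ∘ σ) := by
      intro ρ hρ
      rw [sum_linePerms_comp (permsOn_subset_linePerms hC hρ) (fun μ => A (μ ∘ σ)) μ, smul_smul,
        sign_mul_sign_self, one_smul]
    rw [Nat.cast_smul_eq_nsmul, ← Finset.sum_const, Finset.sum_congr rfl h2]
    simp only [Finset.smul_sum]
    rw [Finset.sum_comm]
    refine Finset.sum_congr rfl fun τ _ => ?_
    rw [smul_comm, ← altOn_comp_exch hθ hC hCθ hA _ σ (mem_exchPerms.1 hσ) rfl (μ ∘ τ), altOn,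
      Finset.smul_sum]
    exact Finset.sum_congr rfl fun ρ _ => smul_comm _ _ _
  rw [mul_smul, eq_inv_smul_iff₀ hG.ne', Finset.sum_smul, ← Finset.sum_congr rfl h1,
    ← Finset.smul_sum, Finset.sum_comm]
  congr 1
  exact Finset.sum_congr rfl fun τ _ => Finset.smul_sum

/-- On an alternating tensor the antisymmetrization over the lines multiplies by the number of line
permutations. As $c\neq0$, tensors with the two-column symmetries lie in the image of the
symmetrizer, the converse of `isTwoCol_youngLines`. -/
theorem exists_youngLines_eq_smul [Module ℝ V] (hθ : IsMate line θ) :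
    ∃ c : ℝ, 0 < c ∧ ∀ Q : (ι → X) → V, IsTwoCol line Q → youngLines line θ Q = c • Q := by
  have hflip : ∀ j, line j = true → θ j ∈ Finset.univ.filter fun x => line x = false := by
    intro j hj
    rw [Finset.mem_filter, hθ.flip j (hθ.mated j hj), hj]
    exact ⟨Finset.mem_univ _, rfl⟩
  obtain ⟨c, hc, h⟩ := exists_youngLines_eq_altLines (X := X) (V := V) hθ
    (fun x hx => (Finset.mem_filter.1 hx).2) hflip
  have hL : 0 < ((linePerms line).card : ℝ) :=
    Nat.cast_pos.2 (Finset.card_pos.2 ⟨1, mem_linePerms.2 fun _ => rfl⟩)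
  refine ⟨c * (linePerms line).card, mul_pos hc hL, fun Q hQ => funext fun μ => ?_⟩
  rw [h Q hQ.isTwoColOn, Pi.smul_apply, mul_smul, Nat.cast_smul_eq_nsmul, ← Finset.sum_const]
  congr 1
  refine Finset.sum_congr rfl fun τ hτ => ?_
  rw [hQ.alt τ hτ, smul_smul, sign_mul_sign_self, one_smul]

theorem sum_comp_perm [Fintype X] {W : Type*} [AddCommMonoid W] (σ : Perm ι) (f : (ι → X) → W) :
    ∑ μ, f (μ ∘ σ) = ∑ μ, f μ :=
  Fintype.sum_equiv (Equiv.arrowCongr σ.symm (Equiv.refl X)) _ _ fun _ => rfl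

/-- A change of variables moves the line permutations and exchanges from $Z$ to $Q$. Of $Z$ only
antisymmetry in the first column is needed: it transfers an antisymmetrization to $Q$, where
`altOn_comp_exch` evaluates the exchange. -/
theorem exists_sum_mul_youngLines [Fintype X] (hθ : IsMate line θ) :
    ∃ c : ℝ, 0 < c ∧ ∀ Q Z : (ι → X) → ℝ, IsTwoCol line Q →
      (∀ ρ ∈ permsOn (Finset.univ.filter fun x => line x = false), ∀ μ,
        Z (μ ∘ ρ) = (Perm.sign ρ : ℤ) • Z μ) →
      ∑ μ, Q μ * youngLines line θ Z μ = c * ∑ μ, Q μ * Z μ := by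
  set C := Finset.univ.filter fun x => line x = false with hCdef
  have hC : ∀ x ∈ C, line x = false := fun x hx => (Finset.mem_filter.1 hx).2
  have hCθ : ∀ j, line j = true → θ j ∈ C := by
    intro j hj
    rw [hCdef, Finset.mem_filter, hθ.flip j (hθ.mated j hj), hj]
    exact ⟨Finset.mem_univ _, rfl⟩
  have hG : 0 < ((permsOn C).card : ℝ) :=
    Nat.cast_pos.2 (Finset.card_pos.2 ⟨1, one_mem_permsOn C⟩)
  have hL : 0 < ((linePerms line).card : ℝ) :=
    Nat.cast_pos.2 (Finset.card_pos.2 ⟨1, mem_linePerms.2 fun _ => rfl⟩)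
  refine ⟨(linePerms line).card * (((permsOn C).card : ℝ)⁻¹ *
    ∑ σ ∈ exchPerms θ, exchCoeff C (movedCells line σ).card),
    mul_pos hL (mul_pos (inv_pos.2 hG) (Finset.sum_pos (fun σ _ => exchCoeff_pos _ _)
      ⟨1, mem_exchPerms.2 IsExch.one⟩)), fun Q Z hQ hZ => ?_⟩
  have h1 : ∀ τ ∈ linePerms line, ∀ σ ∈ exchPerms θ,
      ∑ μ, Q μ * ((Perm.sign τ : ℤ) • Z ((μ ∘ τ) ∘ σ)) = ∑ μ, Q (μ ∘ σ) * Z μ := by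
    intro τ hτ σ hσ
    rw [← sum_comp_perm τ⁻¹, ← sum_comp_perm σ]
    refine Finset.sum_congr rfl fun μ _ => ?_
    have h2 : (((μ ∘ σ) ∘ (τ⁻¹ : Perm ι)) ∘ τ) ∘ σ = μ := by
      funext x
      have := (mem_exchPerms.1 hσ).apply_apply hθ x
      simp [this]
    rw [h2, hQ.alt _ (inv_mem_linePerms hτ), Perm.sign_inv, zsmul_eq_mul, zsmul_eq_mul]
    have := congrArg (Int.cast : ℤ → ℝ) (sign_mul_sign_self τ)
    push_cast at this
    linear_combination Q (μ ∘ σ) * Z μ * this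
  have h3 : ∀ σ ∈ exchPerms θ, ((permsOn C).card : ℝ) * ∑ μ, Q (μ ∘ σ) * Z μ
      = exchCoeff C (movedCells line σ).card * ∑ μ, Q μ * Z μ := by
    intro σ hσ
    have h4 : ∀ ρ ∈ permsOn C, ∑ μ, Q (μ ∘ σ) * Z μ
        = ∑ μ, ((Perm.sign ρ : ℤ) • Q ((μ ∘ ρ) ∘ σ)) * Z μ := by
      intro ρ hρ
      rw [← sum_comp_perm ρ]
      refine Finset.sum_congr rfl fun μ _ => ?_
      rw [hZ ρ hρ, zsmul_eq_mul, zsmul_eq_mul]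
      ring
    rw [← nsmul_eq_mul, ← Finset.sum_const, Finset.sum_congr rfl h4, Finset.sum_comm,
      Finset.mul_sum]
    refine Finset.sum_congr rfl fun μ _ => ?_
    rw [← Finset.sum_mul, ← mul_assoc]
    congr 1
    exact altOn_comp_exch hθ hC hCθ hQ.isTwoColOn _ σ (mem_exchPerms.1 hσ) rfl μ
  have h5 : ∑ μ, Q μ * youngLines line θ Z μ
      = ∑ τ ∈ linePerms line, ∑ σ ∈ exchPerms θ, ∑ μ, Q (μ ∘ σ) * Z μ := by
    rw [← Finset.sum_congr rfl fun τ hτ => Finset.sum_congr rfl fun σ hσ => h1 τ hτ σ hσ]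
    simp only [youngLines, Finset.smul_sum, Finset.mul_sum]
    rw [Finset.sum_comm]
    exact Finset.sum_congr rfl fun τ _ => Finset.sum_comm
  have h6 : ∑ σ ∈ exchPerms θ, ∑ μ, Q (μ ∘ σ) * Z μ = ((permsOn C).card : ℝ)⁻¹ *
      ∑ σ ∈ exchPerms θ, exchCoeff C (movedCells line σ).card * ∑ μ, Q μ * Z μ := by
    rw [eq_inv_mul_iff_mul_eq₀ hG.ne', Finset.mul_sum, Finset.sum_congr rfl h3]
  rw [h5, Finset.sum_const, nsmul_eq_mul, h6, ← Finset.sum_mul, mul_assoc, mul_assoc]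

end TwoColumns

end NComplex

namespace NComplex

/-! ### Antisymmetrized sums -/

section Wedge

variable {X V W : Type*} [AddCommGroup V] [AddCommGroup W] {n : ℕ}

/-- The alternating sum over the ways to single out one of the indices. -/
def wedge (g : X → (Fin n → X) → V) (μ : Fin (n + 1) → X) : V :=
  ∑ i : Fin (n + 1), (-1 : ℤ) ^ (i : ℕ) • g (μ i) (i.removeNth μ)

theorem wedge_zero_index (g : X → (Fin 0 → X) → V) (a : X) (ρ : Fin 0 → X) :
    wedge g (Fin.cons a ρ) = g a ρ := by
  rw [wedge, Fin.sum_univ_one, Fin.val_zero, pow_zero, one_smul]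
  rfl

theorem wedge_cons (g : X → (Fin (n + 1) → X) → V) (a : X) (μ : Fin (n + 1) → X) :
    wedge g (Fin.cons a μ) = g a μ - wedge (fun b ρ => g b (Fin.cons a ρ)) μ := by
  rw [wedge, Fin.sum_univ_succ, Fin.val_zero, pow_zero, one_smul, wedge, sub_eq_add_neg,
    ← Finset.sum_neg_distrib]
  congr 1
  refine Finset.sum_congr rfl fun i _ => ?_
  rw [Fin.val_succ, pow_succ, mul_neg_one, neg_smul, Fin.cons_succ]
  congr 3
  funext k
  refine Fin.cases ?_ (fun k => ?_) k
  · simp [Fin.removeNth]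
  · simp [Fin.removeNth]

theorem wedge_add (g h : X → (Fin n → X) → V) (μ : Fin (n + 1) → X) :
    wedge (fun a ρ => g a ρ + h a ρ) μ = wedge g μ + wedge h μ := by
  simp only [wedge, smul_add, Finset.sum_add_distrib]

theorem wedge_sub (g h : X → (Fin n → X) → V) (μ : Fin (n + 1) → X) :
    wedge (fun a ρ => g a ρ - h a ρ) μ = wedge g μ - wedge h μ := by
  simp only [wedge, smul_sub, Finset.sum_sub_distrib]

theorem wedge_neg (g : X → (Fin n → X) → V) (μ : Fin (n + 1) → X) :
    wedge (fun a ρ => -g a ρ) μ = -wedge g μ := by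
  simp only [wedge, smul_neg, Finset.sum_neg_distrib]

theorem wedge_sum {κ : Type*} (s : Finset κ) (g : κ → X → (Fin n → X) → V) (μ : Fin (n + 1) → X) :
    wedge (fun a ρ => ∑ k ∈ s, g k a ρ) μ = ∑ k ∈ s, wedge (g k) μ := by
  simp only [wedge, Finset.smul_sum]
  exact Finset.sum_comm

theorem map_wedge {F : Type*} [FunLike F V W] [AddMonoidHomClass F V W] (φ : F)
    (g : X → (Fin n → X) → V) (μ : Fin (n + 1) → X) :
    φ (wedge g μ) = wedge (fun a ρ => φ (g a ρ)) μ := by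
  simp only [wedge, map_sum, map_zsmul]

theorem mul_wedge {R : Type*} [CommRing R] (r : R) (g : X → (Fin n → X) → R)
    (μ : Fin (n + 1) → X) : r * wedge g μ = wedge (fun a ρ => r * g a ρ) μ :=
  map_wedge (AddMonoidHom.mulLeft r) g μ

theorem wedge_wedge (g : X → X → (Fin n → X) → V) : ∀ μ : Fin (n + 2) → X,
    wedge (fun a ρ => wedge (g a) ρ) μ = -wedge (fun b ρ => wedge (fun a => g a b) ρ) μ := by
  induction n with
  | zero =>
    intro μ
    rw [← Fin.cons_self_tail μ, wedge_cons, wedge_cons]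
    simp only [wedge_zero_index]
    abel
  | succ n ih =>
    intro μ
    rw [← Fin.cons_self_tail μ, wedge_cons, wedge_cons]
    simp only [wedge_cons (n := n), wedge_sub]
    rw [ih (fun b c ρ => g b c (Fin.cons (μ 0) ρ))]
    abel

/-- Bringing the index $i$ to the front is the inverse of a cycle, of sign $(-1)^i$. -/
theorem wedge_cons_eq_sum_perm (F : (Fin (n + 1) → X) → V) (μ : Fin (n + 1) → X) :
    wedge (fun a ρ => F (Fin.cons a ρ)) μ
      = ∑ i : Fin (n + 1), (Equiv.Perm.sign i.cycleRange⁻¹ : ℤ) •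
        F (μ ∘ (i.cycleRange⁻¹ : Equiv.Perm _)) := by
  refine Finset.sum_congr rfl fun i _ => ?_
  beta_reduce
  rw [Equiv.Perm.sign_inv, Fin.sign_cycleRange, Fin.cons_removeNth_eq_comp_cycleRange_symm,
    Units.val_pow_eq_pow_val, Units.val_neg, Units.val_one]
  rfl

/-- The tensor `F` changes by the sign under permutations of its indices. -/
def IsAntisymm (F : (Fin n → X) → V) : Prop :=
  ∀ (σ : Equiv.Perm (Fin n)) (μ : Fin n → X), F (μ ∘ σ) = (Equiv.Perm.sign σ : ℤ) • F μ

theorem IsAntisymm.wedge_cons_eq {F : (Fin (n + 1) → X) → V} (hF : IsAntisymm F)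
    (μ : Fin (n + 1) → X) : wedge (fun a ρ => F (Fin.cons a ρ)) μ = (n + 1) • F μ := by
  rw [wedge_cons_eq_sum_perm]
  have h : ∀ i : Fin (n + 1), (Equiv.Perm.sign i.cycleRange⁻¹ : ℤ) •
      F (μ ∘ (i.cycleRange⁻¹ : Equiv.Perm _))
      = F μ := fun i => by rw [hF, smul_smul, sign_mul_sign_self, one_smul]
  rw [Finset.sum_congr rfl fun i _ => h i, Finset.sum_const, Finset.card_univ, Fintype.card_fin]

theorem IsAntisymm.slice {F : (Fin (n + 1) → X) → V} (hF : IsAntisymm F) (a : X) :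
    IsAntisymm fun ρ : Fin n → X => F (Fin.cons a ρ) := by
  intro σ ρ
  beta_reduce
  rw [← cons_comp_liftPerm, hF, sign_liftPerm]

theorem IsAntisymm.cons_cons {F : (Fin (n + 2) → X) → V} (hF : IsAntisymm F) (a b : X)
    (ρ : Fin n → X) : F (Fin.cons a (Fin.cons b ρ : Fin (n + 1) → X))
      = -F (Fin.cons b (Fin.cons a ρ : Fin (n + 1) → X)) := by
  have h := hF (Equiv.swap 0 1) (Fin.cons b (Fin.cons a ρ : Fin (n + 1) → X))
  rw [Equiv.Perm.sign_swap (by simp), Units.val_neg, Units.val_one, neg_one_smul] at h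
  rw [← h]
  congr 1
  funext i
  refine Fin.cases ?_ (fun i => ?_) i
  · simp
  · refine Fin.cases ?_ (fun i => ?_) i
    · simp
    · rw [Function.comp_apply, Equiv.swap_apply_of_ne_of_ne]
      · rfl
      · exact Fin.succ_ne_zero _
      · exact fun h' => Fin.succ_ne_zero i (Fin.succ_injective _ h')

theorem isAntisymm_of_le_one (hn : n ≤ 1) (F : (Fin n → X) → V) : IsAntisymm F := by
  intro σ μ
  have := Fin.subsingleton_iff_le_one.2 hn
  rw [Subsingleton.elim σ 1, Equiv.Perm.sign_one, Units.val_one, one_smul]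
  rfl

/-- Adjacent transpositions generate the symmetric group: the first one is covered by `h2`, and the
others fix the first index and are covered by `h1`. -/
theorem isAntisymm_of_cons {F : (Fin (n + 2) → X) → V}
    (h1 : ∀ a, IsAntisymm fun ρ : Fin (n + 1) → X => F (Fin.cons a ρ))
    (h2 : ∀ a b (ρ : Fin n → X), F (Fin.cons a (Fin.cons b ρ : Fin (n + 1) → X))
      = -F (Fin.cons b (Fin.cons a ρ : Fin (n + 1) → X))) : IsAntisymm F := by
  intro σ
  have hσ : σ ∈ Submonoid.closure (Set.range fun i : Fin (n + 1) => Equiv.swap i.castSucc i.succ) := by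
    rw [Equiv.Perm.mclosure_swap_castSucc_succ]
    trivial
  induction hσ using Submonoid.closure_induction with
  | mem σ hσ =>
    obtain ⟨i, rfl⟩ := hσ
    intro μ
    refine Fin.cases ?_ (fun i => ?_) i
    · rw [Equiv.Perm.sign_swap (by simp), Units.val_neg, Units.val_one, neg_one_smul,
        ← Fin.cons_self_tail μ, ← Fin.cons_self_tail (Fin.tail μ), ← h2]
      congr 1
      funext i
      refine Fin.cases ?_ (fun i => ?_) i
      · simp
        rfl
      · refine Fin.cases ?_ (fun i => ?_) i
        · simp
        · rw [Function.comp_apply, Equiv.swap_apply_of_ne_of_ne]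
          · rfl
          · exact Fin.succ_ne_zero _
          · exact fun h' => Fin.succ_ne_zero i (Fin.succ_injective _ h')
    · have hl : Equiv.swap i.succ.castSucc i.succ.succ = liftPerm (Equiv.swap i.castSucc i.succ) := by
        refine Equiv.ext fun k => Fin.cases ?_ (fun k => ?_) k
        · rw [liftPerm_zero, Equiv.swap_apply_of_ne_of_ne]
          · exact (Fin.succ_ne_zero i.castSucc).symm
          · exact (Fin.succ_ne_zero _).symm
        · rw [liftPerm_succ]
          exact (Fin.succ_injective _).swap_apply i.castSucc i.succ k
      beta_reduce
      rw [hl, sign_liftPerm, ← Fin.cons_self_tail μ, cons_comp_liftPerm]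
      exact h1 _ _ _
  | one => intro μ; rw [Equiv.Perm.sign_one, Units.val_one, one_smul]; rfl
  | mul σ τ _ _ hσ hτ =>
    intro μ
    have h : μ ∘ (σ * τ : Equiv.Perm _) = (μ ∘ σ) ∘ τ := rfl
    rw [h, hτ, hσ, smul_smul, Equiv.Perm.sign_mul, Units.val_mul, mul_comm]

theorem IsAntisymm.add {F G : (Fin n → X) → V} (hF : IsAntisymm F) (hG : IsAntisymm G) :
    IsAntisymm fun μ => F μ + G μ := by
  intro σ μ
  beta_reduce
  rw [hF, hG, smul_add]

theorem IsAntisymm.sub {F G : (Fin n → X) → V} (hF : IsAntisymm F) (hG : IsAntisymm G) :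
    IsAntisymm fun μ => F μ - G μ := by
  intro σ μ
  beta_reduce
  rw [hF, hG, smul_sub]

theorem IsAntisymm.map {F : (Fin n → X) → V} (hF : IsAntisymm F) {Φ : Type*} [FunLike Φ V W]
    [AddMonoidHomClass Φ V W] (φ : Φ) : IsAntisymm fun μ => φ (F μ) := by
  intro σ μ
  beta_reduce
  rw [hF, map_zsmul]

theorem IsAntisymm.sum {κ : Type*} {s : Finset κ} {F : κ → (Fin n → X) → V}
    (hF : ∀ k, IsAntisymm (F k)) : IsAntisymm fun μ => ∑ k ∈ s, F k μ := by
  intro σ μ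
  beta_reduce
  rw [Finset.smul_sum]
  exact Finset.sum_congr rfl fun k _ => hF k σ μ

theorem isAntisymm_wedge : ∀ {n : ℕ} {g : X → (Fin n → X) → V}, (∀ a, IsAntisymm (g a)) →
    IsAntisymm (wedge g)
  | 0, _, _ => isAntisymm_of_le_one (by omega) _
  | 1, g, hg => by
    refine isAntisymm_of_cons (fun a => isAntisymm_of_le_one (by omega) _) fun a b ρ => ?_
    rw [wedge_cons, wedge_cons, wedge_zero_index, wedge_zero_index, neg_sub]
  | n + 2, g, hg => by
    refine isAntisymm_of_cons (fun a => ?_) fun a b ρ => ?_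
    · simp only [wedge_cons]
      exact (hg a).sub (isAntisymm_wedge fun b => (hg b).slice a)
    · have e : ∀ a b, wedge g (Fin.cons a (Fin.cons b ρ : Fin (n + 2) → X))
          = g a (Fin.cons b ρ) - (g b (Fin.cons a ρ)
            - wedge (fun c ρ' => g c (Fin.cons a (Fin.cons b ρ' : Fin (n + 1) → X))) ρ) :=
        fun a b => by rw [wedge_cons, wedge_cons]
      have h : wedge (fun c ρ' => g c (Fin.cons b (Fin.cons a ρ' : Fin (n + 1) → X))) ρ
          = -wedge (fun c ρ' => g c (Fin.cons a (Fin.cons b ρ' : Fin (n + 1) → X))) ρ := by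
        rw [← wedge_neg]
        congr 1
        funext c ρ'
        exact (hg c).cons_cons b a ρ'
      rw [e, e, h]
      abel

end Wedge

end NComplex

namespace NComplex

/-! ### Biforms -/

open SmoothFn

/-- Tensor fields with two groups of indices. -/
abbrev BiForm (D n₀ n₁ : ℕ) : Type := (Fin n₀ → Fin D) → (Fin n₁ → Fin D) → SmoothFn D

namespace BiForm

variable {D n₀ n₁ : ℕ}

/-- The exchange of the two groups of indices. -/
def flip (B : BiForm D n₀ n₁) : BiForm D n₁ n₀ := fun ν μ => B μ ν

/-- Application of an operator to the components. -/
noncomputable def map (φ : SmoothFn D →ₗ[ℝ] SmoothFn D) : BiForm D n₀ n₁ →ₗ[ℝ] BiForm D n₀ n₁ where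
  toFun B μ ν := φ (B μ ν)
  map_add' _ _ := funext fun _ => funext fun _ => map_add φ _ _
  map_smul' _ _ := funext fun _ => funext fun _ => map_smul φ _ _

theorem map_apply (φ : SmoothFn D →ₗ[ℝ] SmoothFn D) (B : BiForm D n₀ n₁) (μ : Fin n₀ → Fin D)
    (ν : Fin n₁ → Fin D) : map φ B μ ν = φ (B μ ν) := rfl

theorem wedge_smul {n : ℕ} (r : ℝ) (g : Fin D → (Fin n → Fin D) → SmoothFn D)
    (μ : Fin (n + 1) → Fin D) : wedge (fun a ρ => r • g a ρ) μ = r • wedge g μ :=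
  (map_wedge (LinearMap.lsmul ℝ (SmoothFn D) r) g μ).symm

/-- The exterior derivative in the first group of indices. -/
noncomputable def d₁ : BiForm D n₀ n₁ →ₗ[ℝ] BiForm D (n₀ + 1) n₁ where
  toFun B μ ν := wedge (fun a ρ => pd a (B ρ ν)) μ
  map_add' A B := by
    funext μ ν
    simp only [Pi.add_apply, map_add]
    exact wedge_add _ _ _
  map_smul' r B := by
    funext μ ν
    simp only [Pi.smul_apply, map_smul]
    exact wedge_smul _ _ _

/-- The exterior derivative in the second group of indices. -/
noncomputable def d₂ : BiForm D n₀ n₁ →ₗ[ℝ] BiForm D n₀ (n₁ + 1) where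
  toFun B := flip (d₁ (flip B))
  map_add' A B := congrArg flip (map_add d₁ (flip A) (flip B))
  map_smul' r B := congrArg flip (map_smul d₁ r (flip B))

/-- The contraction of the first group of indices with the position. -/
noncomputable def i₁ : BiForm D (n₀ + 1) n₁ →ₗ[ℝ] BiForm D n₀ n₁ where
  toFun B μ ν := ∑ a, crd a * B (Fin.cons a μ) ν
  map_add' A B := by
    funext μ ν
    simp only [Pi.add_apply, mul_add, Finset.sum_add_distrib]
  map_smul' r B := by
    funext μ ν
    simp only [Pi.smul_apply, mul_smul_comm, RingHom.id_apply, Finset.smul_sum]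

/-- The contraction of the second group of indices with the position. -/
noncomputable def i₂ : BiForm D n₀ (n₁ + 1) →ₗ[ℝ] BiForm D n₀ n₁ where
  toFun B := flip (i₁ (flip B))
  map_add' A B := congrArg flip (map_add i₁ (flip A) (flip B))
  map_smul' r B := congrArg flip (map_smul i₁ r (flip B))

/-- The antisymmetrization of an index of the second group with those of the first. -/
noncomputable def s₁₂ : BiForm D n₀ (n₁ + 1) →ₗ[ℝ] BiForm D (n₀ + 1) n₁ where
  toFun B μ ν := wedge (fun a ρ => B ρ (Fin.cons a ν)) μ
  map_add' A B := by
    funext μ ν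
    simp only [Pi.add_apply]
    exact wedge_add _ _ _
  map_smul' r B := by
    funext μ ν
    simp only [Pi.smul_apply]
    exact wedge_smul _ _ _

/-- The antisymmetrization of an index of the first group with those of the second. -/
noncomputable def s₂₁ : BiForm D (n₀ + 1) n₁ →ₗ[ℝ] BiForm D n₀ (n₁ + 1) where
  toFun B := flip (s₁₂ (flip B))
  map_add' A B := congrArg flip (map_add s₁₂ (flip A) (flip B))
  map_smul' r B := congrArg flip (map_smul s₁₂ r (flip B))

theorem d₁_apply (B : BiForm D n₀ n₁) (μ : Fin (n₀ + 1) → Fin D) (ν : Fin n₁ → Fin D) :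
    d₁ B μ ν = wedge (fun a ρ => pd a (B ρ ν)) μ := rfl

theorem d₂_apply (B : BiForm D n₀ n₁) (μ : Fin n₀ → Fin D) (ν : Fin (n₁ + 1) → Fin D) :
    d₂ B μ ν = wedge (fun a ρ => pd a (B μ ρ)) ν := rfl

theorem i₁_apply (B : BiForm D (n₀ + 1) n₁) (μ : Fin n₀ → Fin D) (ν : Fin n₁ → Fin D) :
    i₁ B μ ν = ∑ a, crd a * B (Fin.cons a μ) ν := rfl

theorem i₂_apply (B : BiForm D n₀ (n₁ + 1)) (μ : Fin n₀ → Fin D) (ν : Fin n₁ → Fin D) :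
    i₂ B μ ν = ∑ a, crd a * B μ (Fin.cons a ν) := rfl

theorem s₁₂_apply (B : BiForm D n₀ (n₁ + 1)) (μ : Fin (n₀ + 1) → Fin D) (ν : Fin n₁ → Fin D) :
    s₁₂ B μ ν = wedge (fun a ρ => B ρ (Fin.cons a ν)) μ := rfl

theorem s₂₁_apply (B : BiForm D (n₀ + 1) n₁) (μ : Fin n₀ → Fin D) (ν : Fin (n₁ + 1) → Fin D) :
    s₂₁ B μ ν = wedge (fun a ρ => B (Fin.cons a μ) ρ) ν := rfl

/-- Antisymmetry in the first group of indices. -/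
def Alt₁ (B : BiForm D n₀ n₁) : Prop := ∀ ν, IsAntisymm fun μ => B μ ν

/-- Antisymmetry in the second group of indices. -/
def Alt₂ (B : BiForm D n₀ n₁) : Prop := ∀ μ, IsAntisymm (B μ)

/-! #### Relations between the operators -/

theorem pd_crd_mul (a b : Fin D) (f : SmoothFn D) :
    pd b (crd a * f) = (if b = a then f else 0) + crd a * pd b f := by
  rw [pd_mul, pd_crd, ite_mul, one_mul, zero_mul]

theorem pd_sum_crd_mul (b : Fin D) (f : Fin D → SmoothFn D) :
    pd b (∑ a, crd a * f a) = f b + ∑ a, crd a * pd b (f a) := by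
  rw [map_sum]
  simp only [pd_crd_mul, Finset.sum_add_distrib]
  rw [Finset.sum_ite_eq, if_pos (Finset.mem_univ b)]

/-- The Euler operator on biforms. -/
noncomputable def eulerB (B : BiForm D n₀ n₁) : BiForm D n₀ n₁ := fun μ ν => euler (B μ ν)

/-- Cartan's formula for the radial vector field in the first column. The terms in which the
derivative hits $B$ cancel up to the Euler operator; those in which it hits the coordinate give
$n_0+1$ copies of $B$. -/
theorem d₁_i₁_add {B : BiForm D (n₀ + 1) n₁} (hB : Alt₁ B) :
    d₁ (i₁ B) + i₁ (d₁ B) = eulerB B + ((n₀ : ℝ) + 1) • B := by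
  funext μ ν
  have h1 : d₁ (i₁ B) μ ν = wedge (fun a ρ => B (Fin.cons a ρ) ν) μ
      + ∑ a, crd a * wedge (fun b ρ => pd b (B (Fin.cons a ρ) ν)) μ := by
    rw [d₁_apply]
    simp only [i₁_apply, pd_sum_crd_mul, mul_wedge]
    rw [wedge_add, wedge_sum]
  have h2 : i₁ (d₁ B) μ ν = euler (B μ ν)
      - ∑ a, crd a * wedge (fun b ρ => pd b (B (Fin.cons a ρ) ν)) μ := by
    rw [i₁_apply]
    simp only [d₁_apply, wedge_cons, mul_sub, Finset.sum_sub_distrib]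
    rfl
  rw [Pi.add_apply, Pi.add_apply, h1, h2, (hB ν).wedge_cons_eq, Pi.add_apply, Pi.add_apply,
    eulerB, Pi.smul_apply, Pi.smul_apply, ← Nat.cast_smul_eq_nsmul ℝ, Nat.cast_add, Nat.cast_one]
  abel

theorem d₂_i₂_add {B : BiForm D n₀ (n₁ + 1)} (hB : Alt₂ B) :
    d₂ (i₂ B) + i₂ (d₂ B) = eulerB B + ((n₁ : ℝ) + 1) • B :=
  congrArg flip (d₁_i₁_add (B := flip B) hB)

/-- The derivative in the second column may hit the coordinate contracted into the first; this
carries an index across, which is $s_{21}$. -/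
theorem d₂_i₁ (B : BiForm D (n₀ + 1) n₁) : d₂ (i₁ B) = s₂₁ B + i₁ (d₂ B) := by
  funext μ ν
  rw [d₂_apply, Pi.add_apply, Pi.add_apply, s₂₁_apply, i₁_apply]
  simp only [i₁_apply, pd_sum_crd_mul, d₂_apply, mul_wedge]
  rw [wedge_add, wedge_sum]

theorem d₁_i₂ (B : BiForm D n₀ (n₁ + 1)) : d₁ (i₂ B) = s₁₂ B + i₂ (d₁ B) :=
  congrArg flip (d₂_i₁ (flip B))

theorem eulerB_i₁ (B : BiForm D (n₀ + 1) n₁) : eulerB (i₁ B) = i₁ B + i₁ (eulerB B) := by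
  funext μ ν
  have h : ∀ a, euler (crd a * B (Fin.cons a μ) ν)
      = crd a * B (Fin.cons a μ) ν + crd a * euler (B (Fin.cons a μ) ν) := by
    intro a
    unfold euler
    simp only [pd_crd_mul, mul_add, Finset.sum_add_distrib, Finset.mul_sum, mul_ite, mul_zero]
    rw [Finset.sum_ite_eq', if_pos (Finset.mem_univ a)]
    congr 1
    exact Finset.sum_congr rfl fun b _ => mul_left_comm _ _ _
  have h2 : euler (∑ a, crd a * B (Fin.cons a μ) ν) = ∑ a, euler (crd a * B (Fin.cons a μ) ν) := by
    unfold euler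
    simp only [map_sum, Finset.mul_sum]
    exact Finset.sum_comm
  rw [eulerB, i₁_apply, h2, Pi.add_apply, Pi.add_apply, i₁_apply, i₁_apply, ← Finset.sum_add_distrib]
  exact Finset.sum_congr rfl fun a _ => h a

theorem s₂₁_i₂ (B : BiForm D (n₀ + 1) (n₁ + 1)) : s₂₁ (i₂ B) = i₁ B - i₂ (s₂₁ B) := by
  funext μ ν
  rw [s₂₁_apply, Pi.sub_apply, Pi.sub_apply, i₁_apply, i₂_apply]
  simp only [i₂_apply, s₂₁_apply, wedge_cons, mul_sub, Finset.sum_sub_distrib, wedge_sum,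
    mul_wedge, sub_sub_cancel]

theorem s₁₂_i₁ (B : BiForm D (n₀ + 1) (n₁ + 1)) : s₁₂ (i₁ B) = i₂ B - i₁ (s₁₂ B) :=
  congrArg flip (s₂₁_i₂ (flip B))

theorem s₂₁_i₁ {B : BiForm D (n₀ + 2) n₁} (hB : Alt₁ B) : s₂₁ (i₁ B) = -i₁ (s₂₁ B) := by
  funext μ ν
  rw [s₂₁_apply, Pi.neg_apply, Pi.neg_apply, i₁_apply]
  simp only [i₁_apply, s₂₁_apply, wedge_sum, mul_wedge]
  rw [← Finset.sum_neg_distrib]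
  refine Finset.sum_congr rfl fun a _ => ?_
  rw [← wedge_neg]
  congr 1
  funext b ρ
  rw [(hB ρ).cons_cons, mul_neg]

theorem s₁₂_i₂ {B : BiForm D n₀ (n₁ + 2)} (hB : Alt₂ B) : s₁₂ (i₂ B) = -i₂ (s₁₂ B) :=
  congrArg flip (s₂₁_i₁ (B := flip B) hB)

theorem s₂₁_d₁ (B : BiForm D (n₀ + 1) n₁) : s₂₁ (d₁ B) = d₂ B - d₁ (s₂₁ B) := by
  funext μ ν
  rw [s₂₁_apply, Pi.sub_apply, Pi.sub_apply, d₂_apply, d₁_apply]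
  simp only [d₁_apply, wedge_cons, wedge_sub, s₂₁_apply, map_wedge]
  congr 1
  simp only [wedge, Finset.smul_sum]
  rw [Finset.sum_comm]
  exact Finset.sum_congr rfl fun _ _ => Finset.sum_congr rfl fun _ _ => smul_comm _ _ _

theorem s₁₂_d₂ (B : BiForm D n₀ (n₁ + 1)) : s₁₂ (d₂ B) = d₁ B - d₂ (s₁₂ B) :=
  congrArg flip (s₂₁_d₁ (flip B))

theorem s₁₂_d₁ (B : BiForm D n₀ (n₁ + 1)) : s₁₂ (d₁ B) = -d₁ (s₁₂ B) := by
  funext μ ν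
  rw [s₁₂_apply, Pi.neg_apply, Pi.neg_apply, d₁_apply]
  simp only [d₁_apply, s₁₂_apply, map_wedge]
  exact wedge_wedge (fun a b ρ => pd b (B ρ (Fin.cons a ν))) μ

theorem eq_zero_of_eq_neg {V : Type*} [AddCommGroup V] [Module ℝ V] {x : V} (h : x = -x) :
    x = 0 := by
  have h2 : (2 : ℝ) • x = 0 := by rw [two_smul, ← sub_neg_eq_add, ← h, sub_self]
  exact (smul_eq_zero.1 h2).resolve_left two_ne_zero

theorem d₁_d₁ (B : BiForm D n₀ n₁) : d₁ (d₁ B) = 0 := by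
  have h : d₁ (d₁ B) = -d₁ (d₁ B) := by
    funext μ ν
    rw [Pi.neg_apply, Pi.neg_apply]
    simp only [d₁_apply, map_wedge]
    refine (wedge_wedge (fun a b ρ => pd a (pd b (B ρ ν))) μ).trans (congrArg Neg.neg ?_)
    exact congrFun (congrArg wedge (funext₂ fun a ρ => congrFun (congrArg wedge
      (funext₂ fun b ρ' => pd_comm _ _ _)) _)) _
  exact eq_zero_of_eq_neg h

theorem d₁_d₂ (B : BiForm D n₀ n₁) : d₁ (d₂ B) = d₂ (d₁ B) := by
  funext μ ν
  simp only [d₁_apply, d₂_apply, map_wedge]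
  simp only [wedge, Finset.smul_sum]
  rw [Finset.sum_comm]
  refine Finset.sum_congr rfl fun j _ => Finset.sum_congr rfl fun i _ => ?_
  rw [smul_comm, pd_comm]

theorem i₁_i₁ {B : BiForm D (n₀ + 2) n₁} (hB : Alt₁ B) : i₁ (i₁ B) = 0 := by
  have h : i₁ (i₁ B) = -i₁ (i₁ B) := by
    funext μ ν
    rw [Pi.neg_apply, Pi.neg_apply]
    simp only [i₁_apply, Finset.mul_sum]
    conv_lhs => rw [Finset.sum_comm]
    rw [← Finset.sum_neg_distrib]
    refine Finset.sum_congr rfl fun a _ => ?_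
    rw [← Finset.sum_neg_distrib]
    refine Finset.sum_congr rfl fun b _ => ?_
    rw [(hB ν).cons_cons]
    ring
  exact eq_zero_of_eq_neg h

theorem i₂_i₂ {B : BiForm D n₀ (n₁ + 2)} (hB : Alt₂ B) : i₂ (i₂ B) = 0 :=
  congrArg flip (i₁_i₁ (B := flip B) hB)

theorem d₁_avg (c : ℕ) (B : BiForm D n₀ n₁) : d₁ (map (avg c) B) = map (avg (c + 1)) (d₁ B) := by
  funext μ ν
  simp only [d₁_apply, map_apply, pd_avg, map_wedge]

theorem d₂_avg (c : ℕ) (B : BiForm D n₀ n₁) : d₂ (map (avg c) B) = map (avg (c + 1)) (d₂ B) :=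
  congrArg flip (d₁_avg c (flip B))

theorem s₁₂_map (φ : SmoothFn D →ₗ[ℝ] SmoothFn D) (B : BiForm D n₀ (n₁ + 1)) :
    s₁₂ (map φ B) = map φ (s₁₂ B) := by
  funext μ ν
  simp only [s₁₂_apply, map_apply, map_wedge]

theorem s₂₁_map (φ : SmoothFn D →ₗ[ℝ] SmoothFn D) (B : BiForm D (n₀ + 1) n₁) :
    s₂₁ (map φ B) = map φ (s₂₁ B) :=
  congrArg flip (s₁₂_map φ (flip B))

theorem eulerB_avg (c : ℕ) (B : BiForm D n₀ n₁) :
    eulerB (map (avg c) B) + ((c : ℝ) + 1) • map (avg c) B = B :=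
  funext fun _ => funext fun _ => euler_avg c _

/-! #### Antisymmetry -/

theorem Alt₁.map {B : BiForm D n₀ n₁} (hB : Alt₁ B) (φ : SmoothFn D →ₗ[ℝ] SmoothFn D) :
    Alt₁ (map φ B) := fun ν => (hB ν).map φ

theorem Alt₂.map {B : BiForm D n₀ n₁} (hB : Alt₂ B) (φ : SmoothFn D →ₗ[ℝ] SmoothFn D) :
    Alt₂ (BiForm.map φ B) := fun μ => (hB μ).map φ

theorem Alt₁.add {A B : BiForm D n₀ n₁} (hA : Alt₁ A) (hB : Alt₁ B) : Alt₁ (A + B) :=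
  fun ν => (hA ν).add (hB ν)

theorem Alt₂.add {A B : BiForm D n₀ n₁} (hA : Alt₂ A) (hB : Alt₂ B) : Alt₂ (A + B) :=
  fun μ => (hA μ).add (hB μ)

theorem Alt₁.d₁ {B : BiForm D n₀ n₁} (hB : Alt₁ B) : Alt₁ (d₁ B) :=
  fun ν => isAntisymm_wedge fun a => (hB ν).map (pd a)

theorem Alt₁.i₁ {B : BiForm D (n₀ + 1) n₁} (hB : Alt₁ B) : Alt₁ (i₁ B) :=
  fun ν => IsAntisymm.sum (s := Finset.univ)
    (F := fun a μ => crd a * B (Fin.cons a μ) ν)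
    fun a => ((hB ν).slice a).map (AddMonoidHom.mulLeft (crd a))

theorem Alt₁.d₂ {B : BiForm D n₀ n₁} (hB : Alt₁ B) : Alt₁ (d₂ B) :=
  fun ν => IsAntisymm.sum (s := Finset.univ)
    (F := fun (i : Fin (n₁ + 1)) μ => (-1 : ℤ) ^ (i : ℕ) • pd (ν i) (B μ (i.removeNth ν)))
    fun i => ((hB _).map (pd (ν i))).map (zsmulAddGroupHom _)

theorem Alt₁.i₂ {B : BiForm D n₀ (n₁ + 1)} (hB : Alt₁ B) : Alt₁ (i₂ B) :=
  fun ν => IsAntisymm.sum (s := Finset.univ)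
    (F := fun a μ => crd a * B μ (Fin.cons a ν)) fun a => (hB _).map (AddMonoidHom.mulLeft (crd a))

theorem Alt₂.d₂ {B : BiForm D n₀ n₁} (hB : Alt₂ B) : Alt₂ (d₂ B) := Alt₁.d₁ (B := flip B) hB

theorem Alt₂.i₂ {B : BiForm D n₀ (n₁ + 1)} (hB : Alt₂ B) : Alt₂ (i₂ B) := Alt₁.i₁ (B := flip B) hB

theorem Alt₂.d₁ {B : BiForm D n₀ n₁} (hB : Alt₂ B) : Alt₂ (d₁ B) := Alt₁.d₂ (B := flip B) hB

theorem Alt₂.i₁ {B : BiForm D (n₀ + 1) n₁} (hB : Alt₂ B) : Alt₂ (i₁ B) :=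
  Alt₁.i₂ (B := flip B) hB

/-! #### Poincaré lemmas -/

/-- A contraction of the first column alone violates the relation by $i_2B$; a further $i_2$ kills
this term, since $i_2i_2=0$. -/
theorem s₁₂_i₂_i₁ {B : BiForm D (n₀ + 1) (n₁ + 2)} (h2 : Alt₂ B) (hs : s₁₂ B = 0) :
    s₁₂ (i₂ (i₁ B)) = 0 := by
  rw [s₁₂_i₂ h2.i₁, s₁₂_i₁, hs, map_zero, sub_zero, i₂_i₂ h2, neg_zero]

variable {m : ℕ} {T : BiForm D (m + 1) (m + 1)}

theorem d₂_eq_zero_of_d₁_eq_zero (hs : s₂₁ T = 0) (hd : d₁ T = 0) : d₂ T = 0 := by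
  have h := s₂₁_d₁ T
  rwa [hd, hs, map_zero, map_zero, sub_zero, eq_comm] at h

/-- Let $f$ be the inner average and $h$ the outer one. Since $d_2h$ and $s_{21}h$ vanish, $d_2i_2$
acts on $i_1h$ as Euler plus $m+1$, which under $i_1$ becomes Euler plus $m+2$; the outer average
inverts this and leaves $i_1f$. As $d_1f=0$, $d_1i_1$ acts on $f$ as Euler plus $m+1$, which the
inner average inverts. -/
theorem d₁_d₂_i₂_i₁_avg (h1 : Alt₁ T) (h2 : Alt₂ T) (hs : s₂₁ T = 0) (hd : d₁ T = 0) :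
    d₁ (d₂ (i₂ (i₁ (map (avg (m + 1)) (map (avg m) T))))) = T := by
  set f := map (avg m) T with hf
  set h := map (avg (m + 1)) f with hh
  have hd2 : d₂ h = 0 := by
    rw [hh, hf, d₂_avg, d₂_avg, d₂_eq_zero_of_d₁_eq_zero hs hd, map_zero, map_zero]
  have hsh : s₂₁ h = 0 := by
    rw [hh, hf, s₂₁_map, s₂₁_map, hs, map_zero, map_zero]
  have e1 : d₂ (i₂ (i₁ h)) = i₁ f := by
    have := d₂_i₂_add (h2.map (avg m) |>.map (avg (m + 1))).i₁
    rw [← hf, ← hh, d₂_i₁, hd2, hsh, map_zero, add_zero, map_zero, add_zero, eulerB_i₁] at this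
    rw [this, ← eulerB_avg (m + 1) f, ← hh, map_add, map_smul]
    push_cast
    module
  have e2 := d₁_i₁_add (h1.map (avg m))
  rw [← hf, show d₁ f = 0 by rw [hf, d₁_avg, hd, map_zero], map_zero, add_zero] at e2
  rw [e1, e2, hf, eulerB_avg]

/-- Let $f,g,g'$ be the averages of $T,d_1T,d_2T$. The summand $i_2f$ alone gives
$2T-i_2d_2f-i_1d_1f$. For $i_2i_1g$ the two parts are $i_1g+i_1d_1f-i_2g'$ and $i_2g'-i_1g+i_2d_2f$,
and their sum is exactly the missing correction. -/
theorem d₂_add_d₁_s₂₁ (h1 : Alt₁ T) (h2 : Alt₂ T) (hs : s₂₁ T = 0) (hs' : s₁₂ T = 0)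
    (hd : d₁ (d₂ T) = 0) {S : BiForm D (m + 1) m}
    (hS : S = i₂ (map (avg m) T) + i₂ (i₁ (map (avg m) (map (avg (m + 1)) (d₁ T))))) :
    d₂ S + d₁ (s₂₁ S) = (2 : ℝ) • T := by
  set f := map (avg m) T with hf
  set g := map (avg m) (map (avg (m + 1)) (d₁ T)) with hg
  set g' := map (avg m) (map (avg (m + 1)) (d₂ T)) with hg'
  have hf1 : Alt₁ f := h1.map _
  have hf2 : Alt₂ f := h2.map _
  have hg1 : Alt₁ g := (h1.d₁.map _).map _
  have hg2 : Alt₂ g := (h2.d₁.map _).map _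
  have hg'1 : Alt₁ g' := (h1.d₂.map _).map _
  have hsf : s₂₁ f = 0 := by rw [hf, s₂₁_map, hs, map_zero]
  have hd1f : d₁ f = map (avg (m + 1)) (d₁ T) := d₁_avg _ _
  have hd2f : d₂ f = map (avg (m + 1)) (d₂ T) := d₂_avg _ _
  have hd2g : d₂ g = 0 := by
    rw [hg, d₂_avg, d₂_avg, ← d₁_d₂, hd, map_zero, map_zero]
  have hd1g' : d₁ g' = 0 := by
    rw [hg', d₁_avg, d₁_avg, hd, map_zero, map_zero]
  have hsg : s₂₁ g = g' := by
    rw [hg, s₂₁_map, s₂₁_map, s₂₁_d₁, hs, map_zero, sub_zero]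
  have hsg' : s₁₂ g' = g := by
    rw [hg', s₁₂_map, s₁₂_map, s₁₂_d₂, hs', map_zero, sub_zero]
  have hEg : eulerB g + ((m : ℝ) + 1) • g = d₁ f := by rw [hg, eulerB_avg, hd1f]
  have hEg' : eulerB g' + ((m : ℝ) + 1) • g' = d₂ f := by rw [hg', eulerB_avg, hd2f]
  have e1 : d₂ (i₂ f) = T - i₂ (d₂ f) := by
    rw [eq_sub_iff_add_eq, d₂_i₂_add hf2, hf, eulerB_avg]
  have e2 : d₂ (i₂ (i₁ g)) = i₁ g + i₁ (d₁ f) - i₂ g' := by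
    have := d₂_i₂_add hg2.i₁
    rw [d₂_i₁, hd2g, map_zero, add_zero, hsg, eulerB_i₁, ← eq_sub_iff_add_eq] at this
    rw [this, ← hEg, map_add, map_smul]
    module
  have e3 : s₂₁ (i₂ f) = i₁ f := by rw [s₂₁_i₂, hsf, map_zero, sub_zero]
  have e4 : s₂₁ (i₂ (i₁ g)) = i₂ (i₁ g') := by
    rw [s₂₁_i₂, i₁_i₁ hg1, s₂₁_i₁ hg1, hsg, map_neg, zero_sub, neg_neg]
  have e5 : d₁ (i₁ f) = T - i₁ (d₁ f) := by
    rw [eq_sub_iff_add_eq, d₁_i₁_add hf1, hf, eulerB_avg]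
  have e6 : d₁ (i₁ g') = d₂ f := by
    have := d₁_i₁_add hg'1
    rwa [hd1g', map_zero, add_zero, hEg'] at this
  have e7 : d₁ (i₂ (i₁ g')) = i₂ g' - i₁ g + i₂ (d₂ f) := by
    rw [d₁_i₂, s₁₂_i₁, hsg', e6]
  rw [hS, map_add, map_add, map_add, e1, e2, e3, e4, e5, e7]
  module

end BiForm

end NComplex

namespace NComplex

/-! ### Biforms of the Young symmetry type -/

section SumIndices

open Equiv

variable {X V : Type*} {n₀ n₁ : ℕ}

/-- A biform, as a tensor whose indices are the cells of two columns. -/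
def sumTensor (B : (Fin n₀ → X) → (Fin n₁ → X) → V) (μ : Fin n₀ ⊕ Fin n₁ → X) : V :=
  B (fun i => μ (Sum.inl i)) fun i => μ (Sum.inr i)

theorem exists_sumCongr_of_mem_linePerms {σ : Perm (Fin n₀ ⊕ Fin n₁)}
    (hσ : σ ∈ linePerms Sum.isRight) :
    ∃ (σ₀ : Perm (Fin n₀)) (σ₁ : Perm (Fin n₁)), σ = Perm.sumCongr σ₀ σ₁ := by
  have h : Set.MapsTo σ (Set.range Sum.inl) (Set.range Sum.inl) := by
    rintro _ ⟨i, rfl⟩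
    have h1 := mem_linePerms.1 hσ (Sum.inl i)
    cases h2 : σ (Sum.inl i) with
    | inl k => exact ⟨k, rfl⟩
    | inr k => rw [h2] at h1; exact Bool.noConfusion h1
  obtain ⟨⟨σ₀, σ₁⟩, h⟩ := Perm.mem_sumCongrHom_range_of_perm_mapsTo_inl h
  exact ⟨σ₀, σ₁, h.symm⟩

theorem sumCongr_mem_linePerms (σ₀ : Perm (Fin n₀)) (σ₁ : Perm (Fin n₁)) :
    Perm.sumCongr σ₀ σ₁ ∈ linePerms (Sum.isRight : Fin n₀ ⊕ Fin n₁ → Bool) :=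
  mem_linePerms.2 fun x => by cases x <;> rfl

theorem sumTensor_comp_swap (B : (Fin n₀ → X) → (Fin n₁ → X) → V) (μ : Fin n₀ ⊕ Fin n₁ → X)
    (i : Fin n₀) (j : Fin n₁) : sumTensor B (μ ∘ swap (Sum.inl i) (Sum.inr j))
      = B (Function.update (fun i => μ (Sum.inl i)) i (μ (Sum.inr j)))
          (Function.update (fun j => μ (Sum.inr j)) j (μ (Sum.inl i))) := by
  unfold sumTensor
  congr 1
  · funext k
    by_cases h : k = i
    · subst h; simp
    · rw [Function.update_of_ne h, Function.comp_apply, swap_apply_of_ne_of_ne] <;> simp [h]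
  · funext k
    by_cases h : k = j
    · subst h; simp
    · rw [Function.update_of_ne h, Function.comp_apply, swap_apply_of_ne_of_ne] <;> simp [h]

variable [AddCommGroup V]

theorem sumTensor_alt {B : (Fin n₀ → X) → (Fin n₁ → X) → V}
    (h₁ : ∀ ν, IsAntisymm fun μ => B μ ν) (h₂ : ∀ μ, IsAntisymm (B μ))
    {σ : Perm (Fin n₀ ⊕ Fin n₁)} (hσ : σ ∈ linePerms Sum.isRight) (μ : Fin n₀ ⊕ Fin n₁ → X) :
    sumTensor B (μ ∘ σ) = (Perm.sign σ : ℤ) • sumTensor B μ := by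
  obtain ⟨σ₀, σ₁, rfl⟩ := exists_sumCongr_of_mem_linePerms hσ
  rw [Perm.sign_sumCongr, Units.val_mul, mul_smul]
  refine (h₁ (fun j => μ (Sum.inr (σ₁ j))) σ₀ fun i => μ (Sum.inl i)).trans ?_
  congr 1
  exact h₂ (fun i => μ (Sum.inl i)) σ₁ fun j => μ (Sum.inr j)

theorem sumTensor_alt_permsOn {B : (Fin n₀ → X) → (Fin n₁ → X) → V}
    (h₁ : ∀ ν, IsAntisymm fun μ => B μ ν) {σ : Perm (Fin n₀ ⊕ Fin n₁)}
    (hσ : σ ∈ permsOn (Finset.univ.filter fun x => Sum.isRight x = false))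
    (μ : Fin n₀ ⊕ Fin n₁ → X) :
    sumTensor B (μ ∘ σ) = (Perm.sign σ : ℤ) • sumTensor B μ := by
  obtain ⟨σ₀, σ₁, rfl⟩ := exists_sumCongr_of_mem_linePerms
    (permsOn_subset_linePerms (fun x hx => (Finset.mem_filter.1 hx).2) hσ)
  have h1 : σ₁ = 1 := by
    ext j
    by_contra hj
    have h2 := mem_permsOn.1 hσ (Sum.inr j) fun h => hj (by
      rw [Sum.inr_injective h]
      rfl)
    simp at h2
  rw [h1, Perm.sign_sumCongr, Perm.sign_one, mul_one]
  exact h₁ (fun j => μ (Sum.inr j)) σ₀ fun i => μ (Sum.inl i)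

theorem IsTwoCol.antisymm₁ {B : (Fin n₀ → X) → (Fin n₁ → X) → V}
    (h : IsTwoCol Sum.isRight (sumTensor B)) (ν : Fin n₁ → X) : IsAntisymm fun μ => B μ ν := by
  intro σ μ
  have := h.alt _ (sumCongr_mem_linePerms σ 1) (Sum.elim μ ν)
  rw [Perm.sign_sumCongr, Perm.sign_one, mul_one] at this
  exact this

theorem IsTwoCol.antisymm₂ {B : (Fin n₀ → X) → (Fin n₁ → X) → V}
    (h : IsTwoCol Sum.isRight (sumTensor B)) (μ : Fin n₀ → X) : IsAntisymm (B μ) := by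
  intro σ ν
  have := h.alt _ (sumCongr_mem_linePerms 1 σ) (Sum.elim μ ν)
  rw [Perm.sign_sumCongr, Perm.sign_one, one_mul] at this
  exact this

theorem sum_filter_isRight_false (f : Fin n₀ ⊕ Fin n₁ → V) :
    ∑ x with Sum.isRight x = false, f x = ∑ i, f (Sum.inl i) := by
  rw [Finset.sum_filter, Fintype.sum_sum_type]
  simp

theorem IsAntisymm.update_eq {n : ℕ} {F : (Fin (n + 1) → X) → V} (hF : IsAntisymm F)
    (μ : Fin (n + 1) → X) (i : Fin (n + 1)) (b : X) :
    F (Function.update μ i b) = (-1 : ℤ) ^ (i : ℕ) • F (Fin.cons b (i.removeNth μ)) := by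
  have h := Fin.cons_removeNth_eq_comp_cycleRange_symm (Function.update μ i b) i
  rw [Function.update_self, Fin.removeNth_update] at h
  rw [h, hF, ← Equiv.Perm.inv_def, Perm.sign_inv, Fin.sign_cycleRange, Units.val_pow_eq_pow_val,
    Units.val_neg, Units.val_one, smul_smul, ← pow_add, Even.neg_one_pow ⟨_, rfl⟩, one_smul]

/-- By antisymmetry, exchanging $b$ with each $\mu_i$ in turn is a wedge with its first term
missing. This translates the Bianchi relation into $s_{12}B=0$. -/
theorem sum_update_eq_wedge {B : (Fin (n₀ + 1) → X) → (Fin (n₁ + 1) → X) → V}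
    (h₁ : ∀ ν, IsAntisymm fun μ => B μ ν) (μ : Fin (n₀ + 1) → X) (b : X) (ν : Fin n₁ → X) :
    ∑ i, B (Function.update μ i b) (Fin.cons (μ i) ν)
      = B μ (Fin.cons b ν) - wedge (fun a ρ => B ρ (Fin.cons a ν)) (Fin.cons b μ) := by
  rw [wedge_cons, sub_sub_cancel]
  exact Finset.sum_congr rfl fun i _ => (h₁ _).update_eq μ i b

theorem IsTwoCol.wedge_eq_zero {B : (Fin (n₀ + 1) → X) → (Fin (n₁ + 1) → X) → V}
    (h : IsTwoCol Sum.isRight (sumTensor B)) (μ : Fin (n₀ + 2) → X) (ν : Fin n₁ → X) :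
    wedge (fun a ρ => B ρ (Fin.cons a ν)) μ = 0 := by
  have h1 := h.bianchi (Sum.inr 0) rfl (Sum.elim (Fin.tail μ) (Fin.cons (μ 0) ν))
  rw [sum_filter_isRight_false] at h1
  simp only [sumTensor_comp_swap] at h1
  simp only [Sum.elim_inl, Sum.elim_inr, Fin.cons_zero, Fin.update_cons_zero] at h1
  have h2 := sum_update_eq_wedge h.antisymm₁ (Fin.tail μ) (μ 0) ν
  rw [Fin.cons_self_tail] at h2
  rw [← sub_eq_self, ← h2]
  exact h1

/-- The hypothesis is the Bianchi relation at the first cell of the second column. Conjugating by a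
transposition inside that column carries it to any other cell, the two signs cancelling. -/
theorem isTwoCol_of_wedge_eq_zero {B : (Fin (n₀ + 1) → X) → (Fin (n₁ + 1) → X) → V}
    (h₁ : ∀ ν, IsAntisymm fun μ => B μ ν) (h₂ : ∀ μ, IsAntisymm (B μ))
    (hs : ∀ μ ν, wedge (fun a ρ => B ρ (Fin.cons a ν)) μ = 0) :
    IsTwoCol Sum.isRight (sumTensor B) where
  alt _ hσ μ := sumTensor_alt h₁ h₂ hσ μ
  bianchi j hj μ := by
    cases j with
    | inl j => exact Bool.noConfusion hj
    | inr j =>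
      have h0 : ∀ μ, ∑ i, sumTensor B (μ ∘ swap (Sum.inl i) (Sum.inr 0)) = sumTensor B μ := by
        intro μ
        have h2 := sum_update_eq_wedge h₁ (fun i => μ (Sum.inl i)) (μ (Sum.inr 0))
          (fun j => μ (Sum.inr j.succ))
        rw [hs, sub_zero] at h2
        have h3 : ∀ x : X, Function.update (fun j => μ (Sum.inr j)) 0 x
            = Fin.cons x fun j => μ (Sum.inr j.succ) := by
          intro x
          funext k
          refine Fin.cases ?_ (fun k => ?_) k <;> simp
        simp only [sumTensor_comp_swap, h3]
        rw [h2]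
        unfold sumTensor
        congr 1
        funext k
        refine Fin.cases ?_ (fun k => ?_) k <;> simp
      rw [sum_filter_isRight_false]
      by_cases hj0 : j = 0
      · rw [hj0]; exact h0 μ
      · have hs : swap (Sum.inr 0) (Sum.inr j) ∈
            linePerms (Sum.isRight : Fin (n₀ + 1) ⊕ Fin (n₁ + 1) → Bool) := swap_mem_linePerms rfl
        have hne : (Sum.inr 0 : Fin (n₀ + 1) ⊕ Fin (n₁ + 1)) ≠ Sum.inr j :=
          fun h => hj0 (Sum.inr_injective h).symm
        have halt : ∀ μ, sumTensor B (μ ∘ swap (Sum.inr 0) (Sum.inr j)) = -sumTensor B μ := by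
          intro μ
          rw [sumTensor_alt h₁ h₂ hs, Perm.sign_swap hne]
          simp
        have hconj : ∀ i : Fin (n₀ + 1), μ ∘ swap (Sum.inl i) (Sum.inr j)
            = ((μ ∘ swap (Sum.inr 0) (Sum.inr j)) ∘ swap (Sum.inl i) (Sum.inr 0))
              ∘ swap (Sum.inr 0) (Sum.inr j) := by
          intro i
          have : swap (Sum.inl i) (Sum.inr j) = swap (Sum.inr 0) (Sum.inr j) *
              swap (Sum.inl i) (Sum.inr 0) * swap (Sum.inr 0 : Fin (n₀ + 1) ⊕ Fin (n₁ + 1))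
                (Sum.inr j) := by
            rw [swap_mul_swap_mul_swap (by simp) (by simp), swap_comm]
          rw [this]
          rfl
        simp only [hconj, halt, Finset.sum_neg_distrib, h0, neg_neg]

theorem isTwoCol_of_right_empty {B : (Fin n₀ → X) → (Fin 0 → X) → V}
    (h₁ : ∀ ν, IsAntisymm fun μ => B μ ν) : IsTwoCol Sum.isRight (sumTensor B) where
  alt _ hσ μ := sumTensor_alt h₁ (fun _ => isAntisymm_of_le_one (by omega) _) hσ μ
  bianchi j hj _ := by
    cases j with
    | inl j => exact Bool.noConfusion hj
    | inr j => exact j.elim0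

/-- The relations in which an index of the first column is exchanged with all the indices of the
second one. -/
theorem IsTwoCol.wedge_eq_zero_of_not {B : (Fin (n₀ + 1) → X) → (Fin (n₁ + 1) → X) → V}
    (h : IsTwoCol (fun x => !Sum.isRight x) (sumTensor B)) (h₂ : ∀ μ, IsAntisymm (B μ))
    (μ : Fin n₀ → X) (ν : Fin (n₁ + 2) → X) : wedge (fun a ρ => B (Fin.cons a μ) ρ) ν = 0 := by
  have h1 := h.bianchi (Sum.inl 0) rfl (Sum.elim (Fin.cons (ν 0) μ) (Fin.tail ν))
  rw [Finset.sum_filter, Fintype.sum_sum_type] at h1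
  simp only [Sum.isRight_inl, Sum.isRight_inr, Bool.not_false, Bool.not_true, Bool.true_eq_false,
    if_false, if_true, Finset.sum_const_zero, zero_add, swap_comm (Sum.inr _) (Sum.inl _)] at h1
  simp only [sumTensor_comp_swap] at h1
  simp only [Sum.elim_inl, Sum.elim_inr, Fin.cons_zero, Fin.update_cons_zero] at h1
  have h2 := sum_update_eq_wedge (B := fun ν μ => B μ ν) h₂ (Fin.tail ν) (ν 0) μ
  rw [Fin.cons_self_tail] at h2
  rw [← sub_eq_self, ← h2]
  exact h1

end SumIndices

end NComplex

namespace NComplex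

open Equiv

/-! ### Mates in diagrams with two columns. -/

section Links

variable {X V : Type*}

theorem isMate_sumSwap (n : ℕ) :
    IsMate (Sum.isRight : Fin n ⊕ Fin n → Bool) Sum.swap where
  invol := Sum.swap_swap
  flip x _ := by cases x <;> rfl
  mated x _ := by cases x <;> simp

theorem isMate_sumSwap_not (n : ℕ) :
    IsMate (fun x : Fin n ⊕ Fin n => !Sum.isRight x) Sum.swap where
  invol := Sum.swap_swap
  flip x _ := by cases x <;> rfl
  mated x _ := by cases x <;> simp

/-- The cell in the same row, when the first column has one more cell. -/
def shiftMate (n : ℕ) : Fin (n + 1) ⊕ Fin n → Fin (n + 1) ⊕ Fin n :=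
  Sum.elim (Fin.cases (Sum.inl 0) Sum.inr) fun j => Sum.inl j.succ

theorem isMate_shiftMate (n : ℕ) : IsMate Sum.isRight (shiftMate n) where
  invol x := by
    rcases x with i | j
    · refine Fin.cases rfl (fun i => rfl) i
    · rfl
  flip x := by
    rcases x with i | j
    · refine Fin.cases (fun h => absurd rfl h) (fun i _ => rfl) i
    · exact fun _ => rfl
  mated x h := by
    rcases x with i | j
    · exact Bool.noConfusion h
    · exact Sum.inl_ne_inr

variable [AddCommGroup V]

theorem linePerms_not {ι : Type*} [Fintype ι] [DecidableEq ι] (line : ι → Bool) :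
    linePerms (fun x => !line x) = linePerms line := by
  ext σ
  simp [mem_linePerms]

/-- Columns of equal length play interchangeable roles, so the Bianchi relation also holds with the
columns exchanged. This is the source of $s_{21}=0$ in even degree. -/
theorem isTwoCol_youngLines_not [Module ℝ V] {n : ℕ} (A : (Fin n ⊕ Fin n → X) → V) :
    IsTwoCol (fun x => !Sum.isRight x) (youngLines Sum.isRight Sum.swap A) := by
  have h := isTwoCol_youngLines (isMate_sumSwap_not n) A
  unfold youngLines at h ⊢
  rwa [linePerms_not] at h

/-! ### The first half of the differential -/

theorem exists_liftPerm_of_apply_zero {n : ℕ} {σ : Perm (Fin (n + 1))} (h : σ 0 = 0) :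
    ∃ τ : Perm (Fin n), σ = liftPerm τ := by
  obtain ⟨⟨i, τ⟩, rfl⟩ := Perm.decomposeFin.symm.surjective σ
  rw [Perm.decomposeFin_symm_apply_zero] at h
  exact ⟨τ, by rw [h]; rfl⟩

/-- The head of the first column carries the operator and is left out of $C$, because the symmetries
of $B$ relate only the old cells. -/
theorem isTwoColOn_consFirst {n : ℕ} (O : X → V →+ V) {B : (Fin n → X) → (Fin n → X) → V}
    (hB : IsTwoCol Sum.isRight (sumTensor B)) :
    IsTwoColOn Sum.isRight (Finset.univ.image fun i : Fin n => (Sum.inl i.succ : Fin (n + 1) ⊕ Fin n))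
      (sumTensor fun (μ : Fin (n + 1) → X) ν => O (μ 0) (B (Fin.tail μ) ν)) where
  alt_first ρ hρ μ := by
    obtain ⟨σ₀, σ₁, rfl⟩ := exists_sumCongr_of_mem_linePerms
      (permsOn_subset_linePerms (line := Sum.isRight) (fun x hx => by
        obtain ⟨i, _, rfl⟩ := Finset.mem_image.1 hx
        rfl) hρ)
    have h1 : σ₁ = 1 := by
      ext j
      by_contra hj
      have h2 := mem_permsOn.1 hρ (Sum.inr j) fun h => hj (by
        rw [Sum.inr_injective h]
        rfl)
      simp at h2
    have h0 : σ₀ 0 = 0 := by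
      by_contra hj
      have h2 := mem_permsOn.1 hρ (Sum.inl 0) fun h => hj (Sum.inl_injective h)
      obtain ⟨i, _, h3⟩ := Finset.mem_image.1 h2
      exact Fin.succ_ne_zero i (Sum.inl_injective h3)
    obtain ⟨τ, rfl⟩ := exists_liftPerm_of_apply_zero h0
    rw [h1, Perm.sign_sumCongr, Perm.sign_one, mul_one, sign_liftPerm]
    have h3 := hB.antisymm₁ (fun j => μ (Sum.inr j)) τ (fun i => μ (Sum.inl i.succ))
    have h4 : Fin.tail (fun i => μ (Sum.inl (liftPerm τ i))) = (fun i => μ (Sum.inl i.succ)) ∘ τ := by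
      funext i
      rw [Fin.tail, liftPerm_succ]
      rfl
    change O (μ (Sum.inl (liftPerm τ 0))) (B (Fin.tail fun i => μ (Sum.inl (liftPerm τ i)))
      fun j => μ (Sum.inr j)) = _
    rw [h4, liftPerm_zero]
    exact (congrArg (O (μ (Sum.inl 0))) h3).trans (map_zsmul _ _ _)
  alt_second x y hx hy hxy μ := by
    cases x with
    | inl x => exact Bool.noConfusion hx
    | inr x =>
      cases y with
      | inl y => exact Bool.noConfusion hy
      | inr y =>
        have h3 := hB.antisymm₂ (fun i => μ (Sum.inl i.succ)) (swap x y) fun j => μ (Sum.inr j)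
        rw [Perm.sign_swap (fun h => hxy (congrArg Sum.inr h)), Units.val_neg, Units.val_one,
          neg_one_smul] at h3
        have h4 : (fun j => (μ ∘ swap (Sum.inr x) (Sum.inr y)) (Sum.inr j))
            = (fun j => μ (Sum.inr j)) ∘ swap x y := by
          funext j
          exact congrArg μ (Sum.inr_injective.swap_apply x y j)
        have h5 : (fun i => (μ ∘ swap (Sum.inr x) (Sum.inr y)) (Sum.inl i))
            = fun i => μ (Sum.inl i) := by
          funext i
          rw [Function.comp_apply, swap_apply_of_ne_of_ne] <;> simp
        unfold sumTensor
        rw [h4, h5, ← map_neg]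
        exact congrArg (O (μ (Sum.inl 0))) h3
  bianchi j hj μ := by
    cases j with
    | inl j => exact Bool.noConfusion hj
    | inr j =>
      have h := hB.bianchi (Sum.inr j) rfl (Sum.elim (fun i => μ (Sum.inl i.succ)) fun j => μ (Sum.inr j))
      rw [sum_filter_isRight_false] at h
      rw [Finset.sum_image fun _ _ _ _ h => Fin.succ_injective _ (Sum.inl_injective h)]
      simp only [sumTensor_comp_swap] at h ⊢
      have h2 : ∀ i : Fin n, Function.update (fun i => μ (Sum.inl i)) i.succ (μ (Sum.inr j)) 0
          = μ (Sum.inl 0) := fun i => Function.update_of_ne (Fin.succ_ne_zero i).symm _ _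
      simp only [h2, ← map_sum, Fin.tail_update_succ]
      exact congrArg (O (μ (Sum.inl 0))) h

/-- `exists_youngLines_eq_altLines` reduces the symmetrizer to antisymmetrization over the columns.
Each of the $n+1$ terms of the wedge differs from the original tensor by a signed line permutation,
so it antisymmetrizes to the same thing; and the wedge is already alternating. -/
theorem exists_youngLines_consFirst [Module ℝ V] (n : ℕ) : ∃ c : ℝ, c ≠ 0 ∧
    ∀ (O : X → V →+ V) (B : (Fin n → X) → (Fin n → X) → V), IsTwoCol Sum.isRight (sumTensor B) →
      youngLines Sum.isRight (shiftMate n)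
        (sumTensor fun (μ : Fin (n + 1) → X) ν => O (μ 0) (B (Fin.tail μ) ν))
        = c • sumTensor fun μ ν => wedge (fun a ρ => O a (B ρ ν)) μ := by
  obtain ⟨c, hc, h⟩ := exists_youngLines_eq_altLines (X := X) (V := V) (isMate_shiftMate n)
    (C := Finset.univ.image fun i : Fin n => (Sum.inl i.succ : Fin (n + 1) ⊕ Fin n))
    (fun x hx => by
      obtain ⟨i, _, rfl⟩ := Finset.mem_image.1 hx
      rfl)
    (fun j hj => by
      cases j with
      | inl j => exact Bool.noConfusion hj
      | inr j => exact Finset.mem_image.2 ⟨j, Finset.mem_univ _, rfl⟩)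
  set L := linePerms (Sum.isRight : Fin (n + 1) ⊕ Fin n → Bool) with hLdef
  have hL : (L.card : ℝ) ≠ 0 :=
    Nat.cast_ne_zero.2 (Finset.card_pos.2 ⟨1, mem_linePerms.2 fun _ => rfl⟩).ne'
  have hn : (((n + 1 : ℕ) : ℝ)) ≠ 0 := Nat.cast_ne_zero.2 (Nat.succ_ne_zero n)
  refine ⟨c * (((n + 1 : ℕ) : ℝ)⁻¹ * L.card), mul_ne_zero hc.ne' (mul_ne_zero (inv_ne_zero hn) hL),
    fun O B hB => ?_⟩
  funext μ
  rw [h _ (isTwoColOn_consFirst O hB), Pi.smul_apply, mul_smul]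
  congr 1
  rw [mul_smul, eq_inv_smul_iff₀ hn]
  set Z : (Fin (n + 1) ⊕ Fin n → X) → V :=
    sumTensor fun (μ : Fin (n + 1) → X) ν => O (μ 0) (B (Fin.tail μ) ν) with hZ
  set W : (Fin (n + 1) ⊕ Fin n → X) → V := sumTensor fun μ ν => wedge (fun a ρ => O a (B ρ ν)) μ
    with hW
  have hWZ : ∀ μ, W μ = ∑ i : Fin (n + 1),
      (Perm.sign (Perm.sumCongr i.cycleRange⁻¹ (1 : Perm (Fin n))) : ℤ) •
      Z (μ ∘ (Perm.sumCongr i.cycleRange⁻¹ 1 : Perm (Fin (n + 1) ⊕ Fin n))) := by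
    intro μ
    have h1 := wedge_cons_eq_sum_perm (fun ρ : Fin (n + 1) → X =>
      O (ρ 0) (B (Fin.tail ρ) fun j => μ (Sum.inr j))) (fun i => μ (Sum.inl i))
    refine h1.trans (Finset.sum_congr rfl fun i _ => ?_)
    rw [Perm.sign_sumCongr, Perm.sign_one, mul_one]
    rfl
  have hWalt : ∀ τ ∈ L, (Perm.sign τ : ℤ) • W (μ ∘ τ) = W μ := by
    intro τ hτ
    rw [hW, sumTensor_alt (fun ν => isAntisymm_wedge fun a => (hB.antisymm₁ ν).map (O a))
      (fun μ => IsAntisymm.sum (s := Finset.univ)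
        (F := fun (i : Fin (n + 1)) ν => (-1 : ℤ) ^ (i : ℕ) • O (μ i) (B (i.removeNth μ) ν))
        fun i => ((hB.antisymm₂ _).map (O (μ i))).map (zsmulAddGroupHom _)) hτ, smul_smul,
      sign_mul_sign_self, one_smul]
  rw [Nat.cast_smul_eq_nsmul, Nat.cast_smul_eq_nsmul, ← Finset.sum_const,
    ← Finset.sum_congr rfl hWalt]
  simp only [hWZ, Finset.smul_sum]
  rw [Finset.sum_comm]
  have h2 : ∀ i : Fin (n + 1), ∑ τ ∈ L, (Perm.sign τ : ℤ) •
      (Perm.sign (Perm.sumCongr i.cycleRange⁻¹ (1 : Perm (Fin n))) : ℤ) •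
        Z ((μ ∘ τ) ∘ (Perm.sumCongr i.cycleRange⁻¹ 1 : Perm (Fin (n + 1) ⊕ Fin n)))
      = ∑ τ ∈ L, (Perm.sign τ : ℤ) • Z (μ ∘ τ) := by
    intro i
    have h3 := sum_linePerms_comp (sumCongr_mem_linePerms i.cycleRange⁻¹ (1 : Perm (Fin n))) Z μ
    rw [← one_smul ℤ (∑ τ ∈ L, (Perm.sign τ : ℤ) • Z (μ ∘ τ)), ← sign_mul_sign_self
      (Perm.sumCongr i.cycleRange⁻¹ (1 : Perm (Fin n))), mul_smul, ← h3, Finset.smul_sum]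
    exact Finset.sum_congr rfl fun τ _ => smul_comm _ _ _
  rw [Finset.sum_congr rfl fun i _ => h2 i, Finset.sum_const, Finset.card_univ, Fintype.card_fin,
    Finset.smul_sum]

end Links

end NComplex

namespace NComplex

open Equiv

/-! ### Pairings with tensors that have the two-column symmetries. -/

section Pairing

variable {X : Type*} [Fintype X] {n : ℕ}

/-- By antisymmetry of $Q$ every term of the wedge pairs like the first one. -/
theorem sum_mul_wedge {Q : (Fin (n + 1) → X) → ℝ} (hQ : IsAntisymm Q)
    (g : X → (Fin n → X) → ℝ) :
    ∑ μ, Q μ * wedge g μ = ((n : ℝ) + 1) * ∑ μ, Q μ * g (μ 0) (Fin.tail μ) := by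
  have h : ∀ i : Fin (n + 1), ∑ μ, Q μ * ((Perm.sign i.cycleRange⁻¹ : ℤ) •
      (fun μ : Fin (n + 1) → X => g (μ 0) (Fin.tail μ)) (μ ∘ (i.cycleRange⁻¹ : Perm _)))
      = ∑ μ, Q μ * g (μ 0) (Fin.tail μ) := by
    intro i
    rw [← sum_comp_perm (i.cycleRange⁻¹ : Perm (Fin (n + 1)))
      (fun μ : Fin (n + 1) → X => Q μ * g (μ 0) (Fin.tail μ))]
    refine Finset.sum_congr rfl fun μ _ => ?_
    rw [hQ, mul_smul_comm, smul_mul_assoc]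
  have h2 : ∀ μ, wedge g μ = ∑ i : Fin (n + 1), (Perm.sign i.cycleRange⁻¹ : ℤ) •
      (fun μ : Fin (n + 1) → X => g (μ 0) (Fin.tail μ)) (μ ∘ (i.cycleRange⁻¹ : Perm _)) :=
    fun μ => wedge_cons_eq_sum_perm (fun μ : Fin (n + 1) → X => g (μ 0) (Fin.tail μ)) μ
  simp only [h2, Finset.mul_sum]
  rw [Finset.sum_comm]
  simp only [h]
  rw [Finset.sum_const, Finset.card_univ, Fintype.card_fin, ← Finset.mul_sum, nsmul_eq_mul]
  push_cast
  rfl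

theorem sum_sumTensor_mul {n₀ n₁ : ℕ} (Q Z : (Fin n₀ → X) → (Fin n₁ → X) → ℝ) :
    ∑ κ, sumTensor Q κ * sumTensor Z κ = ∑ μ, ∑ ν, Q μ ν * Z μ ν := by
  rw [← Fintype.sum_prod_type']
  exact Fintype.sum_equiv (Equiv.sumArrowEquivProdArrow _ _ _) _ _ fun _ => rfl

variable {Q : (Fin (n + 1) → X) → (Fin (n + 1) → X) → ℝ}
  {G : X → (Fin (n + 1) → X) → (Fin n → X) → ℝ}

/-- The Bianchi relation of $Q$ at the head of the second column, moved onto $G$ by a change of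
variables, exchanges the derivative index with the indices of the first column and produces a wedge
there. -/
theorem sum_mul_consSecond (hQ : IsTwoCol Sum.isRight (sumTensor Q))
    (hG : ∀ a ν, IsAntisymm fun μ => G a μ ν) :
    ∑ μ, ∑ ν, Q μ ν * G (ν 0) μ (Fin.tail ν) = ((n : ℝ) + 1) *
      ∑ ν, ∑ μ, Q μ ν * G (μ 0) (Fin.cons (ν 0) (Fin.tail μ)) (Fin.tail ν) := by
  have h0 : ∑ μ, ∑ ν, Q μ ν * G (ν 0) μ (Fin.tail ν)
      = ∑ μ, ∑ ν, Q μ ν * wedge (fun a ρ => G a (Fin.cons (ν 0) ρ) (Fin.tail ν)) μ := by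
    rw [← sum_sumTensor_mul Q fun μ ν => G (ν 0) μ (Fin.tail ν), ← sum_sumTensor_mul]
    have h1 : ∀ κ, sumTensor Q κ
        = ∑ i : Fin (n + 1), sumTensor Q (κ ∘ swap (Sum.inl i) (Sum.inr 0)) := by
      intro κ
      rw [← hQ.bianchi (Sum.inr 0) rfl κ, sum_filter_isRight_false]
    have h2 : ∀ i : Fin (n + 1),
        ∑ κ, sumTensor Q (κ ∘ swap (Sum.inl i) (Sum.inr 0))
          * sumTensor (fun μ ν => G (ν 0) μ (Fin.tail ν)) κ
        = ∑ κ : Fin (n + 1) ⊕ Fin (n + 1) → X, sumTensor Q κ *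
          sumTensor (fun μ ν => G (ν 0) μ (Fin.tail ν)) (κ ∘ swap (Sum.inl i) (Sum.inr 0)) := by
      intro i
      rw [← sum_comp_perm (swap (Sum.inl i) (Sum.inr 0) : Perm (Fin (n + 1) ⊕ Fin (n + 1)))]
      refine Finset.sum_congr rfl fun κ _ => ?_
      congr 2
      funext x
      simp
    have h3 : ∀ (i : Fin (n + 1)) (κ : Fin (n + 1) ⊕ Fin (n + 1) → X),
        sumTensor (fun μ ν => G (ν 0) μ (Fin.tail ν)) (κ ∘ swap (Sum.inl i) (Sum.inr 0))
        = (-1 : ℤ) ^ (i : ℕ) • G (κ (Sum.inl i))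
          (Fin.cons (κ (Sum.inr 0)) (i.removeNth fun i => κ (Sum.inl i)))
          (Fin.tail fun j => κ (Sum.inr j)) := by
      intro i κ
      rw [sumTensor_comp_swap, Function.update_self, Fin.tail_update_zero,
        (hG _ _).update_eq]
    calc _ = ∑ κ, ∑ i : Fin (n + 1), sumTensor Q (κ ∘ swap (Sum.inl i) (Sum.inr 0))
          * sumTensor (fun μ ν => G (ν 0) μ (Fin.tail ν)) κ := by
          refine Finset.sum_congr rfl fun κ _ => ?_
          rw [h1 κ, Finset.sum_mul]
      _ = _ := by
          rw [Finset.sum_comm, Finset.sum_congr rfl fun i _ => h2 i, Finset.sum_comm]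
          refine Finset.sum_congr rfl fun κ _ => ?_
          rw [← Finset.mul_sum]
          congr 1
          exact Finset.sum_congr rfl fun i _ => h3 i κ
  rw [h0, Finset.sum_comm, Finset.mul_sum]
  exact Finset.sum_congr rfl fun ν _ => sum_mul_wedge (hQ.antisymm₁ ν) _

theorem sum_mul_wedge_add (hQ : IsTwoCol Sum.isRight (sumTensor Q))
    (hG : ∀ a ν, IsAntisymm fun μ => G a μ ν) :
    ∑ μ, ∑ ν, Q μ ν * (wedge (fun b ρ => G b μ ρ) ν
      + wedge (fun a ρ => wedge (fun b ρ' => G a (Fin.cons b ρ) ρ') ν) μ)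
      = 2 * ((n : ℝ) + 1) * ∑ μ, ∑ ν, Q μ ν * G (ν 0) μ (Fin.tail ν) := by
  have h1 : ∑ μ, ∑ ν, Q μ ν * wedge (fun b ρ => G b μ ρ) ν
      = ((n : ℝ) + 1) * ∑ μ, ∑ ν, Q μ ν * G (ν 0) μ (Fin.tail ν) := by
    rw [Finset.mul_sum]
    exact Finset.sum_congr rfl fun μ _ => sum_mul_wedge (hQ.antisymm₂ μ) _
  have h2 : ∑ μ, ∑ ν, Q μ ν * wedge (fun a ρ => wedge (fun b ρ' => G a (Fin.cons b ρ) ρ') ν) μ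
      = ((n : ℝ) + 1) * ∑ μ, ∑ ν, Q μ ν * G (ν 0) μ (Fin.tail ν) := by
    rw [sum_mul_consSecond hQ hG, Finset.sum_comm,
      Finset.sum_congr rfl fun ν _ => sum_mul_wedge (hQ.antisymm₁ ν) _, ← Finset.mul_sum]
    congr 1
    rw [Finset.sum_comm, Finset.sum_congr rfl fun μ _ => sum_mul_wedge (hQ.antisymm₂ μ) _,
      ← Finset.mul_sum]
    congr 1
    exact Finset.sum_comm
  simp only [mul_add, Finset.sum_add_distrib]
  rw [h1, h2]
  ring

end Pairing

/-! ### The second half of the differential. -/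

section SecondLink

open SmoothFn BiForm

theorem IsTwoCol.map {ι X V W : Type*} [Fintype ι] [DecidableEq ι] [AddCommGroup V]
    [AddCommGroup W] {line : ι → Bool} {Q : (ι → X) → V} (hQ : IsTwoCol line Q) (φ : V →+ W) :
    IsTwoCol line fun μ => φ (Q μ) where
  alt σ hσ μ := by rw [hQ.alt σ hσ, map_zsmul]
  bianchi j hj μ := by rw [← map_sum, hQ.bianchi j hj]

theorem IsTwoCol.sub_smul {ι X : Type*} [Fintype ι] [DecidableEq ι] {line : ι → Bool}
    {P Q : (ι → X) → ℝ} (hP : IsTwoCol line P) (hQ : IsTwoCol line Q) (c : ℝ) :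
    IsTwoCol line fun μ => P μ - c * Q μ where
  alt σ hσ μ := by rw [hP.alt σ hσ, hQ.alt σ hσ, smul_sub, mul_smul_comm]
  bianchi j hj μ := by
    rw [Finset.sum_sub_distrib, ← Finset.mul_sum, hP.bianchi j hj, hQ.bianchi j hj]

variable {D : ℕ}

theorem map_youngLines {ι X V W : Type*} [Fintype ι] [DecidableEq ι] [AddCommGroup V]
    [AddCommGroup W] (line : ι → Bool) (θ : ι → ι) (A : (ι → X) → V) (φ : V →+ W) (μ : ι → X) :
    φ (youngLines line θ A μ) = youngLines line θ (fun μ => φ (A μ)) μ := by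
  simp only [youngLines, map_sum, map_zsmul]

/-- With the derivative at the head of the second column, the tensor is known to be antisymmetric
only in the first column, so the symmetrizer is computed weakly. The difference $R$ of the two sides
at a point has the two-column symmetries and is orthogonal to every tensor having them; pairing it
with itself gives $\sum R^2=0$. -/
theorem exists_youngLines_consSecond (D n : ℕ) : ∃ c : ℝ, c ≠ 0 ∧
    ∀ (S : BiForm D (n + 1) n) (W : BiForm D (n + 1) (n + 1)), Alt₁ S →
      IsTwoCol Sum.isRight (sumTensor W) → d₂ S + d₁ (s₂₁ S) = (2 : ℝ) • W →
      youngLines Sum.isRight Sum.swap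
        (sumTensor fun μ (ν : Fin (n + 1) → Fin D) => pd (ν 0) (S μ (Fin.tail ν)))
        = c • sumTensor W := by
  obtain ⟨c, hc, h⟩ := exists_sum_mul_youngLines (X := Fin D) (isMate_sumSwap (n + 1))
  have hn : ((n : ℝ) + 1) ≠ 0 := by positivity
  refine ⟨c * ((n : ℝ) + 1)⁻¹, mul_ne_zero hc.ne' (inv_ne_zero hn), fun S W hS hW hSW => ?_⟩
  funext κ
  refine SmoothFn.ext fun x => ?_
  set Z : BiForm D (n + 1) (n + 1) := fun μ ν => pd (ν 0) (S μ (Fin.tail ν)) with hZ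
  let φ : SmoothFn D →+ ℝ := (eval x).toAddMonoidHom
  have hWx : IsTwoCol Sum.isRight (sumTensor fun μ ν => φ (W μ ν)) := hW.map φ
  have hYx := isTwoCol_youngLines (isMate_sumSwap (n + 1)) (sumTensor fun μ ν => φ (Z μ ν))
  have hZalt : ∀ ν, IsAntisymm fun μ => φ (Z μ ν) := fun ν => ((hS _).map (pd (ν 0))).map φ
  set R := fun κ => youngLines Sum.isRight Sum.swap (sumTensor fun μ ν => φ (Z μ ν)) κ
    - (c * ((n : ℝ) + 1)⁻¹) * sumTensor (fun μ ν => φ (W μ ν)) κ with hRdef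
  have hR : IsTwoCol Sum.isRight R := hYx.sub_smul hWx _
  have hpair : ∀ Q : (Fin (n + 1) → Fin D) → (Fin (n + 1) → Fin D) → ℝ,
      IsTwoCol Sum.isRight (sumTensor Q) → ∑ κ, sumTensor Q κ * R κ = 0 := by
    intro Q hQ
    have h1 := h (sumTensor Q) (sumTensor fun μ ν => φ (Z μ ν)) hQ
      (fun ρ hρ μ => sumTensor_alt_permsOn hZalt hρ μ)
    have h2 := sum_mul_wedge_add (G := fun a μ ν => φ (pd a (S μ ν))) hQ
      (fun a ν => ((hS ν).map (pd a)).map φ)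
    have h3 : ∀ μ ν, wedge (fun b ρ => φ (pd b (S μ ρ))) ν
        + wedge (fun a ρ => wedge (fun b ρ' => φ (pd a (S (Fin.cons b ρ) ρ'))) ν) μ
        = 2 * φ (W μ ν) := by
      intro μ ν
      have h4 := congrArg φ (congrFun (congrFun hSW μ) ν)
      rw [Pi.add_apply, Pi.add_apply, map_add, d₂_apply, d₁_apply, map_wedge, map_wedge] at h4
      simp only [s₂₁_apply, map_wedge] at h4
      rw [h4]
      exact (eval x).map_smul 2 (W μ ν)
    simp only [h3] at h2
    rw [sum_sumTensor_mul Q fun μ ν => φ (Z μ ν)] at h1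
    simp only [hRdef, mul_sub, Finset.sum_sub_distrib]
    rw [h1, sub_eq_zero]
    have h5 : ∑ κ, sumTensor Q κ * (c * ((n : ℝ) + 1)⁻¹ * sumTensor (fun μ ν => φ (W μ ν)) κ)
        = c * ((n : ℝ) + 1)⁻¹ * ∑ μ, ∑ ν, Q μ ν * φ (W μ ν) := by
      rw [← sum_sumTensor_mul Q fun μ ν => φ (W μ ν), Finset.mul_sum]
      exact Finset.sum_congr rfl fun κ _ => by ring
    have h6 : ∑ μ, ∑ ν, Q μ ν * (2 * φ (W μ ν)) = 2 * ∑ μ, ∑ ν, Q μ ν * φ (W μ ν) := by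
      simp only [Finset.mul_sum]
      exact Finset.sum_congr rfl fun μ _ => Finset.sum_congr rfl fun ν _ => by ring
    rw [h6] at h2
    rw [h5]
    have h7 : ∑ μ, ∑ ν, Q μ ν * φ (W μ ν)
        = ((n : ℝ) + 1) * ∑ μ, ∑ ν, Q μ ν * φ (pd (ν 0) (S μ (Fin.tail ν))) := by
      linear_combination h2 / 2
    rw [h7]
    field_simp
    rfl
  have hRsum : R = sumTensor fun μ ν => R (Sum.elim μ ν) := by
    funext κ
    refine congrArg R (funext fun x => ?_)
    cases x <;> rfl
  have h0 := hpair (fun μ ν => R (Sum.elim μ ν)) (hRsum ▸ hR)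
  rw [← hRsum] at h0
  have h1 := (Finset.sum_eq_zero_iff_of_nonneg fun κ _ => mul_self_nonneg (R κ)).1 h0 κ
    (Finset.mem_univ κ)
  have h2 := mul_self_eq_zero.1 h1
  rw [hRdef, sub_eq_zero] at h2
  change φ (youngLines Sum.isRight Sum.swap (sumTensor Z) κ)
    = φ ((c * ((n : ℝ) + 1)⁻¹) • sumTensor W κ)
  rw [map_youngLines]
  exact h2.trans ((eval x).map_smul _ _).symm

end SecondLink

end NComplex

namespace NComplex

open Equiv SmoothFn BiForm

/-! ### The slots of the diagrams with two columns -/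

/-- The slots of the diagram with two columns of length `n`. -/
def evenSlots (n : ℕ) : Fin n ⊕ Fin n ≃ Fin (2 * n) where
  toFun := Sum.elim (fun i => ⟨2 * i.1 + 1, by omega⟩) fun i => ⟨2 * i.1, by omega⟩
  invFun k := if k.1 % 2 = 0 then Sum.inr ⟨k.1 / 2, by omega⟩ else Sum.inl ⟨k.1 / 2, by omega⟩
  left_inv x := by
    rcases x with i | i
    · exact (if_neg (show ¬(2 * i.1 + 1) % 2 = 0 by omega)).trans
        (congrArg Sum.inl (Fin.ext (show (2 * i.1 + 1) / 2 = i.1 by omega)))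
    · exact (if_pos (show 2 * i.1 % 2 = 0 by omega)).trans
        (congrArg Sum.inr (Fin.ext (show 2 * i.1 / 2 = i.1 by omega)))
  right_inv k := by
    by_cases h : k.1 % 2 = 0
    · simp only [if_pos h, Sum.elim_inr]
      exact Fin.ext (by simp only; omega)
    · simp only [if_neg h, Sum.elim_inl]
      exact Fin.ext (by simp only; omega)

/-- The slots of the diagram with two columns of lengths `n + 1` and `n`. -/
def oddSlots (n : ℕ) : Fin (n + 1) ⊕ Fin n ≃ Fin (2 * n + 1) where
  toFun := Sum.elim (fun i => ⟨2 * i.1, by omega⟩) fun i => ⟨2 * i.1 + 1, by omega⟩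
  invFun k := if h : k.1 % 2 = 0 then Sum.inl ⟨k.1 / 2, by omega⟩
    else Sum.inr ⟨k.1 / 2, by omega⟩
  left_inv x := by
    rcases x with i | i
    · exact (dif_pos (show 2 * i.1 % 2 = 0 by omega)).trans
        (congrArg Sum.inl (Fin.ext (show 2 * i.1 / 2 = i.1 by omega)))
    · exact (dif_neg (show ¬(2 * i.1 + 1) % 2 = 0 by omega)).trans
        (congrArg Sum.inr (Fin.ext (show (2 * i.1 + 1) / 2 = i.1 by omega)))
  right_inv k := by
    by_cases h : k.1 % 2 = 0
    · simp only [dif_pos h, Sum.elim_inl]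
      exact Fin.ext (by simp only; omega)
    · simp only [dif_neg h, Sum.elim_inr]
      exact Fin.ext (by simp only; omega)

theorem colOf_evenSlots {n : ℕ} (x : Fin n ⊕ Fin n) :
    colOf 3 (evenSlots n x) = if Sum.isRight x = true then 1 else 0 := by
  rcases x with i | i <;> simp [colOf, evenSlots, Fin.val_rev] <;> omega

theorem rowOf_evenSlots {n : ℕ} (x : Fin n ⊕ Fin n) :
    rowOf 3 (evenSlots n x) = n - 1 - Sum.elim Fin.val Fin.val x := by
  rcases x with i | i <;> simp [rowOf, evenSlots, Fin.val_rev] <;> omega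

theorem colOf_oddSlots {n : ℕ} (x : Fin (n + 1) ⊕ Fin n) :
    colOf 3 (oddSlots n x) = if Sum.isRight x = true then 1 else 0 := by
  rcases x with i | i <;> simp [colOf, oddSlots, Fin.val_rev] <;> omega

theorem rowOf_oddSlots {n : ℕ} (x : Fin (n + 1) ⊕ Fin n) :
    rowOf 3 (oddSlots n x) = n - Sum.elim Fin.val (fun i => i.1 + 1) x := by
  rcases x with i | i <;> simp [rowOf, oddSlots, Fin.val_rev] <;> omega

theorem rowOf_evenSlots_eq_iff {n : ℕ} (x y : Fin n ⊕ Fin n) :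
    rowOf 3 (evenSlots n x) = rowOf 3 (evenSlots n y) ↔ x = y ∨ x = Sum.swap y := by
  rw [rowOf_evenSlots, rowOf_evenSlots]
  have h : ∀ i j : Fin n, n - 1 - i.1 = n - 1 - j.1 ↔ i = j := by
    intro i j
    rw [Fin.ext_iff]
    omega
  rcases x with i | i <;> rcases y with j | j <;> simp [h]

theorem rowOf_oddSlots_eq_iff {n : ℕ} (x y : Fin (n + 1) ⊕ Fin n) :
    rowOf 3 (oddSlots n x) = rowOf 3 (oddSlots n y) ↔ x = y ∨ x = shiftMate n y := by
  rw [rowOf_oddSlots, rowOf_oddSlots]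
  have h : ∀ i j : ℕ, i ≤ n → j ≤ n → (n - i = n - j ↔ i = j) := by omega
  rcases x with i | i <;> rcases y with j | j
  · rw [Sum.elim_inl, Sum.elim_inl, h _ _ (by omega) (by omega), ← Fin.ext_iff]
    cases j using Fin.cases <;> simp [shiftMate]
  · rw [Sum.elim_inl, Sum.elim_inr, h _ _ (by omega) (by omega)]
    simp [shiftMate, Fin.ext_iff]
  · rw [Sum.elim_inl, Sum.elim_inr, h _ _ (by omega) (by omega)]
    cases j using Fin.cases <;> simp [shiftMate, Fin.ext_iff]
  · rw [Sum.elim_inr, Sum.elim_inr, h _ _ (by omega) (by omega)]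
    simp [shiftMate, Fin.ext_iff]

theorem youngSum_comp_equiv {ι X V : Type*} [Fintype ι] [DecidableEq ι] [AddCommGroup V] {p : ℕ}
    {line : ι → Bool} {θ : ι → ι} (e : ι ≃ Fin p)
    (hcol : ∀ x y, colOf 3 (e x) = colOf 3 (e y) ↔ line x = line y)
    (hrow : ∀ x y, rowOf 3 (e x) = rowOf 3 (e y) ↔ x = y ∨ x = θ y)
    (A : (Fin p → X) → V) (μ : ι → X) :
    youngSum 3 A (μ ∘ e.symm) = youngLines line θ (fun μ => A (μ ∘ e.symm)) μ := by
  unfold youngSum youngLines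
  symm
  have hcomp : ∀ (μ : ι → X) (τ : Perm ι), (μ ∘ e.symm) ∘ e.permCongr τ = (μ ∘ τ) ∘ e.symm := by
    intro μ τ
    funext k
    simp [Equiv.permCongr_apply]
  have hmem : ∀ (P : Fin p → Fin p → Prop) (R : ι → ι → Prop) (_ : ∀ x y, P (e x) (e y) ↔ R x y)
      (τ : Perm ι), (∀ k, P (e.permCongr τ k) k) ↔ ∀ x, R (τ x) x := by
    intro P R hPR τ
    rw [← e.forall_congr_right]
    refine forall_congr' fun x => ?_
    rw [Equiv.permCongr_apply, e.symm_apply_apply, hPR]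
  have hL : ∀ τ : Perm ι, e.permCongr τ ∈ colPerms 3 p ↔ τ ∈ linePerms line := by
    intro τ
    rw [mem_linePerms, colPerms, Finset.mem_filter]
    simp only [Finset.mem_univ, true_and]
    exact hmem (fun j k => colOf 3 j = colOf 3 k) _ hcol τ
  have hE : ∀ τ : Perm ι, e.permCongr τ ∈ rowPerms 3 p ↔ τ ∈ exchPerms θ := by
    intro τ
    rw [mem_exchPerms, rowPerms, Finset.mem_filter]
    simp only [Finset.mem_univ, true_and]
    exact hmem (fun j k => rowOf 3 j = rowOf 3 k) _ hrow τ
  refine Finset.sum_equiv e.permCongr (fun τ => (hL τ).symm) fun τ _ => ?_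
  rw [Perm.sign_permCongr]
  congr 1
  refine Finset.sum_equiv e.permCongr (fun τ => (hE τ).symm) fun σ _ => ?_
  rw [hcomp, hcomp]

section

variable {X V : Type*} [AddCommGroup V]

theorem youngSum_evenSlots {n : ℕ} (A : (Fin (2 * n) → X) → V) (μ : Fin n ⊕ Fin n → X) :
    youngSum 3 A (μ ∘ (evenSlots n).symm)
      = youngLines Sum.isRight Sum.swap (fun μ => A (μ ∘ (evenSlots n).symm)) μ :=
  youngSum_comp_equiv _ (fun x y => by
    rw [colOf_evenSlots, colOf_evenSlots]
    cases Sum.isRight x <;> cases Sum.isRight y <;> simp) rowOf_evenSlots_eq_iff A μ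

theorem youngSum_oddSlots {n : ℕ} (A : (Fin (2 * n + 1) → X) → V)
    (μ : Fin (n + 1) ⊕ Fin n → X) : youngSum 3 A (μ ∘ (oddSlots n).symm)
      = youngLines Sum.isRight (shiftMate n) (fun μ => A (μ ∘ (oddSlots n).symm)) μ :=
  youngSum_comp_equiv _ (fun x y => by
    rw [colOf_oddSlots, colOf_oddSlots]
    cases Sum.isRight x <;> cases Sum.isRight y <;> simp) rowOf_oddSlots_eq_iff A μ

end

/-- A tensor field, with its indices distributed over two columns. -/
def toBiForm {D p n₀ n₁ : ℕ} (e : Fin n₀ ⊕ Fin n₁ ≃ Fin p) :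
    TField D p ≃ₗ[ℝ] BiForm D n₀ n₁ where
  toFun T μ ν := T (Sum.elim μ ν ∘ e.symm)
  invFun B κ := B (fun i => κ (e (Sum.inl i))) fun j => κ (e (Sum.inr j))
  map_add' _ _ := rfl
  map_smul' _ _ := rfl
  left_inv T := by
    funext κ
    refine congrArg T (funext fun k => ?_)
    obtain ⟨x, rfl⟩ := e.surjective k
    rw [Function.comp_apply, e.symm_apply_apply]
    cases x <;> rfl
  right_inv B := by
    funext μ ν
    simp

theorem sumTensor_toBiForm {D p n₀ n₁ : ℕ} (e : Fin n₀ ⊕ Fin n₁ ≃ Fin p) (T : TField D p)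
    (μ : Fin n₀ ⊕ Fin n₁ → Fin D) : sumTensor (toBiForm e T) μ = T (μ ∘ e.symm) := by
  refine congrArg T (funext fun k => ?_)
  cases h : e.symm k <;> simp [h]

theorem sumTensor_injective {X V : Type*} {n₀ n₁ : ℕ} :
    Function.Injective (sumTensor : ((Fin n₀ → X) → (Fin n₁ → X) → V) → _) := by
  intro A B h
  funext μ ν
  exact congrFun h (Sum.elim μ ν)

variable {D n : ℕ}

/-- The new slot $0$ heads the first column and the other slots shift by one, which is why
`evenSlots` and `oddSlots` give the first column opposite parities. -/
theorem toBiForm_dT_evenSlots (T : TField D (2 * n)) :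
    toBiForm (oddSlots n) (dT T)
      = fun μ ν => pd (μ 0) (toBiForm (evenSlots n) T (Fin.tail μ) ν) := by
  funext μ ν
  have h0 : (oddSlots n).symm 0 = Sum.inl 0 := (Equiv.symm_apply_eq _).2 rfl
  have h1 : Fin.tail (Sum.elim μ ν ∘ (oddSlots n).symm)
      = Sum.elim (Fin.tail μ) ν ∘ (evenSlots n).symm := by
    funext k
    obtain ⟨x, rfl⟩ := (evenSlots n).surjective k
    rw [Function.comp_apply, Equiv.symm_apply_apply]
    cases x with
    | inl i =>
      have : (evenSlots n (Sum.inl i)).succ = oddSlots n (Sum.inl i.succ) := rfl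
      rw [Fin.tail, this, Function.comp_apply, Equiv.symm_apply_apply]
      rfl
    | inr i =>
      have : (evenSlots n (Sum.inr i)).succ = oddSlots n (Sum.inr i) := rfl
      rw [Fin.tail, this, Function.comp_apply, Equiv.symm_apply_apply]
      rfl
  change pd ((Sum.elim μ ν ∘ (oddSlots n).symm) 0)
    (T (Fin.tail (Sum.elim μ ν ∘ (oddSlots n).symm))) = _
  rw [h1, Function.comp_apply, h0]
  rfl

theorem toBiForm_dT_oddSlots (T : TField D (2 * n + 1)) :
    toBiForm (evenSlots (n + 1)) (dT T)
      = fun μ ν => pd (ν 0) (toBiForm (oddSlots n) T μ (Fin.tail ν)) := by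
  funext μ ν
  have h0 : (evenSlots (n + 1)).symm 0 = Sum.inr 0 :=
    (Equiv.symm_apply_eq _).2 rfl
  have h1 : Fin.tail (Sum.elim μ ν ∘ (evenSlots (n + 1)).symm)
      = Sum.elim μ (Fin.tail ν) ∘ (oddSlots n).symm := by
    funext k
    obtain ⟨x, rfl⟩ := (oddSlots n).surjective k
    rw [Function.comp_apply, Equiv.symm_apply_apply]
    cases x with
    | inl i =>
      have : (oddSlots n (Sum.inl i)).succ = evenSlots (n + 1) (Sum.inl i) := rfl
      rw [Fin.tail, this, Function.comp_apply, Equiv.symm_apply_apply]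
      rfl
    | inr i =>
      have : (oddSlots n (Sum.inr i)).succ = evenSlots (n + 1) (Sum.inr i.succ) := rfl
      rw [Fin.tail, this, Function.comp_apply, Equiv.symm_apply_apply]
      rfl
  change pd ((Sum.elim μ ν ∘ (evenSlots (n + 1)).symm) 0)
    (T (Fin.tail (Sum.elim μ ν ∘ (evenSlots (n + 1)).symm))) = _
  rw [h1, Function.comp_apply, h0]
  rfl

end NComplex

namespace NComplex

open Equiv SmoothFn BiForm

/-! ### Complexes of diagrams with two columns -/

theorem isTwoCol_of_eval {ι X : Type*} [Fintype ι] [DecidableEq ι] {D : ℕ} {line : ι → Bool}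
    {Q : (ι → X) → SmoothFn D} (h : ∀ x, IsTwoCol line fun μ => eval x (Q μ)) :
    IsTwoCol line Q where
  alt σ hσ μ := SmoothFn.ext fun x =>
    ((h x).alt σ hσ μ).trans (map_zsmul (eval x) _ _).symm
  bianchi j hj μ := SmoothFn.ext fun x =>
    (map_sum (eval x) _ _).trans ((h x).bianchi j hj μ)

variable {D n : ℕ}

/-- The components of a field of even degree, as a biform. -/
noncomputable def evenForm (n : ℕ) (T : Omega 3 D (2 * n)) : BiForm D n n :=
  toBiForm (evenSlots n) (comp T)

/-- The components of a field of odd degree, as a biform. -/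
noncomputable def oddForm (n : ℕ) (T : Omega 3 D (2 * n + 1)) : BiForm D (n + 1) n :=
  toBiForm (oddSlots n) (comp T)

theorem evenForm_injective : Function.Injective (evenForm (D := D) n) :=
  (toBiForm (evenSlots n)).injective.comp comp_injective

theorem evenForm_smul (r : ℝ) (T : Omega 3 D (2 * n)) : evenForm n (r • T) = r • evenForm n T := rfl

theorem sumTensor_evenForm (T : Omega 3 D (2 * n)) (x : Fin D → ℝ) :
    ∃ A : Tensor D (2 * n), (fun μ => eval x (sumTensor (evenForm n T) μ))
      = youngLines Sum.isRight Sum.swap fun μ => A (μ ∘ (evenSlots n).symm) := by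
  obtain ⟨A, hA⟩ := exists_eval_comp T x
  refine ⟨A, funext fun μ => ?_⟩
  rw [evenForm, sumTensor_toBiForm, hA, youngSum_evenSlots]

theorem isTwoCol_evenForm (T : Omega 3 D (2 * n)) :
    IsTwoCol Sum.isRight (sumTensor (evenForm n T)) := by
  refine isTwoCol_of_eval fun x => ?_
  obtain ⟨A, hA⟩ := sumTensor_evenForm T x
  rw [hA]
  exact isTwoCol_youngLines (isMate_sumSwap n) _

theorem isTwoCol_not_evenForm (T : Omega 3 D (2 * n)) :
    IsTwoCol (fun x => !Sum.isRight x) (sumTensor (evenForm n T)) := by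
  refine isTwoCol_of_eval fun x => ?_
  obtain ⟨A, hA⟩ := sumTensor_evenForm T x
  rw [hA]
  exact isTwoCol_youngLines_not _

theorem exists_evenForm_eq {U : BiForm D n n} (hU : IsTwoCol Sum.isRight (sumTensor U)) :
    ∃ T : Omega 3 D (2 * n), evenForm n T = U := by
  obtain ⟨c, hc, h⟩ := exists_youngLines_eq_smul (X := Fin D) (V := SmoothFn D) (isMate_sumSwap n)
  obtain ⟨T, hT⟩ := exists_comp_eq_of_youngSum (N := 3) (A := (toBiForm (evenSlots n)).symm U)
    hc.ne' (by
      refine (toBiForm (evenSlots n)).injective (sumTensor_injective ?_)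
      funext μ
      rw [sumTensor_toBiForm, youngSum_evenSlots, map_smul, LinearEquiv.apply_symm_apply]
      simp only [← sumTensor_toBiForm]
      rw [LinearEquiv.apply_symm_apply, h _ hU]
      rfl)
  exact ⟨T, by rw [evenForm, hT, LinearEquiv.apply_symm_apply]⟩

theorem exists_oddForm_eq {U : BiForm D (n + 1) n} (hU : IsTwoCol Sum.isRight (sumTensor U)) :
    ∃ T : Omega 3 D (2 * n + 1), oddForm n T = U := by
  obtain ⟨c, hc, h⟩ := exists_youngLines_eq_smul (X := Fin D) (V := SmoothFn D) (isMate_shiftMate n)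
  obtain ⟨T, hT⟩ := exists_comp_eq_of_youngSum (N := 3) (A := (toBiForm (oddSlots n)).symm U)
    hc.ne' (by
      refine (toBiForm (oddSlots n)).injective (sumTensor_injective ?_)
      funext μ
      rw [sumTensor_toBiForm, youngSum_oddSlots, map_smul, LinearEquiv.apply_symm_apply]
      simp only [← sumTensor_toBiForm]
      rw [LinearEquiv.apply_symm_apply, h _ hU]
      rfl)
  exact ⟨T, by rw [oddForm, hT, LinearEquiv.apply_symm_apply]⟩

theorem exists_oddForm_dOmega (D n : ℕ) : ∃ c : ℝ, c ≠ 0 ∧ ∀ T : Omega 3 D (2 * n),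
    oddForm n (dOmega 3 D (2 * n) T) = c • d₁ (evenForm n T) := by
  obtain ⟨c, hc, h⟩ := exists_youngLines_consFirst (X := Fin D) (V := SmoothFn D) n
  refine ⟨(hookProd 3 (2 * n + 1))⁻¹ * c, mul_ne_zero (inv_ne_zero (hookProd_ne_zero _ _)) hc,
    fun T => ?_⟩
  rw [oddForm, comp_dOmega, map_smul, mul_smul]
  congr 1
  refine sumTensor_injective (funext fun μ => ?_)
  rw [sumTensor_toBiForm, youngSum_oddSlots]
  simp only [← sumTensor_toBiForm]
  rw [toBiForm_dT_evenSlots]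
  exact congrFun (h (fun a => (pd a).toAddMonoidHom) (evenForm n T) (isTwoCol_evenForm T)) μ

theorem exists_evenForm_dOmega (D n : ℕ) : ∃ c : ℝ, c ≠ 0 ∧
    ∀ (S : Omega 3 D (2 * n + 1)) (W : BiForm D (n + 1) (n + 1)), Alt₁ (oddForm n S) →
      IsTwoCol Sum.isRight (sumTensor W) →
      d₂ (oddForm n S) + d₁ (s₂₁ (oddForm n S)) = (2 : ℝ) • W →
      evenForm (n + 1) (dOmega 3 D (2 * n + 1) S) = c • W := by
  obtain ⟨c, hc, h⟩ := exists_youngLines_consSecond D n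
  refine ⟨(hookProd 3 (2 * n + 1 + 1))⁻¹ * c,
    mul_ne_zero (inv_ne_zero (hookProd_ne_zero _ _)) hc, fun S W hS hW hSW => ?_⟩
  have h0 : comp (dOmega 3 D (2 * n + 1) S)
      = (hookProd 3 (2 * n + 1 + 1))⁻¹ • youngSum 3 (dT (comp S)) := comp_dOmega S
  refine (congrArg (toBiForm (evenSlots (n + 1))) h0).trans ?_
  rw [mul_smul]
  refine (map_smul (toBiForm (evenSlots (n + 1))) _ _).trans (congrArg _ ?_)
  refine sumTensor_injective (funext fun μ => ?_)
  refine (sumTensor_toBiForm _ _ _).trans ((youngSum_evenSlots (n := n + 1) _ μ).trans ?_)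
  have h1 : (fun μ => dT (comp S) (μ ∘ (evenSlots (n + 1)).symm))
      = sumTensor (toBiForm (evenSlots (n + 1)) (dT (comp S))) :=
    funext fun μ => (sumTensor_toBiForm (evenSlots (n + 1)) _ μ).symm
  refine (congrArg (fun Z => youngLines Sum.isRight Sum.swap Z μ)
    (h1.trans (congrArg sumTensor (toBiForm_dT_oddSlots (comp S))))).trans ?_
  exact congrFun (h (oddForm n S) W hS hW hSW) μ

theorem alt₁_evenForm (T : Omega 3 D (2 * n)) : Alt₁ (evenForm n T) :=
  fun ν => (isTwoCol_evenForm T).antisymm₁ ν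

theorem alt₂_evenForm (T : Omega 3 D (2 * n)) : Alt₂ (evenForm n T) :=
  fun μ => (isTwoCol_evenForm T).antisymm₂ μ

theorem s₁₂_evenForm (T : Omega 3 D (2 * (n + 1))) : s₁₂ (evenForm (n + 1) T) = 0 :=
  funext fun μ => funext fun ν => (isTwoCol_evenForm T).wedge_eq_zero μ ν

theorem s₂₁_evenForm (T : Omega 3 D (2 * (n + 1))) : s₂₁ (evenForm (n + 1) T) = 0 :=
  funext fun μ => funext fun ν =>
    (isTwoCol_not_evenForm T).wedge_eq_zero_of_not (alt₂_evenForm T) μ ν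

theorem isTwoCol_of_s₁₂_eq_zero {n₀ n₁ : ℕ} {B : BiForm D (n₀ + 1) (n₁ + 1)} (h1 : Alt₁ B)
    (h2 : Alt₂ B) (hs : s₁₂ B = 0) : IsTwoCol Sum.isRight (sumTensor B) :=
  isTwoCol_of_wedge_eq_zero h1 h2 fun μ ν => congrFun (congrFun hs μ) ν

/-- Moving $s_{12}$ to the right leaves only $d_1d_1B$, which vanishes. -/
theorem isTwoCol_d₁_d₂ {B : BiForm D (n + 1) (n + 1)} (h1 : Alt₁ B) (h2 : Alt₂ B)
    (hs : s₁₂ B = 0) : IsTwoCol Sum.isRight (sumTensor (d₁ (d₂ B))) :=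
  isTwoCol_of_s₁₂_eq_zero h1.d₂.d₁ h2.d₂.d₁ (by
    rw [s₁₂_d₁, s₁₂_d₂, hs, map_zero, sub_zero, d₁_d₁, neg_zero])

theorem dOmega_inv_smul {c : ℝ} (hc : c ≠ 0) {S : Omega 3 D (2 * n + 1)}
    {T : Omega 3 D (2 * (n + 1))}
    (h : evenForm (n + 1) (dOmega 3 D (2 * n + 1) S) = c • evenForm (n + 1) T) :
    dOmega 3 D (2 * n + 1) (c⁻¹ • S) = T := by
  have h1 : dOmega 3 D (2 * n + 1) S = c • T := evenForm_injective (n := n + 1) h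
  rw [map_smul, h1, smul_smul, inv_mul_cancel₀ hc, one_smul]

/-- A form of even degree at least four which is closed is a second derivative. -/
theorem exists_dOmega_dOmega_eq (T : Omega 3 D (2 * (n + 2)))
    (hT : dOmega 3 D (2 * (n + 2)) T = 0) : ∃ V : Omega 3 D (2 * (n + 1)),
      dOmega 3 D (2 * (n + 1) + 1) (dOmega 3 D (2 * (n + 1)) V) = T := by
  obtain ⟨a, ha, hodd⟩ := exists_oddForm_dOmega D (n + 2)
  obtain ⟨a', ha', hodd'⟩ := exists_oddForm_dOmega D (n + 1)
  obtain ⟨b, hb, heven⟩ := exists_evenForm_dOmega D (n + 1)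
  have h1 := alt₁_evenForm T
  have h2 := alt₂_evenForm T
  have hd : d₁ (evenForm (n + 2) T) = 0 := by
    have h := hodd T
    rw [hT] at h
    exact (smul_eq_zero.1 h.symm).resolve_left ha
  -- The potential is $i_2i_1$ of a double average. It satisfies the Bianchi relation, so it comes
  -- from a field of degree $2(n+1)$, and $d_1d_2$ of it is the biform of $T$.
  have hU := d₁_d₂_i₂_i₁_avg h1 h2 (s₂₁_evenForm T) hd
  set B : BiForm D (n + 2) (n + 2) :=
    map (avg (n + 1 + 1)) (map (avg (n + 1)) (evenForm (n + 2) T)) with hB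
  have hB1 : Alt₁ B := (h1.map _).map _
  have hB2 : Alt₂ B := (h2.map _).map _
  obtain ⟨V, hV⟩ := exists_evenForm_eq (isTwoCol_of_s₁₂_eq_zero (B := i₂ (i₁ B)) hB1.i₁.i₂ hB2.i₁.i₂
    (s₁₂_i₂_i₁ hB2 (by rw [hB, s₁₂_map, s₁₂_map, s₁₂_evenForm T, map_zero, map_zero])))
  have hdV : oddForm (n + 1) (dOmega 3 D (2 * (n + 1)) (a'⁻¹ • V)) = d₁ (i₂ (i₁ B)) := by
    rw [hodd', evenForm_smul, hV, map_smul, smul_smul, mul_inv_cancel₀ ha', one_smul]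
  -- On a $d_1$-image both $d_2$ and $d_1s_{21}$ give $d_1d_2$, because $s_{21}d_1=d_2-d_1s_{21}$
  -- and $d_1d_1=0$; this accounts for the factor $2$.
  have h3 := heven (dOmega 3 D (2 * (n + 1)) (a'⁻¹ • V)) (evenForm (n + 2) T)
    (hdV ▸ hB1.i₁.i₂.d₁) (isTwoCol_evenForm T) (by
      rw [hdV, s₂₁_d₁, map_sub, d₁_d₁, sub_zero, ← d₁_d₂, hU, two_smul])
  refine ⟨b⁻¹ • a'⁻¹ • V, ?_⟩
  rw [map_smul]
  exact dOmega_inv_smul (n := n + 1) hb h3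

/-- A form of positive even degree whose second derivative is zero is a derivative. -/
theorem exists_dOmega_eq (T : Omega 3 D (2 * (n + 1)))
    (hT : dOmega 3 D (2 * (n + 1) + 1) (dOmega 3 D (2 * (n + 1)) T) = 0) :
    ∃ U : Omega 3 D (2 * n + 1), dOmega 3 D (2 * n + 1) U = T := by
  obtain ⟨a, ha, hodd⟩ := exists_oddForm_dOmega D (n + 1)
  obtain ⟨a', ha', heven'⟩ := exists_evenForm_dOmega D (n + 1)
  obtain ⟨b, hb, heven⟩ := exists_evenForm_dOmega D n
  have h1 := alt₁_evenForm T
  have h2 := alt₂_evenForm T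
  have hs := s₁₂_evenForm T
  -- On even degree $d^2$ is a nonzero multiple of $d_1d_2$.
  have hd : d₁ (d₂ (evenForm (n + 1) T)) = 0 := by
    have hdT : oddForm (n + 1) (dOmega 3 D (2 * (n + 1)) (a⁻¹ • T)) = d₁ (evenForm (n + 1) T) := by
      rw [hodd, evenForm_smul, map_smul, smul_smul, mul_inv_cancel₀ ha, one_smul]
    have h := heven' (dOmega 3 D (2 * (n + 1)) (a⁻¹ • T)) (d₁ (d₂ (evenForm (n + 1) T)))
      (hdT ▸ h1.d₁) (isTwoCol_d₁_d₂ h1 h2 hs) (by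
        rw [hdT, s₂₁_d₁, map_sub, d₁_d₁, sub_zero, ← d₁_d₂, two_smul])
    rw [map_smul, map_smul, hT, smul_zero] at h
    exact (smul_eq_zero.1 h.symm).resolve_left ha'
  obtain ⟨S, hS⟩ : ∃ S, S = i₂ (map (avg n) (evenForm (n + 1) T))
    + i₂ (i₁ (map (avg n) (map (avg (n + 1)) (d₁ (evenForm (n + 1) T))))) := ⟨_, rfl⟩
  have hS1 : Alt₁ S := hS ▸ (h1.map _).i₂.add ((h1.d₁.map _).map _).i₁.i₂
  have hS2 : Alt₂ S := hS ▸ (h2.map _).i₂.add ((h2.d₁.map _).map _).i₁.i₂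
  -- $S$ must come from a field of odd degree. For $n=0$ the second column is empty and antisymmetry
  -- suffices; otherwise $s_{12}$ is checked to kill both summands.
  have hScol : IsTwoCol Sum.isRight (sumTensor S) := by
    cases n with
    | zero => exact isTwoCol_of_right_empty hS1
    | succ n =>
      refine isTwoCol_of_s₁₂_eq_zero hS1 hS2 ?_
      rw [hS, map_add, s₁₂_i₂ (h2.map _), s₁₂_map, hs, map_zero, map_zero, neg_zero, zero_add]
      refine s₁₂_i₂_i₁ ((h2.d₁.map _).map _) ?_
      rw [s₁₂_map, s₁₂_map, s₁₂_d₁, hs, map_zero, neg_zero, map_zero, map_zero]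
  obtain ⟨U, hU⟩ := exists_oddForm_eq hScol
  exact ⟨b⁻¹ • U, dOmega_inv_smul hb (heven U _ (hU ▸ hS1) (isTwoCol_evenForm T)
    (hU ▸ d₂_add_d₁_s₂₁ h1 h2 (s₂₁_evenForm T) hs hd hS))⟩

end NComplex

namespace NComplex

/-! ### Exactness in the generalized cohomology -/

section ExactSequences

variable {E : ℕ → Type*} [∀ p, AddCommGroup (E p)] [∀ p, Module ℝ (E p)]
  (d : ∀ p, E p →ₗ[ℝ] E (p + 1)) {N : ℕ}

theorem dPow_eq_zero_of_heq {k p p' : ℕ} (hp : p = p') {T : E p} {T' : E p'} (h : HEq T T')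
    (h0 : dPow d k p T = 0) : dPow d k p' T' = 0 := by
  subst hp
  rwa [← eq_of_heq h]

theorem dPow_dPow_eq_zero_iff {j k p : ℕ} {T : E p} :
    dPow d k (p + j) (dPow d j p T) = 0 ↔ dPow d (j + k) p T = 0 := by
  refine ⟨fun h => ?_, dPow_dPow_eq_zero d⟩
  have h1 := dPow_dPow_heq d j k p T
  rw [h] at h1
  generalize dPow d (j + k) p T = a at h1 ⊢
  clear h
  revert a
  rw [← Nat.add_assoc p j k]
  intro a h
  exact (eq_of_heq h).symm

theorem iPow_mk_eq_zero_iff {p k k' : ℕ} (h : k ≤ k') (T : LinearMap.ker (dPow d k p)) :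
    iPow d N p h (Submodule.Quotient.mk T) = 0 ↔ T.1 ∈ dImage d (N - k') p :=
  Submodule.Quotient.mk_eq_zero _

theorem hdPow_mk_eq_zero_iff {p j k k' : ℕ} (h : k' + j = k) (T : LinearMap.ker (dPow d k p)) :
    hdPow d N p j h (Submodule.Quotient.mk T) = 0 ↔ dPow d j p T.1 ∈ dImage d (N - k') (p + j) :=
  Submodule.Quotient.mk_eq_zero _

theorem iPow_mk_eq_mk_iff {p k k' : ℕ} (h : k ≤ k') (S : LinearMap.ker (dPow d k p))
    (T : LinearMap.ker (dPow d k' p)) :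
    iPow d N p h (Submodule.Quotient.mk S) = Submodule.Quotient.mk T
      ↔ S.1 - T.1 ∈ dImage d (N - k') p :=
  Submodule.Quotient.eq _

theorem hdPow_mk_eq_mk_iff {p j k k' : ℕ} (h : k' + j = k) (S : LinearMap.ker (dPow d k p))
    (T : LinearMap.ker (dPow d k' (p + j))) :
    hdPow d N p j h (Submodule.Quotient.mk S) = Submodule.Quotient.mk T
      ↔ dPow d j p S.1 - T.1 ∈ dImage d (N - k') (p + j) :=
  Submodule.Quotient.eq _

theorem dImage_add_eq (m q : ℕ) {T : E (q + m)} :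
    T ∈ dImage d m (q + m) ↔ ∃ S, dPow d m q S = T := by
  rw [dImage_add]
  rfl

/-- Below degree $N-k'$ the denominator of the target is zero, so a class with zero image has zero
representative. -/
theorem iPow_injective_of_lt {p k k' : ℕ} (h : k ≤ k') (hp : p < N - k') :
    Function.Injective (iPow d N p h) := by
  rw [injective_iff_map_eq_zero]
  intro x hx
  obtain ⟨T, rfl⟩ := Submodule.Quotient.mk_surjective _ x
  rw [iPow_mk_eq_zero_iff, dImage_of_lt _ _ _ hp, Submodule.mem_bot] at hx
  rw [show T = 0 from Subtype.ext hx]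
  exact Submodule.Quotient.mk_zero _

/-- The bound makes the denominators of the second and third terms zero; what is left is the kernel
of $d^\ell$ on both sides. -/
theorem exact_iPow_hdPow {p ℓ k k' : ℕ} (h : ℓ ≤ k) (h' : k' + ℓ = k) (hp : p + ℓ < N - k') :
    Function.Exact (iPow d N p h) (hdPow d N p ℓ h') := by
  intro x
  obtain ⟨T, rfl⟩ := Submodule.Quotient.mk_surjective _ x
  rw [hdPow_mk_eq_zero_iff, dImage_of_lt _ _ _ hp, Submodule.mem_bot]
  constructor
  · intro hT
    exact ⟨Submodule.Quotient.mk ⟨T.1, hT⟩, rfl⟩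
  · rintro ⟨y, hy⟩
    obtain ⟨S, rfl⟩ := Submodule.Quotient.mk_surjective _ y
    have h1 := (iPow_mk_eq_mk_iff d h S T).1 hy
    rw [dImage_of_lt _ _ _ (by omega), Submodule.mem_bot, sub_eq_zero] at h1
    rw [← h1]
    exact S.2

/-- The denominator of the target is the image of $d^\ell$. A representative $d^\ell S$ killed by
$d^{k'}$ has $d^kS=0$; conversely the image of $d^{N-k'}$ lies in that of $d^\ell$. -/
theorem exact_hdPow_iPow {p ℓ k k' k'' : ℕ} (h : k' + ℓ = k) (h' : k' ≤ k'') (hN : N - k'' = ℓ) :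
    Function.Exact (hdPow d N p ℓ h) (iPow d N (p + ℓ) h') := by
  intro x
  obtain ⟨T, rfl⟩ := Submodule.Quotient.mk_surjective _ x
  rw [iPow_mk_eq_zero_iff, hN, dImage_add_eq]
  constructor
  · rintro ⟨S, hS⟩
    have h1 : dPow d k p S = 0 := by
      obtain rfl : k = ℓ + k' := by omega
      rw [← dPow_dPow_eq_zero_iff, hS]
      exact T.2
    refine ⟨Submodule.Quotient.mk ⟨S, h1⟩, ?_⟩
    exact congrArg Submodule.Quotient.mk (Subtype.ext hS)
  · rintro ⟨y, hy⟩
    obtain ⟨S, rfl⟩ := Submodule.Quotient.mk_surjective _ y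
    have h1 := (hdPow_mk_eq_mk_iff d h S T).1 hy
    have h2 := dImage_anti d (by omega : ℓ ≤ N - k') (p + ℓ) h1
    rw [dImage_add_eq] at h2
    obtain ⟨U, hU⟩ := h2
    exact ⟨S.1 - U, by rw [map_sub, hU, sub_sub_cancel]⟩

theorem iPow_surjective_of {p k k' m : ℕ} (h : k ≤ k') (hN : N - k' = m)
    (H : ∀ T : E (p + m), dPow d k' (p + m) T = 0 →
      ∃ S, dPow d k (p + m) (T - dPow d m p S) = 0) :
    Function.Surjective (iPow d N (p + m) h) := by
  intro x
  obtain ⟨T, rfl⟩ := Submodule.Quotient.mk_surjective _ x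
  obtain ⟨S, hS⟩ := H T.1 T.2
  refine ⟨Submodule.Quotient.mk ⟨_, hS⟩, (Submodule.Quotient.eq _).2 ?_⟩
  change T.1 - dPow d m p S - T.1 ∈ dImage d (N - k') (p + m)
  rw [hN, dImage_add_eq]
  exact ⟨-S, by rw [map_neg, sub_sub_cancel_left]⟩

/-- Apply the hypothesis to $d^sT$, which is killed by $d^k$, and write it as $d^s(d^\ell S)$. The
degrees $q+\ell+s$ and $q+(\ell+s)$ are not the same type index, hence `HEq`. -/
theorem exists_dPow_sub_eq_zero {q ℓ s k : ℕ}
    (H : ∀ T : E (q + (ℓ + s)), dPow d k _ T = 0 → ∃ S, dPow d (ℓ + s) q S = T)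
    (T : E (q + ℓ)) (hT : dPow d (s + k) (q + ℓ) T = 0) :
    ∃ S, dPow d s (q + ℓ) (T - dPow d ℓ q S) = 0 := by
  rw [← dPow_dPow_eq_zero_iff] at hT
  obtain ⟨W, hW⟩ : ∃ W : E (q + (ℓ + s)), HEq (dPow d s (q + ℓ) T) W := by
    rw [← Nat.add_assoc]
    exact ⟨_, HEq.rfl⟩
  obtain ⟨S, hS⟩ := H W (dPow_eq_zero_of_heq d (Nat.add_assoc _ _ _) hW hT)
  refine ⟨S, ?_⟩
  rw [map_sub, sub_eq_zero]
  refine eq_of_heq (hW.trans ?_)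
  rw [← hS]
  exact (dPow_dPow_heq d ℓ s q S).symm

/-- Injectivity: if $T=dS$ and $dT=0$, then $S=dU$ by `H2`, so $T=d^2U$. Surjectivity: if $d^2T=0$,
then $dT=d^2V$ by `H1`, and $T-dV$ is a closed representative of the same class. -/
theorem iPow_bijective_of {p : ℕ} (h : 1 ≤ 2)
    (H1 : ∀ T : E (p + 3), d (p + 3) T = 0 → ∃ V, d (p + 2) (d (p + 1) V) = T)
    (H2 : ∀ T : E (p + 1), d (p + 2) (d (p + 1) T) = 0 → ∃ U, d p U = T) :
    Function.Bijective (iPow d 3 (p + 2) h) := by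
  constructor
  · rw [injective_iff_map_eq_zero]
    intro x hx
    obtain ⟨T, rfl⟩ := Submodule.Quotient.mk_surjective _ x
    rw [iPow_mk_eq_zero_iff, show 3 - 2 = 1 from rfl, dImage_add_eq d 1 (p + 1)] at hx
    obtain ⟨S, hS⟩ := hx
    have hT : d (p + 2) T.1 = 0 := T.2
    change d (p + 1) S = T.1 at hS
    rw [← hS] at hT
    obtain ⟨U, hU⟩ := H2 S hT
    refine (Submodule.Quotient.mk_eq_zero _).2 ?_
    change T.1 ∈ dImage d 2 (p + 2)
    rw [dImage_add_eq]
    exact ⟨U, by rw [← hS, ← hU]; rfl⟩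
  · refine iPow_surjective_of d (p := p + 1) (m := 1) _ rfl fun T hT => ?_
    obtain ⟨V, hV⟩ := H1 (d (p + 2) T) hT
    refine ⟨V, ?_⟩
    change d (p + 2) (T - d (p + 1) V) = 0
    rw [map_sub, hV, sub_self]

end ExactSequences

theorem iPow_surjective_dOmega (D N k ℓ : ℕ) (hk : 1 ≤ k) (hℓ : 1 ≤ ℓ) (hkℓ : k + ℓ ≤ N - 1)
    (h : N - k - ℓ ≤ N - ℓ) :
    Function.Surjective (iPow (dOmega N D) N (k - 1 + ℓ) h) := by
  refine iPow_surjective_of _ _ (by omega) fun T hT => ?_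
  obtain ⟨q, rfl⟩ : ∃ q, k = q + 1 := ⟨k - 1, by omega⟩
  -- With $q=k-1$ and $s=N-k-\ell$, the critical degree $N-1$ is $q+(\ell+s)$.
  obtain ⟨s, rfl⟩ : ∃ s, N = q + (ℓ + s) + 1 := ⟨N - 1 - q - ℓ, by omega⟩
  rw [show q + (ℓ + s) + 1 - ℓ = s + (q + 1) by omega] at hT
  rw [show q + (ℓ + s) + 1 - (q + 1) - ℓ = s by omega]
  exact exists_dPow_sub_eq_zero (dOmega (q + (ℓ + s) + 1) D) (q := q) (ℓ := ℓ) (s := s) (k := q + 1)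
    (fun T hT => mem_range_dPow_of_dPow_eq_zero q (ℓ + s) (by omega) T hT) T hT

end NComplex

/-! ### The exact sequences and the isomorphisms for $N=3$. -/

theorem mainTheorem4 (D : ℕ) :
    (∀ (N k ℓ : ℕ) (_hk : 1 ≤ k) (_hℓ : 1 ≤ ℓ) (hkℓ : k + ℓ ≤ N - 1),
      Function.Injective
        (NComplex.iPow (NComplex.dOmega N D) N (k - 1) (show ℓ ≤ N - k by omega)) ∧
      Function.Exact
        (NComplex.iPow (NComplex.dOmega N D) N (k - 1) (show ℓ ≤ N - k by omega))
        (NComplex.hdPow (NComplex.dOmega N D) N (k - 1) ℓ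
          (show (N - k - ℓ) + ℓ = N - k by omega)) ∧
      Function.Exact
        (NComplex.hdPow (NComplex.dOmega N D) N (k - 1) ℓ
          (show (N - k - ℓ) + ℓ = N - k by omega))
        (NComplex.iPow (NComplex.dOmega N D) N (k - 1 + ℓ)
          (show N - k - ℓ ≤ N - ℓ by omega)) ∧
      Function.Surjective
        (NComplex.iPow (NComplex.dOmega N D) N (k - 1 + ℓ)
          (show N - k - ℓ ≤ N - ℓ by omega))) ∧
    (∀ n : ℕ, 1 ≤ n →
      Function.Bijective
        (NComplex.iPow (NComplex.dOmega 3 D) 3 (2 * n + 1) (show 1 ≤ 2 by omega))) := by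
  refine ⟨fun N k ℓ hk hℓ hkℓ => ⟨?_, ?_, ?_, ?_⟩, fun n hn => ?_⟩
  -- The degree $k-1$ is below $N-(N-k)=k$; in the next claim $k-1+\ell$ is below
  -- $N-(N-k-\ell)=k+\ell$.
  · exact NComplex.iPow_injective_of_lt _ _ (by omega)
  · exact NComplex.exact_iPow_hdPow _ _ _ (by omega)
  · exact NComplex.exact_hdPow_iPow _ _ _ (by omega)
  · exact NComplex.iPow_surjective_dOmega D N k ℓ hk hℓ hkℓ _
  · obtain ⟨n, rfl⟩ : ∃ m, n = m + 1 := ⟨n - 1, by omega⟩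
    -- After the shift of $n$ the cohomology has degree $p+2=2(n+1)+1$; the two obligations concern
    -- the neighbouring even degrees $2(n+2)$ and $2(n+1)$.
    refine NComplex.iPow_bijective_of (NComplex.dOmega 3 D) (p := 2 * n + 1) _ ?_ ?_
    · exact NComplex.exists_dOmega_dOmega_eq (n := n)
    · exact NComplex.exists_dOmega_eq (n := n)
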